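/- Let $n\ge 2$ and let $\mathcal P_n$ be the partition monoid of degree $n$: its elements are the set partitions of $\{1,\dots,n\}\cup\{1',\dots,n'\}$, and $x,y$ lie in the same block of $\alpha\beta$ if and only if they are connected by a path in the graph obtained by stacking $\alpha$ above $\beta$, identifying the lower vertices of $\alpha$ with the upper vertices of $\beta$. Let $\alpha^*$ be the partition obtained from $\alpha$ by interchanging $i$ and $i'$ for all $i$. A $*$-congruence is a congruence $\xi$ with $(\alpha,\beta)\in\xi\Rightarrow(\alpha^*,\beta^*)\in\xi$; write $\mathrm{Cong}(\mathcal P_n)$ and $\mathrm{Cong}^*(\mathcal P_n)$ for the lattices of all congruences and of all $*$-congruences, ordered by inclusion. Let $\mathrm{rank}(\alpha)$ be the number of blocks of $\alpha$ that meet both rows, let $I_q=\{\alpha:\mathrm{rank}(\alpha)\le q\}$ and $J_q=\{\alpha:\mathrm{rank}(\alpha)=q\}$, let $\widehat\alpha$ be the partition of rank $0$ with the same kernel and cokernel as $\alpha$ (each block that meets both rows is cut into its upper and its lower part), let $\mathscr L,\mathscr R,\mathscr H=\mathscr L\cap\mathscr R$ be Green's relations and $\Delta$ the equality relation on $\mathcal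 P_n$. For $\sigma$ in the symmetric group $\mathcal S_q$, $q\le n$, let $\overline\sigma\in\mathcal P_n$ have the blocks $\{i,(i\sigma)'\}$ for $1\le i\le q$, all other blocks being singletons. For a normal subgroup $N$ of $\mathcal S_q$ put $$\nu_N=\{(\gamma\overline\sigma\delta,\gamma\overline\tau\delta)\in J_q\times J_q:\ \sigma,\tau\in N,\ \gamma,\delta\in\mathcal P_n\},$$ and define $R_q=\Delta\cup(I_q\times I_q)$ for $0\le q\le n$ and $R_N=\Delta\cup\nu_N\cup(I_{q-1}\times I_{q-1})$ for $1\le q\le n$ and $N$ normal in $\mathcal S_q$. Moreover, for $(q,N)$ equal to $(1,\{\mathrm{id}\})$, $(2,\{\mathrm{id}\})$, $(2,\mathcal S_2)$, with the subscript $0$, $1$, $\mathcal S_2$ respectively, let $$\Delta\cup\nu_N\cup\{(\alpha,\beta)\in I_{q-1}\times I_{q-1}:(\widehat\alpha,\widehat\beta)\in\mathscr K\}$$ be denoted by $\lambda$, $\rho$, $\mu$ according as $\mathscr K=\mathscr L,\mathscr R,\mathscr H$; this gives nine relations $\lambda_i,\rho_i,\mu_i$ with $i\in\{0,1,\mathcal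 S_2\}$. Then the following hold. (1) The relations $R_q$ ($0\le q\le n$), $R_N$ ($2\le q\le n$, $N$ a nontrivial normal subgroup of $\mathcal S_q$), and $\lambda_i,\rho_i,\mu_i$ ($i\in\{0,1,\mathcal S_2\}$) are pairwise distinct congruences, and they are all the congruences of $\mathcal P_n$. (2) The Hasse diagram of $\mathrm{Cong}(\mathcal P_n)$ has exactly the following edges, where $\xi - \zeta$ means that $\zeta$ covers $\xi$: the edges of the four chains $\mu_0-\mu_1-\mu_{\mathcal S_2}$, $\lambda_0-\lambda_1-\lambda_{\mathcal S_2}$, $\rho_0-\rho_1-\rho_{\mathcal S_2}$, $R_0-R_1-R_{\mathcal S_2}$; the edges $\mu_i-\lambda_i$, $\mu_i-\rho_i$, $\lambda_i-R_i$, $\rho_i-R_i$ for $i\in\{0,1,\mathcal S_2\}$; and the edges of the chain $$R_{\mathcal S_2}-R_2-R_{\mathcal A_3}-R_{\mathcal S_3}-R_3-R_K-R_{\mathcal A_4}-R_{\mathcal S_4}-R_4-R_{\mathcal A_5}-R_{\mathcal S_5}-R_5-\cdots-R_{\mathcal S_n}-R_n$$ (ending at $R_n$), where $\mathcal A_q$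 is the alternating group and $K$ is the Klein four-group in $\mathcal S_4$. (3) $\mathrm{Cong}^*(\mathcal P_n)=\mathrm{Cong}(\mathcal P_n)\setminus\{\lambda_0,\lambda_1,\lambda_{\mathcal S_2},\rho_0,\rho_1,\rho_{\mathcal S_2}\}$. (4) The Hasse diagram of $\mathrm{Cong}^*(\mathcal P_n)$ has exactly the following edges: those of the chains $\mu_0-\mu_1-\mu_{\mathcal S_2}$ and $R_0-R_1-R_{\mathcal S_2}$, the edges $\mu_i-R_i$ for $i\in\{0,1,\mathcal S_2\}$, and the edges of the same chain from $R_{\mathcal S_2}$ to $R_n$ as in (2). -/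

import Mathlib

/-! ### The partition monoid -/

/-- An element of the partition monoid of degree `n`: a set partition of the `2 * n` vertices
`Fin n ⊕ Fin n`, given as an equivalence relation, the blocks being the equivalence classes.
`Sum.inl i` is the upper vertex `i` and `Sum.inr i` is the lower vertex `i'`. -/
@[ext]
structure PartitionMonoid (n : ℕ) where
  /-- being in the same block -/
  rel : Setoid (Fin n ⊕ Fin n)

namespace PartitionMonoid

section Product

/-- The edges of the product graph of `α` and `β`.  Its vertices are the three rows
`A` (upper), `B` (middle), `C` (lower); `α` is put on the rows `A, B`, and `β` on `B, C`. -/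
inductive ProductEdge {A B C : Type} (α : Setoid (A ⊕ B)) (β : Setoid (B ⊕ C)) :
    A ⊕ B ⊕ C → A ⊕ B ⊕ C → Prop
  | upper {x y : A ⊕ B} : α x y → ProductEdge α β (Sum.map id Sum.inl x) (Sum.map id Sum.inl y)
  | lower {x y : B ⊕ C} : β x y → ProductEdge α β (Sum.inr x) (Sum.inr y)

/-- Two vertices are connected by a path of the product graph. -/
def Connected {A B C : Type} (α : Setoid (A ⊕ B)) (β : Setoid (B ⊕ C)) :
    Setoid (A ⊕ B ⊕ C) :=
  Relation.EqvGen.setoid (ProductEdge α β)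

/-- The product: upper and lower vertices are in the same block if and only if they are connected
by a path of the product graph. -/
def product {A B C : Type} (α : Setoid (A ⊕ B)) (β : Setoid (B ⊕ C)) : Setoid (A ⊕ C) :=
  (Connected α β).comap (Sum.map id Sum.inr)

/-- Reflection of a partition in the horizontal axis. -/
def flip {A B : Type} (α : Setoid (A ⊕ B)) : Setoid (B ⊕ A) := α.comap Sum.swap

theorem flip_swap {A B : Type} (α : Setoid (A ⊕ B)) (x y : A ⊕ B) :
    flip α x.swap y.swap ↔ α x y := by
  change α x.swap.swap y.swap.swap ↔ α x y
  rw [Sum.swap_swap, Sum.swap_swap]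

theorem eqvGen_map {V W : Type} {r : V → V → Prop} {s : W → W → Prop} (f : V → W)
    (h : ∀ x y, r x y → Relation.EqvGen s (f x) (f y)) {x y : V}
    (hxy : Relation.EqvGen r x y) : Relation.EqvGen s (f x) (f y) := by
  induction hxy with
  | rel _ _ h' => exact h _ _ h'
  | refl _ => exact .refl _
  | symm _ _ _ ih => exact .symm _ _ ih
  | trans _ _ _ _ _ ih₁ ih₂ => exact .trans _ _ _ ih₁ ih₂

/-- Reversal of the order of three rows. -/
def rev {A B C : Type} : A ⊕ B ⊕ C → C ⊕ B ⊕ A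
  | .inl a => .inr (.inr a)
  | .inr (.inl b) => .inr (.inl b)
  | .inr (.inr c) => .inl c

theorem connected_rev {A B C : Type} (α : Setoid (A ⊕ B)) (β : Setoid (B ⊕ C))
    {x y : A ⊕ B ⊕ C} (h : Connected α β x y) :
    Connected (flip β) (flip α) (rev x) (rev y) := by
  refine eqvGen_map rev ?_ h
  rintro _ _ (⟨h⟩ | ⟨h⟩)
  · rename_i x y
    have : ProductEdge (flip β) (flip α) (Sum.inr x.swap) (Sum.inr y.swap) :=
      .lower ((flip_swap _ _ _).2 h)
    rcases x with x | x <;> rcases y with y | y <;> exact .rel _ _ this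
  · rename_i x y
    have : ProductEdge (flip β) (flip α) (Sum.map id Sum.inl x.swap) (Sum.map id Sum.inl y.swap) :=
      .upper ((flip_swap _ _ _).2 h)
    rcases x with x | x <;> rcases y with y | y <;> exact .rel _ _ this

theorem flip_flip {A B : Type} (α : Setoid (A ⊕ B)) : flip (flip α) = α := by
  ext x y
  change α x.swap.swap y.swap.swap ↔ α x y
  rw [Sum.swap_swap, Sum.swap_swap]

theorem flip_product {A B C : Type} (α : Setoid (A ⊕ B)) (β : Setoid (B ⊕ C)) :
    flip (product α β) = product (flip β) (flip α) := by
  ext x y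
  constructor
  · intro h
    have := connected_rev α β h
    rcases x with x | x <;> rcases y with y | y <;> exact this
  · intro h
    have := connected_rev (flip β) (flip α) h
    rw [flip_flip, flip_flip] at this
    rcases x with x | x <;> rcases y with y | y <;> exact this

/-- Edges of the graph on four rows for a product of three partitions. -/
inductive TripleEdge {A B C D : Type} (α : Setoid (A ⊕ B)) (β : Setoid (B ⊕ C))
    (γ : Setoid (C ⊕ D)) : A ⊕ B ⊕ C ⊕ D → A ⊕ B ⊕ C ⊕ D → Prop
  | upper {x y : A ⊕ B} : α x y →
      TripleEdge α β γ (Sum.map id Sum.inl x) (Sum.map id Sum.inl y)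
  | middle {x y : B ⊕ C} : β x y →
      TripleEdge α β γ (Sum.inr (Sum.map id Sum.inl x)) (Sum.inr (Sum.map id Sum.inl y))
  | lower {x y : C ⊕ D} : γ x y → TripleEdge α β γ (Sum.inr (Sum.inr x)) (Sum.inr (Sum.inr y))

/-- Inclusion of the first three of four rows. -/
def firstRows {A B C D : Type} : A ⊕ B ⊕ C → A ⊕ B ⊕ C ⊕ D :=
  Sum.map id (Sum.map id Sum.inl)

/-- Inclusion of all rows but the second. -/
def skipRow {A B C D : Type} : A ⊕ C ⊕ D → A ⊕ B ⊕ C ⊕ D := Sum.map id Sum.inr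

theorem product_product_iff {A B C D : Type} (α : Setoid (A ⊕ B)) (β : Setoid (B ⊕ C))
    (γ : Setoid (C ⊕ D)) (x y : A ⊕ C ⊕ D) :
    Connected (product α β) γ x y ↔
      Relation.EqvGen (TripleEdge α β γ) (skipRow x) (skipRow y) := by
  have hl : Function.Injective (firstRows : A ⊕ B ⊕ C → A ⊕ B ⊕ C ⊕ D) := by
    rintro (x | x | x) (y | y | y) h <;> simp_all [firstRows]
  have hk : Function.Injective (skipRow : A ⊕ C ⊕ D → A ⊕ B ⊕ C ⊕ D) := by
    rintro (x | x | x) (y | y | y) h <;> simp_all [skipRow]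
  constructor
  · intro h
    refine eqvGen_map skipRow ?_ h
    rintro _ _ (⟨h⟩ | ⟨h⟩)
    · rename_i x y
      have h2 : Relation.EqvGen (TripleEdge α β γ) (firstRows (Sum.map id Sum.inr x))
          (firstRows (Sum.map id Sum.inr y)) := by
        refine eqvGen_map firstRows ?_ h
        rintro _ _ (⟨h⟩ | ⟨h⟩)
        · rename_i x y
          have := TripleEdge.upper (β := β) (γ := γ) h
          rcases x with x | x <;> rcases y with y | y <;> exact .rel _ _ this
        · rename_i x y
          have := TripleEdge.middle (α := α) (γ := γ) h
          rcases x with x | x <;> rcases y with y | y <;> exact .rel _ _ this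
      rcases x with x | x <;> rcases y with y | y <;> exact h2
    · exact .rel _ _ (.lower h)
  · intro h
    set G := Connected (product α β) γ with hG
    let S : A ⊕ B ⊕ C ⊕ D → A ⊕ B ⊕ C ⊕ D → Prop := fun u v =>
      u = v ∨ ∃ x y, u = firstRows x ∧ v = firstRows y ∧ Connected α β x y
    have Srefl : ∀ u, S u u := fun u => Or.inl rfl
    have Ssymm : ∀ u v, S u v → S v u := by
      rintro u v (h | ⟨x, y, hx, hy, h⟩)
      · exact Or.inl h.symm
      · exact Or.inr ⟨y, x, hy, hx, (Connected α β).symm h⟩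
    have Strans : ∀ u v w, S u v → S v w → S u w := by
      rintro u v w (rfl | ⟨x, y, rfl, rfl, h⟩) h2
      · exact h2
      · rcases h2 with rfl | ⟨y', z, hy, rfl, h2⟩
        · exact Or.inr ⟨x, y, rfl, rfl, h⟩
        · obtain rfl := hl hy
          exact Or.inr ⟨x, z, rfl, rfl, (Connected α β).trans h h2⟩
    have key : ∀ w w', S (skipRow w) (skipRow w') → G w w' := by
      have aux : ∀ (w : A ⊕ C ⊕ D) (x : A ⊕ B ⊕ C), skipRow w = firstRows x →
          ∃ z : A ⊕ C, w = Sum.map id Sum.inl z ∧ x = Sum.map id Sum.inr z := by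
        rintro (w | w | w) (x | x | x) h <;> simp [skipRow, firstRows] at h
        · exact ⟨.inl w, rfl, by simp [h]⟩
        · exact ⟨.inr w, rfl, by simp [h]⟩
      rintro w w' (h | ⟨x, y, hx, hy, h⟩)
      · rw [hk h]
      · obtain ⟨z, rfl, rfl⟩ := aux w x hx
        obtain ⟨z', rfl, rfl⟩ := aux w' y hy
        exact .rel _ _ (.upper h)
    have main : ∀ u v, Relation.EqvGen (TripleEdge α β γ) u v →
        S u v ∨ ∃ w w', S u (skipRow w) ∧ G w w' ∧ S (skipRow w') v := by
      intro u v h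
      induction h with
      | rel _ _ h =>
        rcases h with ⟨h⟩ | ⟨h⟩ | ⟨h⟩
        · rename_i x y
          have h2 : Connected α β _ _ := .rel _ _ (ProductEdge.upper (β := β) h)
          refine Or.inl (Or.inr ⟨_, _, ?_, ?_, h2⟩)
          · rcases x with x | x <;> rfl
          · rcases y with y | y <;> rfl
        · rename_i x y
          have h2 : Connected α β _ _ := .rel _ _ (ProductEdge.lower (α := α) h)
          refine Or.inl (Or.inr ⟨_, _, ?_, ?_, h2⟩)
          · rcases x with x | x <;> rfl
          · rcases y with y | y <;> rfl
        · exact Or.inr ⟨_, _, Srefl _, .rel _ _ (.lower h), Srefl _⟩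
      | refl u => exact Or.inl (Srefl u)
      | symm u v _ ih =>
        rcases ih with h | ⟨w, w', h1, h2, h3⟩
        · exact Or.inl (Ssymm _ _ h)
        · exact Or.inr ⟨w', w, Ssymm _ _ h3, G.symm h2, Ssymm _ _ h1⟩
      | trans u v t _ _ ih1 ih2 =>
        rcases ih1 with h | ⟨w, w', h1, h2, h3⟩
        · rcases ih2 with h' | ⟨z, z', h1', h2', h3'⟩
          · exact Or.inl (Strans _ _ _ h h')
          · exact Or.inr ⟨z, z', Strans _ _ _ h h1', h2', h3'⟩
        · rcases ih2 with h' | ⟨z, z', h1', h2', h3'⟩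
          · exact Or.inr ⟨w, w', h1, h2, Strans _ _ _ h3 h'⟩
          · exact Or.inr ⟨w, z', h1,
              G.trans (G.trans h2 (key _ _ (Strans _ _ _ h3 h1'))) h2', h3'⟩
    rcases main _ _ h with h | ⟨w, w', h1, h2, h3⟩
    · exact key _ _ h
    · exact G.trans (G.trans (key _ _ h1) h2) (key _ _ h3)

/-- Reversal of the order of four rows. -/
def revFour {A B C D : Type} : A ⊕ B ⊕ C ⊕ D → D ⊕ C ⊕ B ⊕ A
  | .inl a => .inr (.inr (.inr a))
  | .inr (.inl b) => .inr (.inr (.inl b))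
  | .inr (.inr (.inl c)) => .inr (.inl c)
  | .inr (.inr (.inr d)) => .inl d

theorem triple_rev {A B C D : Type} (α : Setoid (A ⊕ B)) (β : Setoid (B ⊕ C))
    (γ : Setoid (C ⊕ D)) {x y : A ⊕ B ⊕ C ⊕ D}
    (h : Relation.EqvGen (TripleEdge α β γ) x y) :
    Relation.EqvGen (TripleEdge (flip γ) (flip β) (flip α)) (revFour x) (revFour y) := by
  refine eqvGen_map revFour ?_ h
  rintro _ _ (⟨h⟩ | ⟨h⟩ | ⟨h⟩)
  · rename_i x y
    have := TripleEdge.lower (α := flip γ) (β := flip β) (γ := flip α) (x := x.swap)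
      (y := y.swap) ((flip_swap _ _ _).2 h)
    rcases x with x | x <;> rcases y with y | y <;> exact .rel _ _ this
  · rename_i x y
    have := TripleEdge.middle (α := flip γ) (β := flip β) (γ := flip α) (x := x.swap)
      (y := y.swap) ((flip_swap _ _ _).2 h)
    rcases x with x | x <;> rcases y with y | y <;> exact .rel _ _ this
  · rename_i x y
    have := TripleEdge.upper (α := flip γ) (β := flip β) (γ := flip α) (x := x.swap)
      (y := y.swap) ((flip_swap _ _ _).2 h)
    rcases x with x | x <;> rcases y with y | y <;> exact .rel _ _ this

theorem product_assoc {A B C D : Type} (α : Setoid (A ⊕ B)) (β : Setoid (B ⊕ C))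
    (γ : Setoid (C ⊕ D)) : product (product α β) γ = product α (product β γ) := by
  have h1 : product α (product β γ)
      = flip (product (product (flip γ) (flip β)) (flip α)) := by
    rw [← flip_product, ← flip_product, flip_flip]
  rw [h1]
  ext x y
  have h2 := product_product_iff α β γ (Sum.map id Sum.inr x) (Sum.map id Sum.inr y)
  have h3 := product_product_iff (flip γ) (flip β) (flip α)
    (Sum.map id Sum.inr x.swap) (Sum.map id Sum.inr y.swap)
  refine h2.trans (Iff.trans ?_ h3.symm)
  constructor
  · intro h
    have := triple_rev α β γ h
    rcases x with x | x <;> rcases y with y | y <;> exact this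
  · intro h
    have := triple_rev _ _ _ h
    simp only [flip_flip] at this
    rcases x with x | x <;> rcases y with y | y <;> exact this

/-- The identity partition, with blocks `{i, i'}`. -/
def identity (A : Type) : Setoid (A ⊕ A) := Setoid.ker (Sum.elim id id)

theorem flip_identity (A : Type) : flip (identity A) = identity A := by
  ext x y
  rcases x with x | x <;> rcases y with y | y <;> rfl

theorem identity_product {A B : Type} (α : Setoid (A ⊕ B)) : product (identity A) α = α := by
  ext x y
  constructor
  · intro h
    have h2 : Relation.EqvGen α (Sum.elim Sum.inl id (Sum.map id Sum.inr x : A ⊕ A ⊕ B))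
        (Sum.elim Sum.inl id (Sum.map id Sum.inr y : A ⊕ A ⊕ B)) := by
      refine eqvGen_map (Sum.elim Sum.inl id : A ⊕ A ⊕ B → A ⊕ B) ?_ h
      rintro _ _ (⟨h⟩ | ⟨h⟩)
      · rename_i x y
        have h' : Sum.elim id id x = Sum.elim id id y := h
        rcases x with x | x <;> rcases y with y | y <;>
          (simp at h'; subst h'; exact .refl _)
      · exact .rel _ _ h
    have h3 : ∀ {a b : A ⊕ B}, Relation.EqvGen α a b → α a b := by
      intro a b h
      exact α.iseqv.eqvGen_iff.1 h
    have := h3 h2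
    rcases x with x | x <;> rcases y with y | y <;> exact this
  · intro h
    have e : ∀ x : A ⊕ B, Connected (identity A) α (Sum.map id Sum.inr x) (Sum.inr x) := by
      rintro (x | x)
      · exact .rel _ _ (ProductEdge.upper (x := Sum.inl x) (y := Sum.inr x) rfl)
      · exact .refl _
    exact .trans _ _ _ (e x) (.trans _ _ _ (.rel _ _ (.lower h)) (.symm _ _ (e y)))

theorem product_identity {A B : Type} (α : Setoid (A ⊕ B)) : product α (identity B) = α := by
  rw [← flip_flip (product α (identity B)), flip_product, flip_identity, identity_product,
    flip_flip]

end Product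

instance (n : ℕ) : Monoid (PartitionMonoid n) where
  mul α β := ⟨product α.rel β.rel⟩
  one := ⟨identity (Fin n)⟩
  mul_assoc α β γ := PartitionMonoid.ext (product_assoc α.rel β.rel γ.rel)
  one_mul α := PartitionMonoid.ext (identity_product α.rel)
  mul_one α := PartitionMonoid.ext (product_identity α.rel)

/-- The involution `α ↦ α*`, which swaps the upper and the lower row. -/
instance (n : ℕ) : StarMul (PartitionMonoid n) where
  star α := ⟨flip α.rel⟩
  star_involutive α := PartitionMonoid.ext (flip_flip α.rel)
  star_mul α β := PartitionMonoid.ext (flip_product α.rel β.rel)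

/-- The rank: the number of transversals, that is, of blocks that contain both an upper and a
lower vertex. -/
noncomputable def rank {n : ℕ} (α : PartitionMonoid n) : ℕ :=
  {A ∈ α.rel.classes | (∃ i, Sum.inl i ∈ A) ∧ ∃ j, Sum.inr j ∈ A}.ncard

/-- The partition `α̂` of rank `0` with the same kernel and cokernel as `α`: every transversal is
cut into its upper and its lower part. -/
def hat {n : ℕ} (α : PartitionMonoid n) : PartitionMonoid n :=
  ⟨α.rel ⊓ Setoid.ker Sum.isLeft⟩

/-- For a permutation `σ` of the first `q ≤ n` points, the partition whose transversals are
`{i, (σ i)'}` for `i` among the first `q` points, all other blocks being singletons. -/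
def bar {n q : ℕ} (σ : Equiv.Perm (Fin q)) : PartitionMonoid n :=
  ⟨Setoid.ker (fun x : Fin n ⊕ Fin n =>
    (match x with
    | .inl i => if h : (i : ℕ) < q then Sum.inl (σ ⟨i, h⟩) else Sum.inr x
    | .inr j => if h : (j : ℕ) < q then Sum.inl ⟨j, h⟩ else Sum.inr x :
      Fin q ⊕ (Fin n ⊕ Fin n)))⟩

end PartitionMonoid

/-! ### Green's relations -/

/-- Green's relation `ℒ` of a monoid: `a` and `b` generate the same left ideal. -/
def GreenL {S : Type*} [Monoid S] (a b : S) : Prop :=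
  Set.range (fun s : S => s * a) = Set.range (fun s : S => s * b)

/-- Green's relation `ℛ` of a monoid: `a` and `b` generate the same right ideal. -/
def GreenR {S : Type*} [Monoid S] (a b : S) : Prop :=
  Set.range (fun s : S => a * s) = Set.range (fun s : S => b * s)

/-- Green's relation `ℋ = ℒ ∩ ℛ`. -/
def GreenH {S : Type*} [Monoid S] (a b : S) : Prop := GreenL a b ∧ GreenR a b

/-! ### The relations `R_q`, `R_N`, `λ`, `ρ`, `μ` -/

namespace PartitionMonoid

/-- The Rees relation `R_q` of the ideal `I_q` of partitions of rank at most `q`. -/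
def reesRel (n q : ℕ) (α β : PartitionMonoid n) : Prop :=
  α = β ∨ (α.rank ≤ q ∧ β.rank ≤ q)

/-- The relation `ν_N` on the set of partitions of rank `q`, for a subgroup `N` of the symmetric
group of degree `q`. -/
def nuRel (n : ℕ) {q : ℕ} (N : Subgroup (Equiv.Perm (Fin q))) (α β : PartitionMonoid n) : Prop :=
  α.rank = q ∧ β.rank = q ∧ ∃ σ ∈ N, ∃ τ ∈ N, ∃ γ δ : PartitionMonoid n,
    α = γ * bar σ * δ ∧ β = γ * bar τ * δ

/-- `R_N = Δ ∪ ν_N ∪ (I × I)`, where `I` is the ideal of partitions of rank less than `q`. -/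
def normalRel (n : ℕ) {q : ℕ} (N : Subgroup (Equiv.Perm (Fin q)))
    (α β : PartitionMonoid n) : Prop :=
  α = β ∨ nuRel n N α β ∨ (α.rank < q ∧ β.rank < q)

/-- `Δ ∪ ν_N ∪ {(α, β) ∈ I × I : (α̂, β̂) ∈ ξ}`, where `I` is the ideal of partitions of rank less
than `q`. -/
def liftRel (n : ℕ) {q : ℕ} (N : Subgroup (Equiv.Perm (Fin q)))
    (ξ : PartitionMonoid n → PartitionMonoid n → Prop) (α β : PartitionMonoid n) : Prop :=
  α = β ∨ nuRel n N α β ∨ (α.rank < q ∧ β.rank < q ∧ ξ α.hat β.hat)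

/-- The three subscripts `0`, `1`, `𝒮₂` of the relations `λ`, `ρ`, `μ`. -/
inductive Level
  | zero
  | one
  | symTwo

/-- The degree `q` belonging to a subscript: the ideal is that of rank less than `q`. -/
def Level.degree : Level → ℕ
  | .zero => 1
  | .one => 2
  | .symTwo => 2

/-- The normal subgroup belonging to a subscript. -/
def Level.group : (i : Level) → Subgroup (Equiv.Perm (Fin i.degree))
  | .zero => ⊥
  | .one => ⊥
  | .symTwo => ⊤

/-- `Level.Step i j`: the subscript `j` comes directly after `i`. -/
inductive Level.Step : Level → Level → Prop
  | zero_one : Level.Step .zero .one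
  | one_symTwo : Level.Step .one .symTwo

/-- Names of the congruences of the partition monoid of degree `n`. -/
inductive CongName (n : ℕ) : Type
  /-- `R_q`, for `0 ≤ q ≤ n` -/
  | rees (q : ℕ) (hqn : q ≤ n)
  /-- `R_N`, for a nontrivial normal subgroup `N` of the symmetric group of degree `q`, where
  `2 ≤ q ≤ n` -/
  | normal (q : ℕ) (h2q : 2 ≤ q) (hqn : q ≤ n) (N : Subgroup (Equiv.Perm (Fin q)))
      (hN : N.Normal) (hN' : N ≠ ⊥)
  /-- `λ_0`, `λ_1`, `λ_{𝒮₂}` -/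
  | lam (i : Level)
  /-- `ρ_0`, `ρ_1`, `ρ_{𝒮₂}` -/
  | rho (i : Level)
  /-- `μ_0`, `μ_1`, `μ_{𝒮₂}` -/
  | mu (i : Level)

/-- The relation with a given name. -/
def CongName.toRel {n : ℕ} : CongName n → PartitionMonoid n → PartitionMonoid n → Prop
  | .rees q _ => reesRel n q
  | .normal _ _ _ N _ _ => normalRel n N
  | .lam i => liftRel n i.group GreenL
  | .rho i => liftRel n i.group GreenR
  | .mu i => liftRel n i.group GreenH

/-- The Klein four-group in the symmetric group of degree `4`. -/
def klein : Subgroup (Equiv.Perm (Fin 4)) :=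
  Subgroup.closure {Equiv.swap 0 1 * Equiv.swap 2 3, Equiv.swap 0 2 * Equiv.swap 1 3}

/-- `R_0`, `R_1`, `R_{𝒮₂}`. -/
def CongName.top {n : ℕ} (hn : 2 ≤ n) : Level → CongName n
  | .zero => .rees 0 (Nat.zero_le n)
  | .one => .rees 1 (by omega)
  | .symTwo => .normal 2 le_rfl hn ⊤ inferInstance top_ne_bot

/-- The edges, from the lower to the upper end, of the chain
`R_{𝒮₂} ⊂ R_2 ⊂ R_{𝒜₃} ⊂ R_{𝒮₃} ⊂ R_3 ⊂ R_K ⊂ R_{𝒜₄} ⊂ R_{𝒮₄} ⊂ R_4 ⊂ R_{𝒜₅} ⊂ R_{𝒮₅} ⊂ R_5 ⊂ ⋯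
⊂ R_{𝒮ₙ} ⊂ R_n`. -/
inductive WickEdge {n : ℕ} : CongName n → CongName n → Prop
  | sym_rees (q : ℕ) (h2q : 2 ≤ q) (hqn : q ≤ n) (hN : (⊤ : Subgroup (Equiv.Perm (Fin q))).Normal)
      (hN' : (⊤ : Subgroup (Equiv.Perm (Fin q))) ≠ ⊥) :
      WickEdge (.normal q h2q hqn ⊤ hN hN') (.rees q hqn)
  | rees_alt (q : ℕ) (h2q : 2 ≤ q) (hq3 : q ≠ 3) (hqn : q ≤ n) (h2q' : 2 ≤ q + 1)
      (hqn' : q + 1 ≤ n) (hN : (alternatingGroup (Fin (q + 1))).Normal)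
      (hN' : alternatingGroup (Fin (q + 1)) ≠ ⊥) :
      WickEdge (.rees q hqn)
        (.normal (q + 1) h2q' hqn' (alternatingGroup (Fin (q + 1))) hN hN')
  | alt_sym (q : ℕ) (h3q : 3 ≤ q) (h2q : 2 ≤ q) (hqn : q ≤ n)
      (hA : (alternatingGroup (Fin q)).Normal) (hA' : alternatingGroup (Fin q) ≠ ⊥)
      (hN : (⊤ : Subgroup (Equiv.Perm (Fin q))).Normal)
      (hN' : (⊤ : Subgroup (Equiv.Perm (Fin q))) ≠ ⊥) :
      WickEdge (.normal q h2q hqn (alternatingGroup (Fin q)) hA hA')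
        (.normal q h2q hqn ⊤ hN hN')
  | rees_klein (h3n : 3 ≤ n) (h24 : 2 ≤ 4) (h4n : 4 ≤ n) (hK : klein.Normal) (hK' : klein ≠ ⊥) :
      WickEdge (.rees 3 h3n) (.normal 4 h24 h4n klein hK hK')
  | klein_alt (h24 : 2 ≤ 4) (h4n : 4 ≤ n) (hK : klein.Normal) (hK' : klein ≠ ⊥)
      (hA : (alternatingGroup (Fin 4)).Normal) (hA' : alternatingGroup (Fin 4) ≠ ⊥) :
      WickEdge (.normal 4 h24 h4n klein hK hK')
        (.normal 4 h24 h4n (alternatingGroup (Fin 4)) hA hA')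

/-- The edges, from the lower to the upper end, of the Hasse diagram of the lattice of
congruences. -/
inductive HasseEdge {n : ℕ} (hn : 2 ≤ n) : CongName n → CongName n → Prop
  | mu_mu {i j : Level} : i.Step j → HasseEdge hn (.mu i) (.mu j)
  | lam_lam {i j : Level} : i.Step j → HasseEdge hn (.lam i) (.lam j)
  | rho_rho {i j : Level} : i.Step j → HasseEdge hn (.rho i) (.rho j)
  | top_top {i j : Level} : i.Step j → HasseEdge hn (CongName.top hn i) (CongName.top hn j)
  | mu_lam (i : Level) : HasseEdge hn (.mu i) (.lam i)
  | mu_rho (i : Level) : HasseEdge hn (.mu i) (.rho i)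
  | lam_top (i : Level) : HasseEdge hn (.lam i) (CongName.top hn i)
  | rho_top (i : Level) : HasseEdge hn (.rho i) (CongName.top hn i)
  | wick {x y : CongName n} : WickEdge x y → HasseEdge hn x y

/-- The edges, from the lower to the upper end, of the Hasse diagram of the lattice of
`*`-congruences. -/
inductive StarHasseEdge {n : ℕ} (hn : 2 ≤ n) : CongName n → CongName n → Prop
  | mu_mu {i j : Level} : i.Step j → StarHasseEdge hn (.mu i) (.mu j)
  | top_top {i j : Level} : i.Step j → StarHasseEdge hn (CongName.top hn i) (CongName.top hn j)
  | mu_top (i : Level) : StarHasseEdge hn (.mu i) (CongName.top hn i)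
  | wick {x y : CongName n} : WickEdge x y → StarHasseEdge hn x y

end PartitionMonoid

/-! ### `*`-congruences -/

/-- The image of a congruence under the involution. -/
def Con.starImage {S : Type*} [Monoid S] [StarMul S] (c : Con S) : Con S where
  r x y := c (star x) (star y)
  iseqv := ⟨fun _ => c.refl _, fun h => c.symm h, fun h h' => c.trans h h'⟩
  mul' h h' := by
    simp only [star_mul]
    exact c.mul h' h

/-- The lattice `Cong*(S)` of `*`-congruences, as a sublattice of the lattice of congruences. -/
def starCongruences (S : Type*) [Monoid S] [StarMul S] : Sublattice (Con S) where
  carrier := {c | ∀ x y : S, c x y → c (star x) (star y)}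
  supClosed' := by
    intro c hc d hd
    have h : c ⊔ d ≤ (c ⊔ d).starImage := by
      refine sup_le ?_ ?_
      · intro x y h
        exact (le_sup_left : c ≤ c ⊔ d) (hc x y h)
      · intro x y h
        exact (le_sup_right : d ≤ c ⊔ d) (hd x y h)
    exact fun x y hxy => h hxy
  infClosed' := by
    intro c hc d hd x y h
    exact ⟨hc x y h.1, hd x y h.2⟩

/-! ### Composition of partitions between different rows -/

namespace PartitionMonoid

-- The proof works with partitions between arbitrary rows. The rank of `α` is the least `q` such
-- that `α` factors through a row of `q` points, and in every factorization through that many points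
-- the left factor has a left inverse and the right factor a right inverse (`rank_le_of_eq_product`,
-- `splitFactorization_of_rank_eq`). A congruence `c` extends to partitions between arbitrary rows
-- (`Ext`), so one can ask what it does to the identity on `q` points.
--
-- There is a dichotomy (`Ext.identity_bot`): `c` relates this identity to permutations only
-- (`Rigid`), or it relates it to `⊥`. In the second case every `α` of rank at most `q` is related
-- to `α.hat` (`con_hat_self`). Then `c` on `I_q` is determined by kernels and cokernels; each of
-- these is either respected or ignored entirely, and both are ignored if `q ≥ 2`. In the rigid case
-- with `q ≥ 1`, two related partitions, one of rank `q` and the other of rank at most `q`, differ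
-- by a permutation inserted in the middle of a factorization (`Rigid.exists_perm`). The core of
-- this is a reconstruction of a left invertible partition from its left inverses
-- (`le_of_left_inverses`).
--
-- Let `r` be the largest rank at which `c` is nontrivial. If `c` is rigid at `r ≥ 1`, then a
-- nontrivial twist of rank `r` destroys rigidity at `r - 1` (`not_rigid_of_ext_graph`). So `c` is
-- given by a degree, a normal subgroup and two flags for kernels and cokernels, both true unless
-- the degree is at most 2 (`exists_gridRel`). Conversely all these data give congruences: in degree
-- at most 2 the flags are free because permuting two points changes no partition of them.
--
-- Inclusion amounts to comparing the two flags and the place of the normal subgroup in one chain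
-- running through all symmetric groups, coded as a number `pos` (`toCon_le_iff`). The congruences
-- thus form a subset of `Bool × Bool × ℕ`, the covers are found by arithmetic on `pos`, and the
-- involution exchanges the flags.

infixl:70 " ⊚ " => product

section Composition

variable {A B C D Q X Z : Type}

/-- A function that is constant along edges is constant on components. This is the tool for showing
that vertices are not connected: choose `F` so that it separates them. -/
theorem product_of_invariant {α : Setoid (A ⊕ B)} {β : Setoid (B ⊕ C)} (F : A ⊕ B ⊕ C → Z)
    (hα : ∀ x y, α x y → F (Sum.map id Sum.inl x) = F (Sum.map id Sum.inl y))
    (hβ : ∀ x y, β x y → F (Sum.inr x) = F (Sum.inr y)) {x y : A ⊕ C} (h : (α ⊚ β) x y) :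
    F (Sum.map id Sum.inr x) = F (Sum.map id Sum.inr y) := by
  have h' : Relation.EqvGen (ProductEdge α β) (Sum.map id Sum.inr x) (Sum.map id Sum.inr y) := h
  generalize Sum.map id Sum.inr x = u at h'
  generalize Sum.map id Sum.inr y = v at h'
  induction h' with
  | rel _ _ h =>
    rcases h with ⟨h⟩ | ⟨h⟩
    · exact hα _ _ h
    · exact hβ _ _ h
  | refl => rfl
  | symm _ _ _ ih => exact ih.symm
  | trans _ _ _ _ _ ih₁ ih₂ => exact ih₁.trans ih₂

theorem connected_upper {α : Setoid (A ⊕ B)} {x y : A ⊕ B} (h : α x y) (β : Setoid (B ⊕ C)) :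
    Connected α β (Sum.map id Sum.inl x) (Sum.map id Sum.inl y) :=
  .rel _ _ (.upper h)

theorem connected_lower (α : Setoid (A ⊕ B)) {β : Setoid (B ⊕ C)} {x y : B ⊕ C} (h : β x y) :
    Connected α β (Sum.inr x) (Sum.inr y) :=
  .rel _ _ (.lower h)

theorem product_inl_inl {α : Setoid (A ⊕ B)} {x y : A} (h : α (.inl x) (.inl y))
    (β : Setoid (B ⊕ C)) : (α ⊚ β) (.inl x) (.inl y) :=
  connected_upper h β

theorem product_inr_inr (α : Setoid (A ⊕ B)) {β : Setoid (B ⊕ C)} {x y : C}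
    (h : β (.inr x) (.inr y)) : (α ⊚ β) (.inr x) (.inr y) :=
  connected_lower α h

theorem product_inl_inr {α : Setoid (A ⊕ B)} {β : Setoid (B ⊕ C)} {x : A} {z : B} {y : C}
    (h : α (.inl x) (.inr z)) (h' : β (.inl z) (.inr y)) : (α ⊚ β) (.inl x) (.inr y) :=
  (Connected α β).trans (connected_upper h β) (connected_lower α h')

/-- The partition of `A ⊕ B` with the blocks `{b} ∪ r ⁻¹ {b}`. -/
def graph (r : A → B) : Setoid (A ⊕ B) := Setoid.ker (Sum.elim r id)

theorem graph_apply (r : A → B) (x y : A ⊕ B) :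
    graph r x y ↔ Sum.elim r id x = Sum.elim r id y := Iff.rfl

theorem identity_apply (x y : A ⊕ A) :
    identity A x y ↔ Sum.elim id id x = Sum.elim id id y := Iff.rfl

/-- Each upper vertex `a` is tied to the middle vertex `r a` and the middle row is not merged any
further, so the product is a pullback. -/
theorem graph_product (r : A → B) (β : Setoid (B ⊕ C)) :
    graph r ⊚ β = β.comap (Sum.map r id) := by
  ext x y
  constructor
  · intro h
    have := product_of_invariant
      (Sum.elim (fun a => Quotient.mk β (.inl (r a))) (Quotient.mk β)) ?_ ?_ h
    · rcases x with x | x <;> rcases y with y | y <;> exact Quotient.exact (s := β) this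
    · intro x y h
      rw [graph_apply] at h
      rcases x with x | x <;> rcases y with y | y <;> simp_all
    · intro x y h
      exact Quotient.sound h
  · intro h
    have e : ∀ x : A ⊕ C, Connected (graph r) β (Sum.map id Sum.inr x)
        (Sum.inr (Sum.map r id x)) := by
      rintro (x | x)
      · exact connected_upper (x := .inl x) (y := .inr (r x)) rfl β
      · exact .refl _
    exact .trans _ _ _ (e x) (.trans _ _ _ (connected_lower _ h) (.symm _ _ (e y)))

theorem product_flip_graph (α : Setoid (A ⊕ B)) (r : C → B) :
    α ⊚ flip (graph r) = α.comap (Sum.map id r) := by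
  rw [← flip_flip (α ⊚ flip (graph r)), flip_product, flip_flip, graph_product]
  ext x y
  rcases x with x | x <;> rcases y with y | y <;> rfl

theorem graph_comp (r : A → B) (s : B → C) : graph r ⊚ graph s = graph (s ∘ r) := by
  rw [graph_product]
  ext x y
  rcases x with x | x <;> rcases y with y | y <;> rfl

theorem flip_graph_perm (σ : Equiv.Perm A) : flip (graph σ) = graph (σ⁻¹ : Equiv.Perm A) := by
  ext x y
  change graph σ x.swap y.swap ↔ _
  rcases x with x | x <;> rcases y with y | y <;>
    simp [graph_apply, Equiv.eq_symm_apply, eq_comm]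

/-- Partitions compose from left to right and permutations from right to left, hence the reversal.
-/
theorem graph_mul (σ τ : Equiv.Perm A) :
    graph (σ * τ : Equiv.Perm A) = graph τ ⊚ graph σ := by
  rw [graph_comp]; rfl

theorem graph_one : graph (1 : Equiv.Perm A) = identity A := rfl

theorem graph_injective : Function.Injective (graph : (A → B) → Setoid (A ⊕ B)) := by
  intro r s h
  ext a
  have : graph s (.inl a) (.inr (r a)) := by rw [← h]; rfl
  exact this.symm

theorem graph_product_flip_graph {r : A → B} (hr : Function.Injective r) :
    graph r ⊚ flip (graph r) = identity A := by
  rw [product_flip_graph]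
  ext x y
  rcases x with x | x <;> rcases y with y | y <;> 
    simp [Setoid.comap_rel, graph_apply, identity_apply, hr.eq_iff]

/-- The common labelling of the three rows is constant along edges. Conversely, two vertices in
different outer rows with the same label are joined through a middle vertex carrying it, which `h`
supplies. -/
theorem ker_product_ker (f : A → X) (e : Q → X) (g : B → X)
    (h : ∀ a b, f a = g b → ∃ i, e i = f a) :
    Setoid.ker (Sum.elim f e) ⊚ Setoid.ker (Sum.elim e g) = Setoid.ker (Sum.elim f g) := by
  ext x y
  constructor
  · intro h
    have := product_of_invariant (Sum.elim f (Sum.elim e g)) ?_ ?_ h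
    · rcases x with x | x <;> rcases y with y | y <;> exact this
    · intro x y h
      rcases x with x | x <;> rcases y with y | y <;> exact h
    · intro x y h
      exact h
  · intro hxy
    rcases x with x | x <;> rcases y with y | y
    · exact product_inl_inl (α := Setoid.ker (Sum.elim f e)) hxy _
    · obtain ⟨i, hi⟩ := h x y hxy
      exact product_inl_inr (z := i) hi.symm (hi.trans hxy)
    · obtain ⟨i, hi⟩ := h y x (Eq.symm hxy)
      exact Setoid.symm' _ (product_inl_inr (z := i) hi.symm (hi.trans (Eq.symm hxy)))
    · exact product_inr_inr _ (β := Setoid.ker (Sum.elim e g)) hxy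

/-- A single point has only one partition. This is why kernels survive in rank at most 1, and hence
why `λ`, `ρ`, `μ` exist. -/
instance [IsEmpty A] : Subsingleton (Setoid (A ⊕ Fin 1)) := ⟨fun r s => by
  ext x y
  obtain rfl : x = y := by
    rcases x with x | x
    · exact isEmptyElim x
    · rcases y with y | y
      · exact isEmptyElim y
      · rw [Subsingleton.elim x y]
  exact ⟨fun _ => s.refl _, fun _ => r.refl _⟩⟩

instance [IsEmpty B] : Subsingleton (Setoid (Fin 1 ⊕ B)) := ⟨fun r s => by
  rw [← flip_flip r, ← flip_flip s, Subsingleton.elim (flip r) (flip s)]⟩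

instance [IsEmpty A] [IsEmpty B] : Subsingleton (Setoid (A ⊕ B)) := ⟨fun r s => by
  ext x
  exact isEmptyElim x⟩

/-- The kernel of a partition, as a partition with empty lower row. -/
def upper (α : Setoid (A ⊕ B)) : Setoid (A ⊕ Fin 0) := α.comap (Sum.map id Fin.elim0)

/-- The cokernel of a partition, as a partition with empty upper row. -/
def lower (α : Setoid (A ⊕ B)) : Setoid (Fin 0 ⊕ B) := α.comap (Sum.map Fin.elim0 id)

/-- Forgetting a row is itself a multiplication, so the behaviour of kernels and cokernels under
products is just associativity. -/
theorem upper_eq_product (α : Setoid (A ⊕ B)) : upper α = α ⊚ flip (graph Fin.elim0) :=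
  (product_flip_graph _ _).symm

theorem lower_eq_product (α : Setoid (A ⊕ B)) : lower α = graph Fin.elim0 ⊚ α :=
  (graph_product _ _).symm

theorem upper_product (α : Setoid (A ⊕ B)) (β : Setoid (B ⊕ C)) :
    upper (α ⊚ β) = α ⊚ upper β := by
  rw [upper_eq_product, upper_eq_product, product_assoc]

theorem lower_product (α : Setoid (A ⊕ B)) (β : Setoid (B ⊕ C)) :
    lower (α ⊚ β) = lower α ⊚ β := by
  rw [lower_eq_product, lower_eq_product, product_assoc]

theorem upper_product_zero (α : Setoid (A ⊕ Fin 0)) (β : Setoid (Fin 0 ⊕ C)) :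
    upper (α ⊚ β) = α := by
  rw [upper_product, Subsingleton.elim (upper β) (identity (Fin 0)), product_identity]

theorem lower_product_zero (α : Setoid (A ⊕ Fin 0)) (β : Setoid (Fin 0 ⊕ C)) :
    lower (α ⊚ β) = β := by
  rw [lower_product, Subsingleton.elim (lower α) (identity (Fin 0)), identity_product]

theorem lower_flip (α : Setoid (A ⊕ B)) : lower (flip α) = flip (upper α) := by
  rw [lower_eq_product, upper_eq_product, flip_product, flip_flip]

theorem upper_flip (α : Setoid (A ⊕ B)) : upper (flip α) = flip (lower α) := by
  rw [lower_eq_product, upper_eq_product, flip_product]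

theorem upper_product_lower_apply (α : Setoid (A ⊕ B)) (x y : A ⊕ B) :
    (upper α ⊚ lower α) x y ↔ α x y ∧ x.isLeft = y.isLeft := by
  constructor
  · intro h
    -- The invariant records the row next to the block, since the empty middle row lets no path
    -- change sides.
    have h1 := product_of_invariant
      (Sum.elim (fun a => (Quotient.mk α (.inl a), true)) (Sum.elim Fin.elim0
        (fun b => (Quotient.mk α (.inr b), false)))) ?_ ?_ h
    · rcases x with x | x <;> rcases y with y | y <;> simp at h1 ⊢ <;>
        exact Quotient.exact (s := α) h1
    · rintro (x | x) (y | y) h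
      · exact Prod.ext (Quotient.sound h) rfl
      · exact y.elim0
      · exact x.elim0
      · exact x.elim0
    · rintro (x | x) (y | y) h
      · exact y.elim0
      · exact x.elim0
      · exact y.elim0
      · exact Prod.ext (Quotient.sound h) rfl
  · rintro ⟨h, h'⟩
    rcases x with x | x <;> rcases y with y | y
    · exact product_inl_inl (α := upper α) h _
    · simp at h'
    · simp at h'
    · exact product_inr_inr _ (β := lower α) h

end Composition

theorem mul_rel {n : ℕ} (α β : PartitionMonoid n) : (α * β).rel = α.rel ⊚ β.rel := rfl

theorem star_rel {n : ℕ} (α : PartitionMonoid n) : (star α).rel = flip α.rel := rfl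

theorem hat_rel {n : ℕ} (α : PartitionMonoid n) : α.hat.rel = upper α.rel ⊚ lower α.rel := by
  ext x y
  exact (upper_product_lower_apply α.rel x y).symm

end PartitionMonoid

/-! ### Rank and factorizations -/

namespace PartitionMonoid

section Inverses

variable {A B C Q : Type}

theorem eq_of_product_eq_identity {α : Setoid (Q ⊕ B)} {β : Setoid (B ⊕ Q)}
    (h : α ⊚ β = identity Q) {i j : Q} (hij : α (.inl i) (.inl j)) : i = j := by
  have := product_inl_inl hij β
  rw [h] at this
  exact this

/-- If the block of `i` stayed in the upper row, its indicator would be an invariant separating `i`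
from `i'`. -/
theorem exists_of_product_eq_identity {α : Setoid (Q ⊕ B)} {β : Setoid (B ⊕ Q)}
    (h : α ⊚ β = identity Q) (i : Q) : ∃ m, α (.inl i) (.inr m) := by
  by_contra! hm
  have hi : (α ⊚ β) (.inl i) (.inr i) := by rw [h]; rfl
  have := product_of_invariant (Sum.elim (fun x => α (.inl i) (.inl x)) fun _ => False) ?_ ?_ hi
  · exact this.mp (α.refl _)
  · rintro (x | x) (y | y) hxy <;> refine propext ?_
    · exact ⟨fun h => α.trans h hxy, fun h => α.trans h (α.symm hxy)⟩
    · exact ⟨fun h => hm _ (α.trans h hxy), False.elim⟩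
    · exact ⟨False.elim, fun h => hm _ (α.trans h (α.symm hxy))⟩
    · exact Iff.rfl
  · intro x y _; rfl

theorem le_of_product_eq_identity {q r : ℕ} {α : Setoid (Fin q ⊕ Fin r)}
    {β : Setoid (Fin r ⊕ Fin q)} (h : α ⊚ β = identity (Fin q)) : q ≤ r := by
  choose f hf using exists_of_product_eq_identity h
  have : Function.Injective f := fun i j hij => eq_of_product_eq_identity h
    (α.trans (hf i) (by rw [hij]; exact α.symm (hf j)))
  simpa using Fintype.card_le_of_injective f this

/-- Choosing a lower partner for each upper point gives an injection, which finiteness makes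
bijective. Every lower point then has an upper partner, so lower points cannot be merged either. -/
theorem eq_graph_of_injective [Finite Q] {β : Setoid (Q ⊕ Q)}
    (h₁ : ∀ i j, β (.inl i) (.inl j) → i = j) (h₂ : ∀ i, ∃ m, β (.inl i) (.inr m)) :
    ∃ σ : Equiv.Perm Q, β = graph σ := by
  choose f hf using h₂
  have hinj : Function.Injective f := fun i j hij =>
    h₁ i j (β.trans (hf i) (by rw [hij]; exact β.symm (hf j)))
  have hbij : Function.Bijective f := Finite.injective_iff_bijective.1 hinj
  have e : β = graph f ⊚ identity Q := by
    rw [product_identity]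
    have key : ∀ x, β x (.inr (Sum.elim f id x)) := by
      rintro (x | x)
      · exact hf x
      · exact β.refl _
    ext x y
    constructor
    · intro h
      have h' := β.trans (β.symm (key x)) (β.trans h (key y))
      rw [graph_apply]
      obtain ⟨i, hi⟩ := hbij.2 (Sum.elim f id x)
      obtain ⟨j, hj⟩ := hbij.2 (Sum.elim f id y)
      rw [← hi, ← hj] at h' ⊢
      rw [h₁ i j (β.trans (hf i) (β.trans h' (β.symm (hf j))))]
    · intro h
      rw [graph_apply] at h
      exact β.trans (key x) (by rw [h]; exact β.symm (key y))
  exact ⟨Equiv.ofBijective f hbij, by rw [e, product_identity]; rfl⟩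

theorem eq_graph_of_product_eq_identity [Finite Q] {α β : Setoid (Q ⊕ Q)}
    (h : α ⊚ β = identity Q) : ∃ σ : Equiv.Perm Q, α = graph σ :=
  eq_graph_of_injective (fun _ _ => eq_of_product_eq_identity h)
    (exists_of_product_eq_identity h)

theorem graph_product_graph_inv (σ : Equiv.Perm Q) :
    graph σ ⊚ graph (σ⁻¹ : Equiv.Perm Q) = identity Q := by
  rw [← graph_mul, inv_mul_cancel, graph_one]

theorem graph_inv_product_graph (σ : Equiv.Perm Q) :
    graph (σ⁻¹ : Equiv.Perm Q) ⊚ graph σ = identity Q := by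
  rw [← graph_mul, mul_inv_cancel, graph_one]

theorem eq_graph_inv {σ : Equiv.Perm Q} {β : Setoid (Q ⊕ Q)}
    (h : graph σ ⊚ β = identity Q) : β = graph (σ⁻¹ : Equiv.Perm Q) := by
  rw [← identity_product β, ← graph_inv_product_graph σ, product_assoc, h, product_identity]

end Inverses

section Rank

variable {n q : ℕ}

/-- `α = γ ⊚ δ` is a factorization whose first factor has a left inverse and whose second factor
has a right inverse. -/
structure SplitFactorization {A Q B : Type} (α : Setoid (A ⊕ B)) (γ : Setoid (A ⊕ Q))
    (δ : Setoid (Q ⊕ B)) : Prop where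
  eq : α = γ ⊚ δ
  left : ∃ γ', γ' ⊚ γ = identity Q
  right : ∃ δ', δ ⊚ δ' = identity Q

/-- The middle row indexes the transversals. Choosing an upper point `a i` and a lower point `b i`
in each transversal provides the one-sided inverses. -/
theorem exists_splitFactorization_rank (α : PartitionMonoid n) :
    ∃ (γ : Setoid (Fin n ⊕ Fin α.rank)) (δ : Setoid (Fin α.rank ⊕ Fin n)),
      SplitFactorization α.rel γ δ := by
  set T := {A ∈ α.rel.classes | (∃ i, Sum.inl i ∈ A) ∧ ∃ j, Sum.inr j ∈ A} with hT
  have hfin : Finite T := inferInstance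
  have hcard : Nat.card T = α.rank := Nat.card_coe_set_eq T
  let e : Fin α.rank ≃ T := (Finite.equivFinOfCardEq hcard).symm
  choose a ha using fun i => (e i).2.2.1
  choose b hb using fun i => (e i).2.2.2
  have hrel : ∀ i x y, x ∈ (e i).1 → y ∈ (e i).1 → α.rel x y := fun i x y hx hy =>
    (α.rel.rel_iff_exists_classes).2 ⟨_, (e i).2.1, hx, hy⟩
  have hab : ∀ i, α.rel (.inl (a i)) (.inr (b i)) := fun i => hrel i _ _ (ha i) (hb i)
  have huniq : ∀ i j x y, x ∈ (e i).1 → y ∈ (e j).1 → α.rel x y → i = j := by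
    intro i j x y hx hy hxy
    obtain ⟨c, hc, hxc, hyc⟩ := (α.rel.rel_iff_exists_classes).1 hxy
    have h1 := Setoid.eq_of_mem_classes (e i).2.1 hx hc hxc
    have h2 := Setoid.eq_of_mem_classes (e j).2.1 hy hc hyc
    exact e.injective (Subtype.ext (h1.trans h2.symm))
  -- All three rows are labelled by blocks of `α`; a label shared by the outer rows is a
  -- transversal, so it occurs in the middle.
  refine ⟨Setoid.ker (Sum.elim (fun x => Quotient.mk α.rel (.inl x))
      (fun i => Quotient.mk α.rel (.inl (a i)))),
    Setoid.ker (Sum.elim (fun i => Quotient.mk α.rel (.inl (a i)))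
      (fun y => Quotient.mk α.rel (.inr y))), ⟨?_, ⟨graph a, ?_⟩, ⟨flip (graph b), ?_⟩⟩⟩
  · rw [ker_product_ker]
    · ext x y
      rcases x with x | x <;> rcases y with y | y <;> exact Quotient.eq (r := α.rel).symm
    · intro x y h
      have h := Quotient.exact (s := α.rel) h
      have hc : {z | α.rel z (.inl x)} ∈ T :=
        ⟨Setoid.mem_classes _ _, ⟨x, α.rel.refl _⟩, ⟨y, α.rel.symm h⟩⟩
      refine ⟨e.symm ⟨_, hc⟩, Quotient.sound ?_⟩
      refine hrel (e.symm ⟨_, hc⟩) _ _ (ha _) ?_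
      rw [Equiv.apply_symm_apply]
      exact α.rel.refl _
  · rw [graph_product]
    ext x y
    rcases x with x | x <;> rcases y with y | y <;>
      refine (Quotient.eq (r := α.rel)).trans ⟨fun h => ?_, fun h => ?_⟩ <;>
      first
      | exact huniq _ _ _ _ (ha _) (ha _) h
      | (obtain rfl : x = y := h; exact α.rel.refl _)
  · rw [product_flip_graph]
    ext x y
    rcases x with x | x <;> rcases y with y | y <;>
      refine (Quotient.eq (r := α.rel)).trans ⟨fun h => ?_, fun h => ?_⟩ <;>
      first
      | exact huniq _ _ _ _ (by first | exact ha _ | exact hb _)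
          (by first | exact ha _ | exact hb _) h
      | (obtain rfl : x = y := h
         first | exact α.rel.refl _ | exact hab _ | exact α.rel.symm (hab _))

theorem exists_splitFactorization {α : PartitionMonoid n} (h : α.rank = q) :
    ∃ (γ : Setoid (Fin n ⊕ Fin q)) (δ : Setoid (Fin q ⊕ Fin n)),
      SplitFactorization α.rel γ δ := by
  subst h
  exact exists_splitFactorization_rank α

/-- Multiplying by the inverses of an optimal factorization makes the identity on `α.rank` points
factor through `q` points, and then pigeonhole applies. -/
theorem rank_le_of_eq_product {α : PartitionMonoid n} {γ : Setoid (Fin n ⊕ Fin q)}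
    {δ : Setoid (Fin q ⊕ Fin n)} (h : α.rel = γ ⊚ δ) : α.rank ≤ q := by
  obtain ⟨γ₀, δ₀, h₀, ⟨γ', hγ⟩, ⟨δ', hδ⟩⟩ := exists_splitFactorization_rank α
  refine le_of_product_eq_identity (α := γ' ⊚ γ) (β := δ ⊚ δ') ?_
  rw [product_assoc, ← product_assoc γ, ← h, h₀, product_assoc, hδ, product_identity, hγ]

theorem SplitFactorization.rank_eq {α : PartitionMonoid n} {γ : Setoid (Fin n ⊕ Fin q)}
    {δ : Setoid (Fin q ⊕ Fin n)} (h : SplitFactorization α.rel γ δ) : α.rank = q := by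
  refine le_antisymm (rank_le_of_eq_product h.eq) ?_
  obtain ⟨γ₀, δ₀, h₀, -⟩ := exists_splitFactorization_rank α
  obtain ⟨h, ⟨γ', hγ⟩, ⟨δ', hδ⟩⟩ := h
  refine le_of_product_eq_identity (α := γ' ⊚ γ₀) (β := δ₀ ⊚ δ') ?_
  rw [product_assoc, ← product_assoc γ₀, ← h₀, h, product_assoc, hδ, product_identity, hγ]

/-- Comparison with a split factorization gives `(γ' ⊚ γ) ⊚ (δ ⊚ δ') = identity` on `q` points. Both
factors are therefore mutually inverse permutations and can be absorbed into the inverses. -/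
theorem splitFactorization_of_rank_eq {α : PartitionMonoid n} {γ : Setoid (Fin n ⊕ Fin q)}
    {δ : Setoid (Fin q ⊕ Fin n)} (h : α.rel = γ ⊚ δ) (hq : α.rank = q) :
    SplitFactorization α.rel γ δ := by
  obtain ⟨γ₀, δ₀, h₀, ⟨γ', hγ⟩, ⟨δ', hδ⟩⟩ := exists_splitFactorization hq
  have h1 : (γ' ⊚ γ) ⊚ (δ ⊚ δ') = identity (Fin q) := by
    rw [product_assoc, ← product_assoc γ, ← h, h₀, product_assoc, hδ, product_identity, hγ]
  obtain ⟨σ, hσ⟩ := eq_graph_of_product_eq_identity h1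
  rw [hσ] at h1
  have h2 := eq_graph_inv h1
  refine ⟨h, ⟨graph (σ⁻¹ : Equiv.Perm _) ⊚ γ', ?_⟩, ⟨δ' ⊚ graph σ, ?_⟩⟩
  · rw [product_assoc, hσ, graph_inv_product_graph]
  · rw [← product_assoc, h2, graph_inv_product_graph]

theorem exists_eq_product_of_rank_le {α : PartitionMonoid n} (h : α.rank ≤ q) :
    ∃ (γ : Setoid (Fin n ⊕ Fin q)) (δ : Setoid (Fin q ⊕ Fin n)), α.rel = γ ⊚ δ := by
  obtain ⟨γ, δ, h₀, -⟩ := exists_splitFactorization_rank α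
  refine ⟨γ ⊚ graph (Fin.castLE h), flip (graph (Fin.castLE h)) ⊚ δ, ?_⟩
  rw [product_assoc, ← product_assoc (graph _), graph_product_flip_graph (Fin.castLE_injective h),
    identity_product, h₀]

theorem rank_mul_le_left (α β : PartitionMonoid n) : (α * β).rank ≤ α.rank := by
  obtain ⟨γ, δ, h, -⟩ := exists_splitFactorization_rank α
  exact rank_le_of_eq_product (γ := γ) (δ := δ ⊚ β.rel) (by rw [mul_rel, h, product_assoc])

theorem rank_le (α : PartitionMonoid n) : α.rank ≤ n :=
  rank_le_of_eq_product (product_identity α.rel).symm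

theorem rank_star (α : PartitionMonoid n) : (star α).rank = α.rank := by
  obtain ⟨γ, δ, h, ⟨γ', hγ⟩, ⟨δ', hδ⟩⟩ := exists_splitFactorization_rank α
  refine SplitFactorization.rank_eq (γ := flip δ) (δ := flip γ) ⟨?_, ⟨flip δ', ?_⟩, ⟨flip γ', ?_⟩⟩
  · rw [star_rel, h, flip_product]
  · rw [← flip_product, hδ, flip_identity]
  · rw [← flip_product, hγ, flip_identity]

theorem rank_hat (α : PartitionMonoid n) : α.hat.rank = 0 :=
  Nat.le_zero.1 (rank_le_of_eq_product (hat_rel α))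

/-- For `q ≤ n`, the partition of rank `q` of `Fin n ⊕ Fin q` that restricts to the first `q`
points. -/
def restrictFin (n q : ℕ) : Setoid (Fin n ⊕ Fin q) :=
  Setoid.ker (Sum.elim (fun i : Fin n => if h : (i : ℕ) < q then Sum.inl ⟨i, h⟩ else Sum.inr i)
    Sum.inl : Fin n ⊕ Fin q → Fin q ⊕ Fin n)

theorem restrictFin_apply (x y : Fin n ⊕ Fin q) : restrictFin n q x y ↔
    (Sum.elim (fun i : Fin n => if h : (i : ℕ) < q then Sum.inl ⟨i, h⟩ else Sum.inr i)
      Sum.inl x : Fin q ⊕ Fin n) = Sum.elim (fun i : Fin n =>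
        if h : (i : ℕ) < q then Sum.inl ⟨i, h⟩ else Sum.inr i) Sum.inl y := Iff.rfl

theorem graph_castLE_product_restrictFin (h : q ≤ n) :
    graph (Fin.castLE h) ⊚ restrictFin n q = identity (Fin q) := by
  rw [graph_product]
  ext x y
  rcases x with x | x <;> rcases y with y | y <;>
    simp [restrictFin_apply, Setoid.comap_rel, identity_apply]

theorem bar_rel (σ : Equiv.Perm (Fin q)) :
    (bar σ : PartitionMonoid n).rel = restrictFin n q ⊚ graph σ ⊚ flip (restrictFin n q) := by
  -- Points outside the first `q` get labels private to their row (`inr (inl i)` above, `inr (inr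
  -- i)` below), so only the `q` middle labels are shared and `ker_product_ker` applies.
  have e1 : restrictFin n q ⊚ graph σ = Setoid.ker (Sum.elim
      (fun i : Fin n => if h : (i : ℕ) < q then Sum.inl (σ ⟨i, h⟩) else Sum.inr (.inl i))
      Sum.inl : Fin n ⊕ Fin q → Fin q ⊕ (Fin n ⊕ Fin n)) := by
    rw [← flip_flip (graph σ), flip_graph_perm, product_flip_graph]
    ext x y
    rcases x with x | x <;> rcases y with y | y <;>
      simp only [restrictFin_apply, Setoid.comap_rel, Setoid.ker_def, Sum.map_inl, Sum.map_inr,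
        Sum.elim_inl, Sum.elim_inr, id] <;> (try split_ifs) <;>
      simp [Equiv.symm_apply_eq, Equiv.eq_symm_apply]
  have e2 : flip (restrictFin n q) = Setoid.ker (Sum.elim Sum.inl
      (fun i : Fin n => if h : (i : ℕ) < q then Sum.inl ⟨i, h⟩ else Sum.inr (.inr i)) :
      Fin q ⊕ Fin n → Fin q ⊕ (Fin n ⊕ Fin n)) := by
    ext x y
    change restrictFin n q x.swap y.swap ↔ _
    rcases x with x | x <;> rcases y with y | y <;>
      simp only [restrictFin_apply, Setoid.ker_def, Sum.swap_inl, Sum.swap_inr,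
        Sum.elim_inl, Sum.elim_inr] <;> (try split_ifs) <;> simp
  rw [e1, e2, ker_product_ker]
  · ext x y
    rcases x with x | x <;> rcases y with y | y <;> exact Iff.rfl
  · intro a b hab
    by_cases ha : (a : ℕ) < q
    · exact ⟨σ ⟨a, ha⟩, by simp [ha]⟩
    · by_cases hb : (b : ℕ) < q <;> simp [ha, hb] at hab

theorem splitFactorization_bar (h : q ≤ n) (σ : Equiv.Perm (Fin q)) :
    SplitFactorization (bar σ : PartitionMonoid n).rel (restrictFin n q ⊚ graph σ)
      (flip (restrictFin n q)) := by
  refine ⟨bar_rel σ, ⟨graph (σ⁻¹ : Equiv.Perm _) ⊚ graph (Fin.castLE h), ?_⟩,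
    ⟨flip (graph (Fin.castLE h)), ?_⟩⟩
  · rw [product_assoc, ← product_assoc (graph (Fin.castLE h)), graph_castLE_product_restrictFin,
      identity_product, graph_inv_product_graph]
  · rw [← flip_product, graph_castLE_product_restrictFin, flip_identity]

theorem rank_bar (h : q ≤ n) (σ : Equiv.Perm (Fin q)) : (bar σ : PartitionMonoid n).rank = q :=
  (splitFactorization_bar h σ).rank_eq

end Rank

end PartitionMonoid

/-! ### Extension of a congruence to partitions between different rows -/

namespace PartitionMonoid

variable {n q : ℕ} {A B C Q : Type}

/-- The largest extension of the congruence `c` to partitions with arbitrary rows. -/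
def Ext (c : Con (PartitionMonoid n)) (α β : Setoid (A ⊕ B)) : Prop :=
  ∀ (γ : Setoid (Fin n ⊕ A)) (δ : Setoid (B ⊕ Fin n)), c ⟨γ ⊚ α ⊚ δ⟩ ⟨γ ⊚ β ⊚ δ⟩

namespace Ext

variable {c : Con (PartitionMonoid n)}

theorem refl (α : Setoid (A ⊕ B)) : Ext c α α := fun _ _ => c.refl _

theorem symm {α β : Setoid (A ⊕ B)} (h : Ext c α β) : Ext c β α := fun γ δ => c.symm (h γ δ)

theorem trans {α β γ : Setoid (A ⊕ B)} (h : Ext c α β) (h' : Ext c β γ) : Ext c α γ :=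
  fun ε δ => c.trans (h ε δ) (h' ε δ)

theorem mul_left {α β : Setoid (A ⊕ B)} (h : Ext c α β) (θ : Setoid (C ⊕ A)) :
    Ext c (θ ⊚ α) (θ ⊚ β) := by
  intro γ δ
  simpa only [product_assoc] using h (γ ⊚ θ) δ

theorem mul_right {α β : Setoid (A ⊕ B)} (h : Ext c α β) (θ : Setoid (B ⊕ C)) :
    Ext c (α ⊚ θ) (β ⊚ θ) := by
  intro γ δ
  simpa only [product_assoc] using h γ (θ ⊚ δ)

theorem mul {α β : Setoid (A ⊕ B)} {γ δ : Setoid (B ⊕ C)} (h : Ext c α β) (h' : Ext c γ δ) :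
    Ext c (α ⊚ γ) (β ⊚ δ) :=
  (h.mul_right γ).trans (h'.mul_left β)

/-- This is the duality of the proof: results about one side hold for all congruences, so applying
them to `c.starImage` gives the other side. -/
theorem flip {α β : Setoid (A ⊕ B)} (h : Ext c α β) :
    Ext c.starImage (flip α) (PartitionMonoid.flip β) := by
  intro γ δ
  have := h (PartitionMonoid.flip δ) (PartitionMonoid.flip γ)
  have e : ∀ α : Setoid (A ⊕ B),
      (⟨PartitionMonoid.flip δ ⊚ α ⊚ PartitionMonoid.flip γ⟩ : PartitionMonoid n)
        = star ⟨γ ⊚ PartitionMonoid.flip α ⊚ δ⟩ := by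
    intro α
    refine PartitionMonoid.ext ?_
    rw [star_rel, flip_product, flip_product, flip_flip, product_assoc]
  rw [e, e] at this
  exact this

end Ext

variable {c : Con (PartitionMonoid n)}

theorem starImage_starImage : c.starImage.starImage = c := by
  refine Con.ext fun x y => ?_
  change c (star (star x)) (star (star y)) ↔ c x y
  rw [star_star, star_star]

theorem ext_flip_iff {α β : Setoid (A ⊕ B)} :
    Ext c.starImage (flip α) (flip β) ↔ Ext c α β := by
  refine ⟨fun h => ?_, Ext.flip⟩
  have := h.flip
  rwa [starImage_starImage, flip_flip, flip_flip] at this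

theorem ext_rel_iff {α β : PartitionMonoid n} : Ext c α.rel β.rel ↔ c α β := by
  constructor
  · intro h
    have := h (identity _) (identity _)
    simpa only [product_identity, identity_product] using this
  · intro h γ δ
    exact c.mul (c.mul (c.refl ⟨γ⟩) h) (c.refl ⟨δ⟩)

theorem Ext.of_con {α β : PartitionMonoid n} (h : c α β) : Ext c α.rel β.rel := ext_rel_iff.2 h

/-! ### Collapse of the identity -/

section Cut

/-- The identity with the points of `S` isolated in both rows. -/
def cut (S : Set Q) : Setoid (Q ⊕ Q) where
  r x y := x = y ∨ (Sum.elim id id x = Sum.elim id id y ∧ Sum.elim id id x ∉ S)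
  iseqv := by
    refine ⟨fun x => Or.inl rfl, ?_, ?_⟩
    · rintro x y (h | ⟨h, h'⟩)
      · exact Or.inl h.symm
      · exact Or.inr ⟨h.symm, h ▸ h'⟩
    · rintro x y z (rfl | ⟨h, h'⟩) h2
      · exact h2
      · rcases h2 with rfl | ⟨h2, -⟩
        · exact Or.inr ⟨h, h'⟩
        · exact Or.inr ⟨h.trans h2, h'⟩

theorem cut_apply (S : Set Q) (x y : Q ⊕ Q) : cut S x y ↔
    x = y ∨ (Sum.elim id id x = Sum.elim id id y ∧ Sum.elim id id x ∉ S) := Iff.rfl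

open Classical in
theorem cut_product_apply (S : Set Q) (β : Setoid (Q ⊕ B)) (x y : Q ⊕ B) :
    (cut S ⊚ β) x y ↔ x = y ∨ (x ∉ Sum.inl '' S ∧ y ∉ Sum.inl '' S ∧ β x y) := by
  constructor
  · intro h
    -- Upper points in `S` keep labels of their own; every other vertex carries its block of `β`.
    have := product_of_invariant (Z := Q ⊕ Quotient β)
      (Sum.elim (fun a => if a ∈ S then .inl a else .inr (Quotient.mk β (.inl a)))
        fun b => .inr (Quotient.mk β b)) ?_ ?_ h
    · rcases x with x | x <;> rcases y with y | y <;>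
        simp only [Sum.map_inl, Sum.map_inr, Sum.elim_inl, Sum.elim_inr, id] at this <;>
        (try split_ifs at this) <;> simp at this <;> simp_all <;>
        first
        | exact Or.inr (Quotient.exact (s := β) this)
        | exact Quotient.exact (s := β) this
    · intro x y h
      rcases h with rfl | ⟨h, h'⟩
      · rfl
      · rcases x with x | x <;> rcases y with y | y <;> simp_all
    · intro x y h
      simp only [Sum.elim_inr]
      rw [Quotient.sound h]
  · rintro (rfl | ⟨hx, hy, h⟩)
    · exact Setoid.refl' _ _
    · have e : ∀ x : Q ⊕ B, x ∉ Sum.inl '' S →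
          Connected (cut S) β (Sum.map id Sum.inr x) (Sum.inr x) := by
        rintro (x | x) hx
        · exact connected_upper (x := .inl x) (y := .inr x)
            (Or.inr ⟨rfl, fun h => hx ⟨x, h, rfl⟩⟩) β
        · exact .refl _
      exact .trans _ _ _ (e x hx) (.trans _ _ _ (connected_lower _ h) (.symm _ _ (e y hy)))

theorem cut_product_cut (S T : Set Q) : cut S ⊚ cut T = cut (S ∪ T) := by
  ext x y
  rw [cut_product_apply, cut_apply, cut_apply]
  rcases x with x | x <;> rcases y with y | y <;> simp
  · tauto
  · constructor
    · rintro ⟨h1, rfl, h2⟩; exact ⟨rfl, h1, h2⟩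
    · rintro ⟨rfl, h1, h2⟩; exact ⟨h1, rfl, h2⟩
  · constructor
    · rintro ⟨h1, rfl, h2⟩; exact ⟨rfl, h1, h2⟩
    · rintro ⟨rfl, h1, h2⟩; exact ⟨h1, rfl, h2⟩
  · tauto

theorem cut_univ : cut (Set.univ : Set Q) = ⊥ := by
  ext x y
  rw [cut_apply]
  simp

theorem cut_empty : cut (∅ : Set Q) = identity Q := by
  ext x y
  rw [cut_apply, identity_apply]
  simp only [Set.mem_empty_iff_false, not_false_eq_true, and_true, or_iff_right_iff_imp]
  rintro rfl
  rfl

theorem cut_product_of_isolated {i : Q} {β : Setoid (Q ⊕ B)} (h : ∀ x, β (.inl i) x → x = .inl i) :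
    cut {i} ⊚ β = β := by
  ext x y
  rw [cut_product_apply]
  constructor
  · rintro (rfl | ⟨-, -, h⟩)
    · exact β.refl _
    · exact h
  · intro hxy
    by_cases hx : x = .inl i
    · subst hx
      exact Or.inl (h _ hxy).symm
    · by_cases hy : y = .inl i
      · subst hy
        exact Or.inl (h _ (β.symm hxy))
      · refine Or.inr ⟨?_, ?_, hxy⟩
        · rintro ⟨_, rfl, rfl⟩; exact hx rfl
        · rintro ⟨_, rfl, rfl⟩; exact hy rfl

theorem graph_product_cut_product_graph (σ : Equiv.Perm Q) (S : Set Q) :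
    graph σ ⊚ cut S ⊚ graph (σ⁻¹ : Equiv.Perm Q) = cut (σ ⁻¹' S) := by
  rw [← flip_graph_perm, product_flip_graph, graph_product]
  ext x y
  simp only [Setoid.comap_rel]
  rw [cut_apply, cut_apply]
  rcases x with x | x <;> rcases y with y | y <;> simp

end Cut

/-- Since `β` absorbs `cut {i}`, the identity is related to `cut {i}`. Conjugation by transpositions
gives every `cut {j}`, and the product of all of these is `⊥`. -/
theorem Ext.identity_bot_of_isolated [Finite Q] {β : Setoid (Q ⊕ Q)} (h : Ext c (identity Q) β)
    {i : Q} (hi : ∀ x, β (.inl i) x → x = .inl i) : Ext c (identity Q) ⊥ := by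
  classical
  have h1 : Ext c (identity Q) (cut {i}) := by
    have := h.mul_left (cut {i})
    rw [product_identity, cut_product_of_isolated hi] at this
    exact h.trans this.symm
  have h2 : ∀ j, Ext c (identity Q) (cut {j}) := by
    intro j
    have := (h1.mul_left (graph (Equiv.swap i j))).mul_right
      (graph ((Equiv.swap i j)⁻¹ : Equiv.Perm Q))
    rw [product_identity, graph_product_graph_inv, graph_product_cut_product_graph] at this
    convert this
    ext x
    simp [Equiv.swap_apply_eq_iff]
  have h3 : ∀ S : Set Q, S.Finite → Ext c (identity Q) (cut S) := by
    intro S hS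
    induction S, hS using Set.Finite.induction_on with
    | empty => rw [cut_empty]; exact .refl _
    | @insert j S _ _ ih =>
      have := (h2 j).mul ih
      rwa [identity_product, cut_product_cut] at this
  have := h3 Set.univ Set.finite_univ
  rwa [cut_univ] at this

theorem flip_bot : flip (⊥ : Setoid (A ⊕ B)) = ⊥ := by
  ext x y
  change x.swap = y.swap ↔ x = y
  exact Sum.swap_leftInverse.injective.eq_iff

/-- The map `r` merging `j` into `i` satisfies `graph r ⊚ β = β`, so the identity is related to
`graph r`. There the lower point `j` is isolated, as `r` misses `j`, and the mirror image of the
isolated case applies. -/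
theorem Ext.identity_bot_of_joined [Finite Q] {β : Setoid (Q ⊕ Q)} (h : Ext c (identity Q) β)
    {i j : Q} (hij : i ≠ j) (hβ : β (.inl i) (.inl j)) : Ext c (identity Q) ⊥ := by
  classical
  let r : Q → Q := Function.update id j i
  have hr : ∀ x, β (Sum.map r id x) x := by
    rintro (x | x)
    · by_cases hx : x = j
      · subst hx; simpa [r] using hβ
      · simp [r, hx]
    · exact β.refl _
  have h1 : graph r ⊚ β = β := by
    rw [graph_product]
    ext x y
    exact ⟨fun h => β.trans (β.symm (hr x)) (β.trans h (hr y)),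
      fun h => β.trans (hr x) (β.trans h (β.symm (hr y)))⟩
  have h2 : Ext c (identity Q) (graph r) := by
    have := h.mul_left (graph r)
    rw [product_identity, h1] at this
    exact h.trans this.symm
  have h3 : Ext c.starImage (identity Q) ⊥ := by
    have := h2.flip
    rw [flip_identity] at this
    refine this.identity_bot_of_isolated (i := j) ?_
    intro x hx
    have hx : graph r (.inr j) x.swap := hx
    rw [graph_apply] at hx
    rcases x with x | x
    · simp at hx; simp [hx]
    · by_cases hxj : x = j
      · simp [r, hxj] at hx; exact absurd hx.symm hij
      · simp [r, hxj] at hx; exact absurd hx.symm hxj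
  rwa [← flip_identity, ← flip_bot, ext_flip_iff] at h3

theorem Ext.identity_bot [Finite Q] {β : Setoid (Q ⊕ Q)} (h : Ext c (identity Q) β)
    (hβ : ¬ ∃ σ : Equiv.Perm Q, β = graph σ) : Ext c (identity Q) ⊥ := by
  by_cases h1 : ∀ i j, β (.inl i) (.inl j) → i = j
  · by_cases h2 : ∀ i, ∃ m, β (.inl i) (.inr m)
    · exact absurd (eq_graph_of_injective h1 h2) hβ
    · push Not at h2
      obtain ⟨i, hi⟩ := h2
      refine h.identity_bot_of_isolated (i := i) ?_
      rintro (x | x) hx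
      · rw [h1 _ _ hx]
      · exact absurd hx (hi x)
  · push Not at h1
    obtain ⟨i, j, h2, h3⟩ := h1
    exact h.identity_bot_of_joined h3 h2

/-! ### Congruences that do not collapse the identity of a row -/

/-- A left inverse may be replaced by the graph of a section `a`, which picks an upper point from
the block of each lower point. -/
theorem exists_graph_product_eq_identity {γ : Setoid (A ⊕ Q)} {θ : Setoid (Q ⊕ A)}
    (h : θ ⊚ γ = identity Q) :
    (∀ i j, γ (.inr i) (.inr j) → i = j) ∧ ∃ a : Q → A, ∀ i, γ (.inl (a i)) (.inr i) := by
  have h' : flip γ ⊚ flip θ = identity Q := by rw [← flip_product, h, flip_identity]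
  choose a ha using exists_of_product_eq_identity h'
  exact ⟨fun i j hij => eq_of_product_eq_identity h' (i := i) (j := j) hij,
    a, fun i => γ.symm (ha i)⟩

theorem graph_product_eq_identity {γ : Setoid (A ⊕ Q)}
    (hγ : ∀ i j, γ (.inr i) (.inr j) → i = j) {a : Q → A}
    (ha : ∀ i, γ (.inl (a i)) (.inr i)) : graph a ⊚ γ = identity Q := by
  have key : ∀ x : Q ⊕ Q, γ (Sum.map a id x) (.inr (Sum.elim id id x)) := by
    rintro (x | x)
    · exact ha x
    · exact γ.refl _
  rw [graph_product]
  ext x y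
  rw [identity_apply]
  constructor
  · intro h
    exact hγ _ _ (γ.trans (γ.symm (key x)) (γ.trans h (key y)))
  · intro h
    exact γ.trans (key x) (by rw [h]; exact γ.symm (key y))

/-! ### Reconstruction of a partition from its left inverses -/

section LeftInverses

variable {γ η : Setoid (A ⊕ Q)} {a : Q → A}

/-- Replacing the value of the section `a` at `i` by `x` gives another section of `γ`, hence a
permutation `σ` for `η`. It fixes every `j ≠ i`, where nothing changed, so it fixes `i` too, and
this says that `η` joins `x` to `i`. -/
theorem le_inr_of_left_inverses (hγ : ∀ i j, γ (.inr i) (.inr j) → i = j)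
    (hη : ∀ i j, η (.inr i) (.inr j) → i = j)
    (haγ : ∀ i, γ (.inl (a i)) (.inr i)) (haη : ∀ i, η (.inl (a i)) (.inr i))
    (h : ∀ θ : Setoid (Q ⊕ A), θ ⊚ γ = identity Q → ∃ σ : Equiv.Perm Q, θ ⊚ η = graph σ)
    {x : A} {i : Q} (hx : γ (.inl x) (.inr i)) : η (.inl x) (.inr i) := by
  classical
  let r := Function.update a i x
  have hr : graph r ⊚ γ = identity Q := by
    refine graph_product_eq_identity hγ fun j => ?_
    by_cases hj : j = i
    · subst hj; simpa [r] using hx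
    · simpa [r, hj] using haγ j
  obtain ⟨σ, hσ⟩ := h _ hr
  have hσ' : ∀ j, η (.inl (r j)) (.inr (σ j)) := by
    intro j
    have : (graph r ⊚ η) (.inl j) (.inr (σ j)) := by rw [hσ]; rfl
    rwa [graph_product] at this
  have h1 : ∀ j, j ≠ i → σ j = j := by
    intro j hj
    have := hσ' j
    simp only [r, Function.update_of_ne hj] at this
    exact hη _ _ (η.trans (η.symm this) (haη j))
  have h2 : σ i = i := by
    by_contra h2
    exact h2 (σ.injective (h1 _ h2))
  have := hσ' i
  rw [h2] at this
  simpa [r] using this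

/-- A detour distinguishes `γ` from `η`: `θ` joins `i₀` to `x` and `y` to `a i₀`, so that in `θ ⊚ γ`
the point `i₀` reaches its lower copy only by the step from `x` to `y`. If `η` does not join `x` and
`y`, then `i₀` is stuck in the block of `x` and `θ ⊚ η` is no permutation. -/
theorem le_inl_of_left_inverses [Nonempty Q] (hγ : ∀ i j, γ (.inr i) (.inr j) → i = j)
    (haγ : ∀ i, γ (.inl (a i)) (.inr i))
    (h : ∀ θ : Setoid (Q ⊕ A), θ ⊚ γ = identity Q → ∃ σ : Equiv.Perm Q, θ ⊚ η = graph σ)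
    {x y : A} (hxγ : ∀ i, ¬ γ (.inl x) (.inr i)) (hxη : ∀ i, ¬ η (.inl x) (.inr i))
    (haη : ∀ i, η (.inl (a i)) (.inr i))
    (hxy : γ (.inl x) (.inl y)) : η (.inl x) (.inl y) := by
  classical
  by_contra hne
  let i₀ : Q := Classical.arbitrary Q
  let m : A → A := Function.update id y (a i₀)
  let r : Q → A := Function.update a i₀ x
  have hyγ : ∀ i, ¬ γ (.inl y) (.inr i) := fun i hi => hxγ i (γ.trans hxy hi)
  have hyx : y ≠ x := by rintro rfl; exact hne (η.refl _)
  have hya : ∀ i, a i ≠ y := fun i hi => hyγ i (hi ▸ haγ i)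
  have hxa : ∀ i, ¬ γ (.inl (a i)) (.inl x) := fun i hi =>
    hxγ i (γ.trans (γ.symm hi) (haγ i))
  have hxa' : ∀ i, ¬ η (.inl (a i)) (.inl x) := fun i hi =>
    hxη i (η.trans (η.symm hi) (haη i))
  let θ : Setoid (Q ⊕ A) := Setoid.ker (Sum.elim r m)
  -- The only nontrivial joins in `θ` are those of `y` with `a i₀` and of `i` with `r i`, so an
  -- invariant of `ζ` respecting them is an invariant of `θ ⊚ ζ`.
  have key : ∀ {Z : Type} {ζ : Setoid (A ⊕ Q)} (G : A ⊕ Q → Z) (T : Q → Z),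
      (∀ u v, ζ u v → G u = G v) → G (.inl y) = G (.inl (a i₀)) → (∀ i, G (.inl (r i)) = T i) →
      ∀ u v : Q ⊕ Q, (θ ⊚ ζ) u v →
        Sum.elim T (fun j => G (.inr j)) u = Sum.elim T (fun j => G (.inr j)) v := by
    intro Z ζ G T h1 h2 h3 u v huv
    have hm : ∀ w, G (.inl w) = G (.inl (m w)) := by
      intro w
      by_cases hw : w = y
      · subst hw; simpa [m] using h2
      · simp [m, hw]
    have := product_of_invariant (Sum.elim T G) ?_ h1 huv
    · rcases u with u | u <;> rcases v with v | v <;> exact this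
    · have e : ∀ u : Q ⊕ A, Sum.elim T G (Sum.map id Sum.inl u) = G (.inl (Sum.elim r m u)) := by
        rintro (u | u)
        · exact (h3 u).symm
        · exact hm u
      intro u v huv
      rw [e, e]
      exact congrArg (fun z => G (.inl z)) huv
  have hθγ : θ ⊚ γ = identity Q := by
    have hrel : ∀ i, (θ ⊚ γ) (.inl i) (.inr i) := by
      intro i
      by_cases hi : i = i₀
      · subst hi
        have e1 : Connected θ γ (.inl i₀) (.inr (.inl x)) :=
          connected_upper (α := θ) (x := .inl i₀) (y := .inr x)
            (by simp [θ, Setoid.ker_def, r, m, hyx.symm]) γ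
        have e2 : Connected θ γ (.inr (.inl x)) (.inr (.inl y)) := connected_lower θ hxy
        have e3 : Connected θ γ (.inr (.inl y)) (.inr (.inl (a i₀))) :=
          connected_upper (α := θ) (x := .inr y) (y := .inr (a i₀))
            (by simp [θ, Setoid.ker_def, m, hya]) γ
        have e4 : Connected θ γ (.inr (.inl (a i₀))) (.inr (.inr i₀)) :=
          connected_lower θ (haγ i₀)
        exact (Connected θ γ).trans e1 ((Connected θ γ).trans e2 ((Connected θ γ).trans e3 e4))
      · exact product_inl_inr (α := θ) (z := a i)
          (by simp [θ, Setoid.ker_def, r, m, hi, hya]) (haγ i)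
    -- The invariant is the set of lower points joined to `v`, with the block of `x` counted as
    -- belonging to `i₀`.
    have hG := key (ζ := γ) (fun v => {j : Q | γ v (.inr j) ∨ j = i₀ ∧ γ v (.inl x)})
      (fun i => {i}) ?_ ?_ ?_
    · have hb : ∀ j, {k : Q | γ (.inr j) (.inr k) ∨ k = i₀ ∧ γ (.inr j) (.inl x)} = {j} := by
        intro j
        ext k
        simp only [Set.mem_ofPred_eq, Set.mem_singleton_iff]
        constructor
        · rintro (h | ⟨-, h⟩)
          · exact (hγ _ _ h).symm
          · exact absurd (γ.symm h) (hxγ j)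
        · rintro rfl; exact Or.inl (γ.refl _)
      ext u v
      rw [identity_apply]
      constructor
      · intro huv
        have := hG u v huv
        simp only [hb] at this
        rcases u with u | u <;> rcases v with v | v <;> simpa using this
      · intro huv
        have e : ∀ u : Q ⊕ Q, (θ ⊚ γ) u (.inr (Sum.elim id id u)) := by
          rintro (u | u)
          · exact hrel u
          · exact Setoid.refl' _ _
        exact Setoid.trans' _ (e u) (by rw [huv]; exact Setoid.symm' _ (e v))
    · intro u v huv
      ext k
      simp only [Set.mem_ofPred_eq]
      have e : ∀ w, γ u w ↔ γ v w := fun w =>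
        ⟨fun h => γ.trans (γ.symm huv) h, fun h => γ.trans huv h⟩
      rw [e, e]
    · ext k
      simp only [Set.mem_ofPred_eq]
      constructor
      · rintro (h | ⟨rfl, -⟩)
        · exact absurd h (hyγ k)
        · exact Or.inl (haγ _)
      · rintro (h | ⟨-, h⟩)
        · exact Or.inr ⟨hγ _ _ (γ.trans (γ.symm h) (haγ i₀)), γ.symm hxy⟩
        · exact absurd h (hxa _)
    · intro i
      ext k
      simp only [Set.mem_ofPred_eq, Set.mem_singleton_iff]
      by_cases hi : i = i₀
      · subst hi
        simp only [r, Function.update_self]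
        exact ⟨fun h => h.elim (fun h => absurd h (hxγ k)) And.left,
          fun h => Or.inr ⟨h, γ.refl _⟩⟩
      · simp only [r, Function.update_of_ne hi]
        constructor
        · rintro (h | ⟨-, h⟩)
          · exact hγ _ _ (γ.trans (γ.symm h) (haγ i))
          · exact absurd h (hxa _)
        · rintro rfl; exact Or.inl (haγ _)
  obtain ⟨σ, hσ⟩ := h θ hθγ
  have hc : (θ ⊚ η) (.inl i₀) (.inr (σ i₀)) := by rw [hσ]; rfl
  -- Membership in the `η`-block of `x` is invariant; it holds at the upper `i₀` and at no lower
  -- point.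
  have := key (ζ := η) (fun v => η v (.inl x)) (fun i => i = i₀) ?_ ?_ ?_ _ _ hc
  · exact hxη _ (η.symm ((show (i₀ = i₀) = η (.inr (σ i₀)) (.inl x) from this).mp rfl))
  · intro u v huv
    exact propext ⟨fun h => η.trans (η.symm huv) h, fun h => η.trans huv h⟩
  · refine propext ⟨fun h => absurd (η.symm h) hne, fun h => absurd h (hxa' _)⟩
  · intro i
    by_cases hi : i = i₀
    · subst hi; simp [r]
    · simp [r, hi, hxa' i]

theorem le_of_left_inverses [Nonempty Q] (hγ : ∀ i j, γ (.inr i) (.inr j) → i = j)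
    (hη : ∀ i j, η (.inr i) (.inr j) → i = j)
    (haγ : ∀ i, γ (.inl (a i)) (.inr i)) (haη : ∀ i, η (.inl (a i)) (.inr i))
    (h : ∀ θ : Setoid (Q ⊕ A), θ ⊚ γ = identity Q → ∃ σ : Equiv.Perm Q, θ ⊚ η = graph σ)
    (h' : ∀ θ : Setoid (Q ⊕ A), θ ⊚ η = identity Q → ∃ σ : Equiv.Perm Q, θ ⊚ γ = graph σ) :
    γ ≤ η := by
  have key : ∀ x i, γ (.inl x) (.inr i) → η (.inl x) (.inr i) := fun x i =>
    le_inr_of_left_inverses hγ hη haγ haη h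
  rintro (x | x) (y | y) hxy
  · by_cases hx : ∃ i, γ (.inl x) (.inr i)
    · obtain ⟨i, hi⟩ := hx
      exact η.trans (key _ _ hi) (η.symm (key _ _ (γ.trans (γ.symm hxy) hi)))
    · push Not at hx
      exact le_inl_of_left_inverses hγ haγ h hx
        (fun i hi => hx i (le_inr_of_left_inverses hη hγ haη haγ h' hi)) haη hxy
  · exact key _ _ hxy
  · exact η.symm (key _ _ (γ.symm hxy))
  · rw [hγ _ _ hxy]

end LeftInverses

/-- The congruence `c` relates the identity of degree `q` to permutations only. -/
def Rigid (c : Con (PartitionMonoid n)) (q : ℕ) : Prop :=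
  ∀ β : Setoid (Fin q ⊕ Fin q), Ext c (identity (Fin q)) β →
    ∃ σ : Equiv.Perm (Fin q), β = graph σ

theorem Rigid.starImage (h : Rigid c q) : Rigid c.starImage q := by
  intro β hβ
  have := hβ.flip
  rw [starImage_starImage, flip_identity] at this
  obtain ⟨σ, hσ⟩ := h _ this
  exact ⟨σ⁻¹, by rw [← flip_graph_perm, ← hσ, flip_flip]⟩

theorem ext_identity_bot_of_not_rigid (h : ¬ Rigid c q) : Ext c (identity (Fin q)) ⊥ := by
  simp only [Rigid, not_forall] at h
  obtain ⟨β, h1, h2⟩ := h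
  exact h1.identity_bot h2

/-- A section of `γ` turns `β` into a permutation `σ`. Dividing it out gives `η` with the same
section; by rigidity left inverses of either of `γ`, `η` send the other to a permutation, which
forces `γ = η`. The assumption `q ≠ 0` supplies the point `i₀` used to compare blocks that do not
reach the lower row. -/
theorem Rigid.exists_perm_right (h : Rigid c q) (hq : q ≠ 0) {γ β : Setoid (A ⊕ Fin q)}
    {γ' : Setoid (Fin q ⊕ A)} (hγ' : γ' ⊚ γ = identity (Fin q)) (hγβ : Ext c γ β) :
    ∃ σ : Equiv.Perm (Fin q), β = γ ⊚ graph σ := by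
  have : Nonempty (Fin q) := ⟨⟨0, Nat.pos_of_ne_zero hq⟩⟩
  obtain ⟨hγ, a, haγ⟩ := exists_graph_product_eq_identity hγ'
  have ha := graph_product_eq_identity hγ haγ
  have h1 := hγβ.mul_left (graph a)
  rw [ha] at h1
  obtain ⟨σ, hσ⟩ := h _ h1
  set η := β ⊚ graph (σ⁻¹ : Equiv.Perm _) with hη
  have hβ : β = η ⊚ graph σ := by
    rw [hη, product_assoc, graph_inv_product_graph, product_identity]
  have haη : graph a ⊚ η = identity (Fin q) := by
    rw [hη, ← product_assoc, hσ, graph_product_graph_inv]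
  have hη' := (exists_graph_product_eq_identity haη).1
  have haη' : ∀ i, η (.inl (a i)) (.inr i) := by
    intro i
    have : (graph a ⊚ η) (.inl i) (.inr i) := by rw [haη]; rfl
    rwa [graph_product] at this
  have hd : ∀ θ : Setoid (Fin q ⊕ A), θ ⊚ γ = identity (Fin q) →
      ∃ σ : Equiv.Perm (Fin q), θ ⊚ η = graph σ := by
    intro θ hθ
    have h2 := hγβ.mul_left θ
    rw [hθ] at h2
    obtain ⟨τ, hτ⟩ := h _ h2
    exact ⟨σ⁻¹ * τ, by rw [hη, ← product_assoc, hτ, graph_mul]⟩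
  have hd' : ∀ θ : Setoid (Fin q ⊕ A), θ ⊚ η = identity (Fin q) →
      ∃ σ : Equiv.Perm (Fin q), θ ⊚ γ = graph σ := by
    intro θ hθ
    have h2 := (hγβ.mul_right (graph (σ⁻¹ : Equiv.Perm _))).mul_left θ
    rw [← hη, hθ] at h2
    obtain ⟨τ, hτ⟩ := h _ h2.symm
    refine ⟨σ * τ, ?_⟩
    rw [graph_mul, ← hτ, product_assoc, product_assoc, graph_inv_product_graph, product_identity]
  refine ⟨σ, hβ.trans ?_⟩
  rw [le_antisymm (le_of_left_inverses hγ hη' haγ haη' hd hd')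
    (le_of_left_inverses hη' hγ haη' haγ hd' hd)]

theorem Rigid.exists_perm_left (h : Rigid c q) (hq : q ≠ 0) {δ β : Setoid (Fin q ⊕ B)}
    {δ' : Setoid (B ⊕ Fin q)} (hδ' : δ ⊚ δ' = identity (Fin q)) (hδβ : Ext c δ β) :
    ∃ σ : Equiv.Perm (Fin q), β = graph σ ⊚ δ := by
  obtain ⟨σ, hσ⟩ := h.starImage.exists_perm_right hq (γ := flip δ) (γ' := flip δ')
    (by rw [← flip_product, hδ', flip_identity]) hδβ.flip
  refine ⟨σ⁻¹, ?_⟩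
  rw [← flip_flip β, hσ, flip_product, flip_flip, flip_graph_perm]

/-- Multiplication by `γ'` reduces to the one-sided case and yields `γ' ⊚ β = graph σ ⊚ δ`. To
recover `β`, one shows that `γ ⊚ γ'` fixes its left factor `γ₁`. -/
theorem Rigid.exists_perm (h : Rigid c q) (hq : q ≠ 0) {α β : Setoid (A ⊕ B)}
    {γ : Setoid (A ⊕ Fin q)} {δ : Setoid (Fin q ⊕ B)} (hα : SplitFactorization α γ δ)
    {γ₁ : Setoid (A ⊕ Fin q)} {δ₁ : Setoid (Fin q ⊕ B)} (hβ : β = γ₁ ⊚ δ₁) (hαβ : Ext c α β) :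
    ∃ σ : Equiv.Perm (Fin q), β = γ ⊚ graph σ ⊚ δ := by
  obtain ⟨hα, ⟨γ', hγ⟩, ⟨δ', hδ⟩⟩ := hα
  have e1 : γ' ⊚ α = δ := by rw [hα, ← product_assoc, hγ, identity_product]
  have h1 := hαβ.mul_left γ'
  rw [e1] at h1
  obtain ⟨σ, hσ⟩ := h.exists_perm_left hq hδ h1
  refine ⟨σ, ?_⟩
  -- Through `q` points this permutation forces both factors to be permutations, so `γ₁` and `δ₁`
  -- are invertible on their inner sides.
  have e2 : (γ' ⊚ γ₁) ⊚ (δ₁ ⊚ δ') = graph σ := by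
    rw [product_assoc, ← product_assoc γ₁, ← hβ, ← product_assoc, hσ, product_assoc, hδ,
      product_identity]
  have e3 : (γ' ⊚ γ₁) ⊚ (δ₁ ⊚ δ' ⊚ graph (σ⁻¹ : Equiv.Perm _)) = identity _ := by
    rw [← product_assoc, e2, graph_product_graph_inv]
  obtain ⟨τ, hτ⟩ := eq_graph_of_product_eq_identity e3
  rw [hτ] at e3
  have e4 := eq_graph_inv e3
  have hδ₁ : δ₁ ⊚ (δ' ⊚ graph (σ⁻¹ : Equiv.Perm _) ⊚ graph τ) = identity _ := by
    rw [← product_assoc, ← product_assoc, e4, graph_inv_product_graph]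
  have hγ₁ : (graph (τ⁻¹ : Equiv.Perm _) ⊚ γ') ⊚ γ₁ = identity _ := by
    rw [product_assoc, hτ, graph_inv_product_graph]
  have h2 := hαβ.symm.mul_right (δ' ⊚ graph (σ⁻¹ : Equiv.Perm _) ⊚ graph τ)
  rw [hβ, product_assoc γ₁, hδ₁, product_identity] at h2
  obtain ⟨ρ, hρ⟩ := h.exists_perm_right hq hγ₁ h2
  -- The one-sided case, applied to `γ₁` and `α` times a right inverse of `δ₁`, shows that `γ₁` is a
  -- right multiple of `γ`.
  have e5 : γ ⊚ γ' ⊚ γ₁ = γ₁ := by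
    have : γ₁ = γ ⊚ (δ ⊚ (δ' ⊚ graph (σ⁻¹ : Equiv.Perm _) ⊚ graph τ)
        ⊚ graph (ρ⁻¹ : Equiv.Perm _)) := by
      rw [← product_assoc γ, ← product_assoc γ, ← hα, hρ, product_assoc γ₁,
        graph_product_graph_inv, product_identity]
    rw [this, ← product_assoc, product_assoc γ γ' γ, hγ, product_identity]
  rw [product_assoc γ, ← hσ, hβ, ← product_assoc, ← product_assoc, e5]

end PartitionMonoid

/-! ### Consequences of a collapse -/

namespace PartitionMonoid

variable {n q : ℕ} {A B C Q : Type} {c : Con (PartitionMonoid n)}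

theorem graph_product_bot_product_flip_graph {r : A → Q} (hr : Function.Injective r) :
    graph r ⊚ (⊥ : Setoid (Q ⊕ Q)) ⊚ flip (graph r) = ⊥ := by
  rw [product_flip_graph, graph_product]
  ext x y
  change Sum.map r id (Sum.map id r x) = Sum.map r id (Sum.map id r y) ↔ x = y
  rcases x with x | x <;> rcases y with y | y <;> simp [hr.eq_iff]

theorem bot_eq_product : (⊥ : Setoid (A ⊕ B)) = (⊥ : Setoid (A ⊕ Fin 0)) ⊚
    (⊥ : Setoid (Fin 0 ⊕ B)) := by
  have e1 : upper (⊥ : Setoid (A ⊕ B)) = ⊥ := by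
    ext x y
    rcases x with x | x
    · rcases y with y | y
      · change Sum.inl x = Sum.inl y ↔ Sum.inl x = Sum.inl y
        simp
      · exact y.elim0
    · exact x.elim0
  have e2 : lower (⊥ : Setoid (A ⊕ B)) = ⊥ := by
    ext x y
    rcases x with x | x
    · exact x.elim0
    · rcases y with y | y
      · exact y.elim0
      · change Sum.inr x = Sum.inr y ↔ Sum.inr x = Sum.inr y
        simp
  rw [← e1, ← e2]
  ext x y
  rw [upper_product_lower_apply]
  constructor
  · intro h
    obtain rfl : x = y := h
    exact ⟨rfl, rfl⟩
  · exact And.left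

/-- Delete a moved point `i` from both rows. The identity becomes the identity on `q` points, while
in `graph σ` the upper point `σ⁻¹ i` loses its partner, so the result is no permutation. -/
theorem not_rigid_of_ext_graph {σ : Equiv.Perm (Fin (q + 1))} (hσ : σ ≠ 1)
    (h : Ext c (identity (Fin (q + 1))) (graph σ)) : ¬ Rigid c q := by
  intro hr
  obtain ⟨i, hi⟩ : ∃ i, σ i ≠ i := by
    by_contra! h; exact hσ (Equiv.ext h)
  have h1 := (h.mul_left (graph i.succAbove)).mul_right (flip (graph i.succAbove))
  rw [product_identity, graph_product_flip_graph Fin.succAbove_right_injective, graph_comp,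
    product_flip_graph] at h1
  obtain ⟨τ, hτ⟩ := hr _ h1
  have hne : σ⁻¹ i ≠ i := fun h => hi (by rw [Equiv.Perm.inv_eq_iff_eq] at h; exact h.symm)
  obtain ⟨k, hk⟩ := Fin.exists_succAbove_eq hne
  have : graph τ (.inl k) (.inr (τ k)) := rfl
  rw [← hτ] at this
  have : σ (i.succAbove k) = i.succAbove (τ k) := this
  rw [hk, ← Equiv.Perm.mul_apply, mul_inv_cancel, Equiv.Perm.one_apply] at this
  exact (Fin.succAbove_ne i (τ k)) this.symm

/-- The congruence `c` relates partitions with different kernels. -/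
def KernelCollapse (c : Con (PartitionMonoid n)) : Prop :=
  Ext c (⊤ : Setoid (Fin 2 ⊕ Fin 0)) ⊥

/-- The congruence `c` relates partitions with different cokernels. -/
def CokernelCollapse (c : Con (PartitionMonoid n)) : Prop :=
  Ext c (⊤ : Setoid (Fin 0 ⊕ Fin 2)) ⊥

theorem flip_top : flip (⊤ : Setoid (A ⊕ B)) = ⊤ := rfl

theorem kernelCollapse_starImage : KernelCollapse c.starImage ↔ CokernelCollapse c := by
  rw [KernelCollapse, CokernelCollapse, ← flip_top, ← flip_bot, ext_flip_iff]

/-- Restrict to two points and close the lower row by a block containing both: the identity becomes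
`⊤` and `⊥` stays `⊥`. -/
theorem kernelCollapse_of_ext_identity_bot (hq : 2 ≤ q) (h : Ext c (identity (Fin q)) ⊥) :
    KernelCollapse c := by
  have h1 := (h.mul_left (graph (Fin.castLE hq))).mul_right (flip (graph (Fin.castLE hq)))
  rw [product_identity, graph_product_flip_graph (Fin.castLE_injective hq),
    graph_product_bot_product_flip_graph (Fin.castLE_injective hq)] at h1
  have h2 := h1.mul_right (⊤ : Setoid (Fin 2 ⊕ Fin 0))
  rwa [identity_product, bot_eq_product, product_assoc,
    Subsingleton.elim (_ ⊚ _) (identity (Fin 0)), product_identity] at h2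

theorem cokernelCollapse_of_ext_identity_bot (hq : 2 ≤ q) (h : Ext c (identity (Fin q)) ⊥) :
    CokernelCollapse c := by
  rw [← kernelCollapse_starImage]
  refine kernelCollapse_of_ext_identity_bot hq ?_
  rw [← flip_identity, ← flip_bot]
  exact h.flip

/-- Blocks are merged two at a time, by induction up the finite lattice of partitions. -/
theorem KernelCollapse.ext_top [Finite A] (h : KernelCollapse c) (α : Setoid (A ⊕ Fin 0)) :
    Ext c α ⊤ := by
  have : Finite (Setoid (A ⊕ Fin 0)) :=
    Finite.of_injective (fun s => (s : A ⊕ Fin 0 → A ⊕ Fin 0 → Prop)) fun s t h =>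
      Setoid.ext fun x y => iff_of_eq (congrFun (congrFun h x) y)
  induction α using WellFoundedGT.induction with
  | ind α ih =>
    by_cases hα : α = ⊤
    · rw [hα]; exact .refl _
    · obtain ⟨a, b, hab⟩ : ∃ a b, ¬ α (.inl a) (.inl b) := by
        by_contra! h'
        refine hα (top_le_iff.1 fun x y _ => ?_)
        rcases x with x | x
        · rcases y with y | y
          · exact h' x y
          · exact y.elim0
        · exact x.elim0
      -- `θ` exposes the blocks of `a` and `b` as two lower points. Closing them by `⊥` gives back
      -- `α`; closing them by `⊤` joins the two blocks.
      let g : Fin 2 → Quotient α := ![Quotient.mk α (.inl a), Quotient.mk α (.inl b)]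
      let θ : Setoid (A ⊕ Fin 2) := Setoid.ker (Sum.elim (fun x => Quotient.mk α (.inl x)) g)
      have h1 : θ ⊚ (⊥ : Setoid (Fin 2 ⊕ Fin 0)) = α := by
        ext x y
        rcases x with x | x
        · rcases y with y | y
          · constructor
            · intro hxy
              have := product_of_invariant (Sum.elim (fun x => Quotient.mk α (.inl x))
                (Sum.elim g Fin.elim0)) ?_ ?_ hxy
              · exact Quotient.exact (s := α) this
              · intro u v huv
                rcases u with u | u <;> rcases v with v | v <;> exact huv
              · intro u v huv
                obtain rfl : u = v := huv
                rfl
            · intro hxy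
              exact product_inl_inl (α := θ) (Quotient.sound hxy) _
          · exact y.elim0
        · exact x.elim0
      have h2 : α ≤ θ ⊚ (⊤ : Setoid (Fin 2 ⊕ Fin 0)) := by
        intro x y hxy
        rcases x with x | x
        · rcases y with y | y
          · exact product_inl_inl (α := θ) (Quotient.sound hxy) _
          · exact y.elim0
        · exact x.elim0
      have h3 : (θ ⊚ (⊤ : Setoid (Fin 2 ⊕ Fin 0))) (.inl a) (.inl b) := by
        have e1 : Connected θ (⊤ : Setoid (Fin 2 ⊕ Fin 0)) (.inl a) (.inr (.inl 0)) :=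
          connected_upper (α := θ) (x := .inl a) (y := .inr 0) rfl _
        have e2 : Connected θ (⊤ : Setoid (Fin 2 ⊕ Fin 0)) (.inr (.inl 0)) (.inr (.inl 1)) :=
          connected_lower θ trivial
        have e3 : Connected θ (⊤ : Setoid (Fin 2 ⊕ Fin 0)) (.inr (.inl 1)) (.inl b) :=
          connected_upper (α := θ) (x := .inr 1) (y := .inl b) rfl _
        exact (Connected _ _).trans e1 ((Connected _ _).trans e2 e3)
      have h4 : Ext c α (θ ⊚ (⊤ : Setoid (Fin 2 ⊕ Fin 0))) := by
        have := (h.mul_left θ).symm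
        rwa [h1] at this
      refine h4.trans (ih _ (lt_of_le_of_ne h2 fun h => hab ?_))
      rw [h]
      exact h3

theorem KernelCollapse.ext [Finite A] (h : KernelCollapse c) (α β : Setoid (A ⊕ Fin 0)) :
    Ext c α β :=
  (h.ext_top α).trans (h.ext_top β).symm

/-- Pulling back to two points that `α` joins and `β` separates gives exactly the pair `⊤`, `⊥`. -/
theorem kernelCollapse_of_not_le {α β : Setoid (A ⊕ Fin 0)} (h : Ext c α β) (hne : ¬ α ≤ β) :
    KernelCollapse c := by
  obtain ⟨x, y, hxy, hxy'⟩ : ∃ x y, α (.inl x) (.inl y) ∧ ¬ β (.inl x) (.inl y) := by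
    by_contra! h'
    refine hne fun x y hxy => ?_
    rcases x with x | x
    · rcases y with y | y
      · exact h' x y hxy
      · exact y.elim0
    · exact x.elim0
  have h1 := h.mul_left (graph ![x, y])
  rw [graph_product, graph_product] at h1
  have e1 : α.comap (Sum.map ![x, y] id) = ⊤ := by
    refine top_le_iff.1 fun u v _ => ?_
    rcases u with u | u
    · rcases v with v | v
      · fin_cases u <;> fin_cases v
        · exact α.refl _
        · exact hxy
        · exact α.symm hxy
        · exact α.refl _
      · exact v.elim0
    · exact u.elim0
  have e2 : β.comap (Sum.map ![x, y] id) = ⊥ := by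
    refine le_bot_iff.1 fun u v huv => ?_
    rcases u with u | u
    · rcases v with v | v
      · fin_cases u <;> fin_cases v
        · rfl
        · exact absurd huv hxy'
        · exact absurd (β.symm huv) hxy'
        · rfl
      · exact v.elim0
    · exact u.elim0
  rwa [e1, e2] at h1

theorem ext_upper_iff [Finite A] {α β : Setoid (A ⊕ Fin 0)} :
    Ext c α β ↔ KernelCollapse c ∨ α = β := by
  constructor
  · intro h
    by_contra! hne
    refine hne.2 (le_antisymm ?_ ?_)
    · by_contra h'
      exact hne.1 (kernelCollapse_of_not_le h h')
    · by_contra h'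
      exact hne.1 (kernelCollapse_of_not_le h.symm h')
  · rintro (h | rfl)
    · exact h.ext _ _
    · exact .refl _

theorem flip_injective : Function.Injective (flip : Setoid (A ⊕ B) → Setoid (B ⊕ A)) :=
  Function.LeftInverse.injective flip_flip

theorem ext_lower_iff [Finite B] {α β : Setoid (Fin 0 ⊕ B)} :
    Ext c α β ↔ CokernelCollapse c ∨ α = β := by
  rw [← ext_flip_iff, ext_upper_iff, kernelCollapse_starImage, flip_injective.eq_iff]

theorem hat_eq_self {α : PartitionMonoid n} (h : α.rank = 0) : α.hat = α := by
  obtain ⟨γ, δ, hα⟩ := exists_eq_product_of_rank_le (le_of_eq h)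
  refine PartitionMonoid.ext ?_
  rw [hat_rel, hα, upper_product_zero, lower_product_zero]

/-- A partition of rank 0 is its kernel times its cokernel over an empty middle row, so the two
sides can be treated independently. -/
theorem con_hat_iff {α β : PartitionMonoid n} : c α.hat β.hat ↔
    (KernelCollapse c ∨ upper α.rel = upper β.rel) ∧
      (CokernelCollapse c ∨ lower α.rel = lower β.rel) := by
  rw [← ext_rel_iff, ← ext_upper_iff, ← ext_lower_iff, hat_rel, hat_rel]
  constructor
  · intro h
    have h1 := h.mul_right (flip (graph Fin.elim0))
    have h2 := h.mul_left (graph Fin.elim0)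
    rw [← upper_eq_product, ← upper_eq_product, upper_product_zero, upper_product_zero] at h1
    rw [← lower_eq_product, ← lower_eq_product, lower_product_zero, lower_product_zero] at h2
    exact ⟨h1, h2⟩
  · rintro ⟨h1, h2⟩
    exact h1.mul h2

/-- Replacing the identity by `⊥` inside `α = γ ⊚ δ` cuts the transversals but may also change the
kernel and cokernel. For `q ≥ 2` the collapse makes this harmless. For `q ≤ 1` nothing changes,
because a row of at most one point has one partition. The case `q = 0` is listed separately since
every congruence is rigid there. -/
theorem con_hat_self (h : q = 0 ∨ ¬ Rigid c q) {α : PartitionMonoid n} (hα : α.rank ≤ q) :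
    c α α.hat := by
  rcases h with rfl | h
  · rw [hat_eq_self (Nat.le_zero.1 hα)]
    exact c.refl _
  · obtain ⟨γ, δ, hα⟩ := exists_eq_product_of_rank_le hα
    have hb := ext_identity_bot_of_not_rigid h
    rw [← ext_rel_iff, hat_rel]
    have h1 := (hb.mul_left γ).mul_right δ
    rw [product_identity, ← hα, bot_eq_product, ← product_assoc, product_assoc] at h1
    refine h1.trans (Ext.mul ?_ ?_)
    · by_cases hq : 2 ≤ q
      · exact (kernelCollapse_of_ext_identity_bot hq hb).ext _ _
      · have hs : Subsingleton (Setoid (Fin q ⊕ Fin 0)) := by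
          obtain rfl | rfl : q = 0 ∨ q = 1 := by omega
          all_goals infer_instance
        rw [hα, upper_product, Subsingleton.elim (upper δ) ⊥]
        exact .refl _
    · by_cases hq : 2 ≤ q
      · rw [ext_lower_iff]
        exact Or.inl (cokernelCollapse_of_ext_identity_bot hq hb)
      · have hs : Subsingleton (Setoid (Fin 0 ⊕ Fin q)) := by
          obtain rfl | rfl : q = 0 ∨ q = 1 := by omega
          all_goals infer_instance
        rw [hα, lower_product, Subsingleton.elim (lower γ) ⊥]
        exact .refl _

theorem con_iff_of_rank_le (h : q = 0 ∨ ¬ Rigid c q) {α β : PartitionMonoid n}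
    (hα : α.rank ≤ q) (hβ : β.rank ≤ q) : c α β ↔
    (KernelCollapse c ∨ upper α.rel = upper β.rel) ∧
      (CokernelCollapse c ∨ lower α.rel = lower β.rel) := by
  rw [← con_hat_iff]
  have h1 := con_hat_self h hα
  have h2 := con_hat_self h hβ
  exact ⟨fun h => c.trans (c.symm h1) (c.trans h h2), fun h => c.trans h1 (c.trans h (c.symm h2))⟩

/-! ### A uniform description of the congruences -/

theorem nuRel_iff {N : Subgroup (Equiv.Perm (Fin q))} {α β : PartitionMonoid n} :
    nuRel n N α β ↔ α.rank = q ∧ β.rank = q ∧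
      ∃ σ ∈ N, ∃ (γ : Setoid (Fin n ⊕ Fin q)) (δ : Setoid (Fin q ⊕ Fin n)),
        α.rel = γ ⊚ δ ∧ β.rel = γ ⊚ graph σ ⊚ δ := by
  refine and_congr_right fun hα => and_congr_right fun hβ => ?_
  constructor
  · rintro ⟨σ, hσ, τ, hτ, γ, δ, rfl, rfl⟩
    -- `σ` is absorbed into the left factor, which leaves `τ * σ⁻¹` as the twist.
    refine ⟨τ * σ⁻¹, N.mul_mem hτ (N.inv_mem hσ), γ.rel ⊚ restrictFin n q ⊚ graph σ,
      flip (restrictFin n q) ⊚ δ.rel, ?_, ?_⟩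
    · simp only [mul_rel, bar_rel, product_assoc]
    · rw [mul_rel, mul_rel, bar_rel, product_assoc _ (graph σ), ← graph_mul, inv_mul_cancel_right]
      simp only [product_assoc]
  · rintro ⟨σ, hσ, γ, δ, h1, h2⟩
    have hq : q ≤ n := hα ▸ rank_le α
    have e : ∀ τ : Equiv.Perm (Fin q), γ ⊚ graph τ ⊚ δ =
        ((⟨γ ⊚ graph (Fin.castLE hq)⟩ * bar τ * ⟨flip (graph (Fin.castLE hq)) ⊚ δ⟩ :
          PartitionMonoid n)).rel := by
      intro τ
      rw [mul_rel, mul_rel, bar_rel]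
      simp only [product_assoc]
      rw [← product_assoc (graph (Fin.castLE hq)) (restrictFin n q),
        graph_castLE_product_restrictFin, identity_product,
        ← product_assoc (flip (restrictFin n q)), ← flip_product,
        graph_castLE_product_restrictFin, flip_identity, identity_product]
    refine ⟨1, N.one_mem, σ, hσ, ⟨γ ⊚ graph (Fin.castLE hq)⟩,
      ⟨flip (graph (Fin.castLE hq)) ⊚ δ⟩, PartitionMonoid.ext ?_, PartitionMonoid.ext ?_⟩
    · rw [← e, graph_one, product_identity, h1]
    · rw [← e, h2]

theorem rank_eq_of_twist {α β : PartitionMonoid n} {σ : Equiv.Perm (Fin q)}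
    {γ : Setoid (Fin n ⊕ Fin q)} {δ : Setoid (Fin q ⊕ Fin n)} (hα : α.rel = γ ⊚ δ)
    (hβ : β.rel = γ ⊚ graph σ ⊚ δ) (h : α.rank = q) : β.rank = q := by
  obtain ⟨-, ⟨γ', hγ⟩, hδ⟩ := splitFactorization_of_rank_eq hα h
  refine SplitFactorization.rank_eq (γ := γ ⊚ graph σ) (δ := δ)
    ⟨hβ, ⟨graph (σ⁻¹ : Equiv.Perm _) ⊚ γ', ?_⟩, hδ⟩
  rw [product_assoc, ← product_assoc γ', hγ, identity_product, graph_inv_product_graph]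

theorem twist_symm {α β : Setoid (A ⊕ B)} {σ : Equiv.Perm Q}
    {γ : Setoid (A ⊕ Q)} {δ : Setoid (Q ⊕ B)} (hα : α = γ ⊚ δ)
    (hβ : β = γ ⊚ graph σ ⊚ δ) :
    β = (γ ⊚ graph σ) ⊚ δ ∧ α = (γ ⊚ graph σ) ⊚ graph (σ⁻¹ : Equiv.Perm Q) ⊚ δ := by
  refine ⟨hβ, ?_⟩
  rw [product_assoc γ, graph_product_graph_inv, product_identity, hα]

theorem nuRel_symm {N : Subgroup (Equiv.Perm (Fin q))} {α β : PartitionMonoid n}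
    (h : nuRel n N α β) : nuRel n N β α := by
  obtain ⟨h1, h2, σ, hσ, τ, hτ, γ, δ, h3, h4⟩ := h
  exact ⟨h2, h1, τ, hτ, σ, hσ, γ, δ, h4, h3⟩

/-- The two factorizations of `β` differ by a permutation `ρ` of the middle row. Carrying the second
twist over to the first factorization conjugates it by `ρ`, which is where normality enters. -/
theorem nuRel_trans {N : Subgroup (Equiv.Perm (Fin q))} [hN : N.Normal]
    {α β χ : PartitionMonoid n} (h : nuRel n N α β) (h' : nuRel n N β χ) : nuRel n N α χ := by
  rw [nuRel_iff] at h h' ⊢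
  obtain ⟨hα, hβ, σ, hσ, γ, δ, h1, h2⟩ := h
  obtain ⟨-, hχ, τ, hτ, η, θ, h3, h4⟩ := h'
  obtain ⟨-, ⟨η', hη⟩, ⟨θ', hθ⟩⟩ := splitFactorization_of_rank_eq h3 hβ
  have e1 : (η' ⊚ γ ⊚ graph σ) ⊚ (δ ⊚ θ') = identity _ := by
    have : η' ⊚ β.rel ⊚ θ' = identity _ := by
      rw [h3, product_assoc, product_assoc, hθ, product_identity, hη]
    rw [← this, h2]
    simp only [product_assoc]
  obtain ⟨ρ, hρ⟩ := eq_graph_of_product_eq_identity e1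
  rw [hρ] at e1
  have e2 := eq_graph_inv e1
  have e3 : η = γ ⊚ graph σ ⊚ graph (ρ⁻¹ : Equiv.Perm _) := by
    rw [← e2, ← product_assoc, ← h2, h3, product_assoc, hθ, product_identity]
  have e4 : θ = graph ρ ⊚ δ := by
    rw [← hρ, product_assoc, product_assoc, ← product_assoc γ, ← h2, h3, ← product_assoc, hη,
      identity_product]
  refine ⟨hα, hχ, ρ * τ * ρ⁻¹ * σ, ?_, γ, δ, h1, ?_⟩
  · exact N.mul_mem (hN.conj_mem _ hτ _) hσ
  · rw [h4, e3, e4]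
    simp only [graph_mul, product_assoc]

theorem nuRel_bot {α β : PartitionMonoid n}
    (h : nuRel n (⊥ : Subgroup (Equiv.Perm (Fin q))) α β) : α = β := by
  obtain ⟨-, -, σ, hσ, τ, hτ, γ, δ, rfl, rfl⟩ := h
  rw [Subgroup.mem_bot] at hσ hτ
  rw [hσ, hτ]

end PartitionMonoid

/-! ### The relations `R_q`, `R_N`, `λ`, `ρ`, `μ` in a uniform notation -/

namespace PartitionMonoid

variable {n q : ℕ}

/-- `Δ ∪ ν_N` together with the pairs of partitions of rank less than `q` that have the same kernel
(unless `a`) and the same cokernel (unless `b`). -/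
def gridRel (n : ℕ) {q : ℕ} (N : Subgroup (Equiv.Perm (Fin q))) (a b : Bool)
    (α β : PartitionMonoid n) : Prop :=
  α = β ∨ nuRel n N α β ∨ (α.rank < q ∧ β.rank < q ∧
    (a = true ∨ upper α.rel = upper β.rel) ∧ (b = true ∨ lower α.rel = lower β.rel))

section Congruence

variable {N : Subgroup (Equiv.Perm (Fin q))} {a b : Bool} {α β χ : PartitionMonoid n}

theorem gridRel_symm (h : gridRel n N a b α β) : gridRel n N a b β α := by
  rcases h with rfl | h | ⟨h1, h2, h3, h4⟩
  · exact Or.inl rfl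
  · exact Or.inr (Or.inl (nuRel_symm h))
  · exact Or.inr (Or.inr ⟨h2, h1, h3.imp_right Eq.symm, h4.imp_right Eq.symm⟩)

theorem gridRel_trans [N.Normal] (h : gridRel n N a b α β) (h' : gridRel n N a b β χ) :
    gridRel n N a b α χ := by
  rcases h with rfl | h | ⟨h1, h2, h3, h4⟩
  · exact h'
  · rcases h' with rfl | h' | ⟨h1', -⟩
    · exact Or.inr (Or.inl h)
    · exact Or.inr (Or.inl (nuRel_trans h h'))
    · exact absurd h.2.1 h1'.ne
  · rcases h' with rfl | h' | ⟨h1', h2', h3', h4'⟩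
    · exact Or.inr (Or.inr ⟨h1, h2, h3, h4⟩)
    · exact absurd h'.1 h2.ne
    · refine Or.inr (Or.inr ⟨h1, h2', ?_, ?_⟩)
      · rcases h3 with h3 | h3
        · exact Or.inl h3
        · exact h3'.imp_right h3.trans
      · rcases h4 with h4 | h4
        · exact Or.inl h4
        · exact h4'.imp_right h4.trans

theorem nuRel_star (h : nuRel n N α β) : nuRel n N (star α) (star β) := by
  rw [nuRel_iff] at h ⊢
  obtain ⟨hα, hβ, σ, hσ, γ, δ, h1, h2⟩ := h
  refine ⟨by rw [rank_star, hα], by rw [rank_star, hβ], σ⁻¹, N.inv_mem hσ, flip δ, flip γ, ?_, ?_⟩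
  · rw [star_rel, h1, flip_product]
  · rw [star_rel, h2, flip_product, flip_product, flip_graph_perm, product_assoc]

theorem gridRel_star (h : gridRel n N a b α β) : gridRel n N b a (star α) (star β) := by
  rcases h with rfl | h | ⟨h1, h2, h3, h4⟩
  · exact Or.inl rfl
  · exact Or.inr (Or.inl (nuRel_star h))
  · refine Or.inr (Or.inr ⟨by rwa [rank_star], by rwa [rank_star], ?_, ?_⟩)
    · rw [star_rel, star_rel, upper_flip, upper_flip]
      exact h4.imp_right (congrArg _)
    · rw [star_rel, star_rel, lower_flip, lower_flip]
      exact h3.imp_right (congrArg _)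

theorem upper_product_of_rank_le_one (hα : α.rank ≤ 1) (θ : Setoid (Fin n ⊕ Fin n)) :
    upper (α.rel ⊚ θ) = upper α.rel := by
  obtain ⟨γ, δ, h⟩ := exists_eq_product_of_rank_le hα
  rw [h, product_assoc, upper_product γ, upper_product γ, Subsingleton.elim (upper (δ ⊚ θ))]

/-- A partition of two points is symmetric under their exchange. This allows `𝒮₂` alongside kernels
that are still distinguished, and fails from three points on. -/
theorem graph_product_of_le_two (hq : q ≤ 2) (σ : Equiv.Perm (Fin q)) (θ : Setoid (Fin q ⊕ Fin 0)) :
    graph σ ⊚ θ = θ := by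
  by_cases h : q = 2
  · subst h
    have hσ : σ = 1 ∨ σ = Equiv.swap 0 1 := by revert σ; decide
    rcases hσ with rfl | rfl
    · rw [graph_one, identity_product]
    · rw [graph_product]
      ext x y
      rcases x with x | x
      · rcases y with y | y
        · fin_cases x <;> fin_cases y
          · exact ⟨fun _ => θ.refl _, fun _ => θ.refl _⟩
          · exact ⟨fun h => θ.symm h, fun h => θ.symm h⟩
          · exact ⟨fun h => θ.symm h, fun h => θ.symm h⟩
          · exact ⟨fun _ => θ.refl _, fun _ => θ.refl _⟩
        · exact y.elim0
      · exact x.elim0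
  · have : Subsingleton (Fin q) := Fin.subsingleton_iff_le_one.2 (by omega)
    rw [Subsingleton.elim σ 1, graph_one, identity_product]

theorem product_graph_of_le_two (hq : q ≤ 2) (σ : Equiv.Perm (Fin q)) (θ : Setoid (Fin 0 ⊕ Fin q)) :
    θ ⊚ graph σ = θ := by
  apply flip_injective
  rw [flip_product, flip_graph_perm, graph_product_of_le_two hq]

/-- The critical case is a twisted pair whose rank drops: both members enter the ideal together. For
`q ≤ 2` the twist is invisible in the kernel and cokernel, and otherwise these are ignored. -/
theorem gridRel_mul_right (hab : (a = true ∧ b = true) ∨ q ≤ 2) (h : gridRel n N a b α β)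
    (θ : PartitionMonoid n) : gridRel n N a b (α * θ) (β * θ) := by
  rcases h with rfl | h | ⟨h1, h2, h3, h4⟩
  · exact Or.inl rfl
  · obtain ⟨hα, hβ, σ, hσ, γ, δ, h1, h2⟩ := nuRel_iff.1 h
    have h1' : (α * θ).rel = γ ⊚ (δ ⊚ θ.rel) := by rw [mul_rel, h1, product_assoc]
    have h2' : (β * θ).rel = γ ⊚ graph σ ⊚ (δ ⊚ θ.rel) := by rw [mul_rel, h2, product_assoc]
    by_cases hr : (α * θ).rank = q
    · exact Or.inr (Or.inl (nuRel_iff.2 ⟨hr, rank_eq_of_twist h1' h2' hr, σ, hσ, _, _, h1', h2'⟩))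
    · have hr' : (β * θ).rank ≠ q := fun h =>
        hr (rank_eq_of_twist (twist_symm h1' h2').1 (twist_symm h1' h2').2 h)
      refine Or.inr (Or.inr ⟨lt_of_le_of_ne ((rank_mul_le_left _ _).trans hα.le) hr,
        lt_of_le_of_ne ((rank_mul_le_left _ _).trans hβ.le) hr', ?_⟩)
      rcases hab with hab | hq
      · exact ⟨Or.inl hab.1, Or.inl hab.2⟩
      · refine ⟨Or.inr ?_, Or.inr ?_⟩
        · rw [h1', h2', product_assoc, upper_product γ, upper_product γ, upper_product (graph σ),
            graph_product_of_le_two hq]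
        · rw [h1', h2', lower_product, lower_product, lower_product, product_graph_of_le_two hq]
  · refine Or.inr (Or.inr ⟨(rank_mul_le_left _ _).trans_lt h1,
      (rank_mul_le_left _ _).trans_lt h2, ?_, ?_⟩)
    · rcases hab with hab | hq
      · exact Or.inl hab.1
      · refine h3.imp_right fun h3 => ?_
        rw [mul_rel, mul_rel, upper_product_of_rank_le_one (by omega),
          upper_product_of_rank_le_one (by omega), h3]
    · refine h4.imp_right fun h4 => ?_
      rw [mul_rel, mul_rel, lower_product, lower_product, h4]

theorem gridRel_mul_left (hab : (a = true ∧ b = true) ∨ q ≤ 2) (h : gridRel n N a b α β)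
    (θ : PartitionMonoid n) : gridRel n N a b (θ * α) (θ * β) := by
  have := gridRel_star (gridRel_mul_right (hab.imp_left And.symm) (gridRel_star h) (star θ))
  rwa [star_mul, star_mul, star_star, star_star, star_star] at this

/-- The relations `gridRel` as congruences. -/
def gridCon (n : ℕ) {q : ℕ} (N : Subgroup (Equiv.Perm (Fin q))) [N.Normal] (a b : Bool)
    (hab : (a = true ∧ b = true) ∨ q ≤ 2) : Con (PartitionMonoid n) where
  r := gridRel n N a b
  iseqv := ⟨fun _ => Or.inl rfl, gridRel_symm, gridRel_trans⟩
  mul' h h' := gridRel_trans (gridRel_mul_right hab h _) (gridRel_mul_left hab h' _)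

end Congruence

/-! ### Every congruence is of this form -/

section Classification

variable {c : Con (PartitionMonoid n)}

/-- The permutations that `c` relates to the identity. -/
def permSubgroup (c : Con (PartitionMonoid n)) (q : ℕ) : Subgroup (Equiv.Perm (Fin q)) where
  carrier := {σ | Ext c (identity (Fin q)) (graph σ)}
  one_mem' := Ext.refl _
  mul_mem' {σ τ} hσ hτ := by
    have := hτ.mul hσ
    rwa [identity_product, ← graph_mul] at this
  inv_mem' {σ} hσ := by
    have := hσ.mul_right (graph (σ⁻¹ : Equiv.Perm _))
    rw [identity_product, graph_product_graph_inv] at this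
    exact this.symm

theorem mem_permSubgroup {σ : Equiv.Perm (Fin q)} :
    σ ∈ permSubgroup c q ↔ Ext c (identity (Fin q)) (graph σ) := Iff.rfl

instance : (permSubgroup c q).Normal where
  conj_mem σ hσ τ := by
    have := (Ext.mul_left hσ (graph (τ⁻¹ : Equiv.Perm _))).mul_right (graph τ)
    rwa [product_identity, graph_inv_product_graph, product_assoc, ← graph_mul, ← graph_mul] at this

theorem kernelCollapse_and_cokernelCollapse (hq : 2 ≤ q) (h : ¬ Rigid c q) :
    KernelCollapse c ∧ CokernelCollapse c :=
  ⟨kernelCollapse_of_ext_identity_bot hq (ext_identity_bot_of_not_rigid h),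
    cokernelCollapse_of_ext_identity_bot hq (ext_identity_bot_of_not_rigid h)⟩

open Classical in
theorem con_iff_gridRel_of_not_rigid (h : q = 0 ∨ ¬ Rigid c q)
    (hc : ∀ α β : PartitionMonoid n, c α β → α ≠ β → α.rank ≤ q) (α β : PartitionMonoid n) :
    c α β ↔ gridRel n (⊥ : Subgroup (Equiv.Perm (Fin (q + 1))))
      (decide (KernelCollapse c)) (decide (CokernelCollapse c)) α β := by
  simp only [gridRel, decide_eq_true_eq, Nat.lt_succ_iff]
  constructor
  · intro hαβ
    by_cases hne : α = β
    · exact Or.inl hne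
    · have h1 := hc _ _ hαβ hne
      have h2 := hc _ _ (c.symm hαβ) (Ne.symm hne)
      exact Or.inr (Or.inr ⟨h1, h2, (con_iff_of_rank_le h h1 h2).1 hαβ⟩)
  · rintro (rfl | h' | ⟨h1, h2, h3⟩)
    · exact c.refl _
    · rw [nuRel_bot h']
      exact c.refl _
    · exact (con_iff_of_rank_le h h1 h2).2 h3

open Classical in
theorem con_iff_gridRel_of_rigid (h : Rigid c (q + 1)) (h' : q = 0 ∨ ¬ Rigid c q)
    (hc : ∀ α β : PartitionMonoid n, c α β → α ≠ β → α.rank ≤ q + 1) (α β : PartitionMonoid n) :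
    c α β ↔ gridRel n (permSubgroup c (q + 1))
      (decide (KernelCollapse c)) (decide (CokernelCollapse c)) α β := by
  simp only [gridRel, decide_eq_true_eq, Nat.lt_succ_iff]
  have key : ∀ α β : PartitionMonoid n, c α β → α ≠ β → α.rank = q + 1 →
      nuRel n (permSubgroup c (q + 1)) α β := by
    intro α β hαβ hne hα
    have hβ := hc _ _ (c.symm hαβ) hne.symm
    obtain ⟨γ, δ, hs⟩ := exists_splitFactorization hα
    obtain ⟨γ₁, δ₁, hβ⟩ := exists_eq_product_of_rank_le hβ
    obtain ⟨σ, hσ⟩ := h.exists_perm (Nat.succ_ne_zero q) hs hβ (Ext.of_con hαβ)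
    refine nuRel_iff.2 ⟨hα, rank_eq_of_twist hs.eq hσ hα, σ, ?_, γ, δ, hs.eq, hσ⟩
    -- Multiplying by the one-sided inverses strips `γ` and `δ` off and leaves the identity related
    -- to `graph σ`.
    have h1 := Ext.of_con hαβ
    obtain ⟨hα', ⟨γ', hγ⟩, ⟨δ', hδ⟩⟩ := hs
    have h2 := (h1.mul_left γ').mul_right δ'
    rw [hα', hσ, ← product_assoc, hγ, identity_product, hδ, product_assoc γ, ← product_assoc γ',
      hγ, identity_product, product_assoc, hδ, product_identity] at h2
    exact h2
  constructor
  · intro hαβ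
    by_cases hne : α = β
    · exact Or.inl hne
    · have h1 := hc _ _ hαβ hne
      have h2 := hc _ _ (c.symm hαβ) (Ne.symm hne)
      by_cases hα : α.rank = q + 1
      · exact Or.inr (Or.inl (key _ _ hαβ hne hα))
      · by_cases hβ : β.rank = q + 1
        · exact Or.inr (Or.inl (nuRel_symm (key _ _ (c.symm hαβ) (Ne.symm hne) hβ)))
        · have h1 : α.rank ≤ q := by omega
          have h2 : β.rank ≤ q := by omega
          exact Or.inr (Or.inr ⟨h1, h2, (con_iff_of_rank_le h' h1 h2).1 hαβ⟩)
  · rintro (rfl | hν | ⟨h1, h2, h3⟩)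
    · exact c.refl _
    · obtain ⟨-, -, σ, hσ, γ, δ, h1, h2⟩ := nuRel_iff.1 hν
      rw [← ext_rel_iff, h1, h2]
      have := (Ext.mul_left (mem_permSubgroup.1 hσ) γ).mul_right δ
      rwa [product_identity] at this
    · exact (con_iff_of_rank_le h' h1 h2).2 h3

theorem exists_gridRel (c : Con (PartitionMonoid n)) :
    ∃ (q : ℕ) (N : Subgroup (Equiv.Perm (Fin q))) (a b : Bool), 1 ≤ q ∧ q ≤ n + 1 ∧ N.Normal ∧
      (q = n + 1 → N = ⊥) ∧ ((a = true ∧ b = true) ∨ q ≤ 2) ∧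
      ∀ α β, c α β ↔ gridRel n N a b α β := by
  classical
  have hex : ∃ r, ∀ α β : PartitionMonoid n, c α β → α ≠ β → α.rank ≤ r :=
    ⟨n, fun α _ _ _ => rank_le α⟩
  -- `r` is the largest rank at which `c` is nontrivial, and 0 if `c` is equality.
  set r := Nat.find hex with hr
  have hc := Nat.find_spec hex
  rw [← hr] at hc
  have hrn : r ≤ n := Nat.find_min' hex fun α _ _ _ => rank_le α
  by_cases h : r = 0 ∨ ¬ Rigid c r
  · refine ⟨r + 1, ⊥, _, _, Nat.le_add_left 1 r, Nat.succ_le_succ hrn, inferInstance,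
      fun _ => rfl, ?_, con_iff_gridRel_of_not_rigid h hc⟩
    simp only [decide_eq_true_eq]
    by_cases hr2 : 2 ≤ r
    · exact Or.inl (kernelCollapse_and_cokernelCollapse hr2 (h.resolve_left (by omega)))
    · exact Or.inr (by omega)
  · push Not at h
    obtain ⟨h0, hrig⟩ := h
    obtain ⟨p, hp⟩ := Nat.exists_eq_succ_of_ne_zero h0
    rw [hp] at hrig hc hrn
    -- Minimality of `r = p + 1` yields a nontrivial pair of exactly this rank, hence a twist `σ ≠
    -- 1`, hence a collapse at degree `p`.
    have hmin := Nat.find_min hex (m := p) (by omega)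
    push Not at hmin
    obtain ⟨α, β, hαβ, hne, hα⟩ := hmin
    have hα : α.rank = p + 1 := le_antisymm (hc _ _ hαβ hne) hα
    obtain ⟨γ, δ, hs⟩ := exists_splitFactorization hα
    obtain ⟨γ₁, δ₁, hβ⟩ := exists_eq_product_of_rank_le (hc _ _ (c.symm hαβ) hne.symm)
    obtain ⟨σ, hσ⟩ := hrig.exists_perm (Nat.succ_ne_zero p) hs hβ (Ext.of_con hαβ)
    have hσ1 : σ ≠ 1 := by
      rintro rfl
      rw [graph_one, product_identity] at hσ
      exact hne (PartitionMonoid.ext (hs.eq.trans hσ.symm))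
    have hσN : Ext c (identity _) (graph σ) := by
      have h1 := Ext.of_con hαβ
      obtain ⟨hα', ⟨γ', hγ⟩, ⟨δ', hδ⟩⟩ := hs
      have h2 := (h1.mul_left γ').mul_right δ'
      rw [hα', hσ, ← product_assoc, hγ, identity_product, hδ, product_assoc γ, ← product_assoc γ',
        hγ, identity_product, product_assoc, hδ, product_identity] at h2
      exact h2
    have hnr := not_rigid_of_ext_graph hσ1 hσN
    refine ⟨p + 1, permSubgroup c (p + 1), _, _, Nat.le_add_left 1 p, by omega, inferInstance,
      by omega, ?_, con_iff_gridRel_of_rigid hrig (Or.inr hnr) hc⟩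
    simp only [decide_eq_true_eq]
    by_cases hp2 : 2 ≤ p
    · exact Or.inl (kernelCollapse_and_cokernelCollapse hp2 hnr)
    · exact Or.inr (by omega)

end Classification

/-! ### Inclusion of these congruences -/

section Order

/-- Compressed to the first `q` points, `bar 1` and `bar σ` become the identity and `graph σ`. The
outer factors then become inverse permutations, so `σ` is a conjugate of an element of `N`. -/
theorem nuRel_bar_iff {N : Subgroup (Equiv.Perm (Fin q))} [hN : N.Normal] (hq : q ≤ n)
    {σ : Equiv.Perm (Fin q)} : nuRel n N (bar (1 : Equiv.Perm (Fin q))) (bar σ) ↔ σ ∈ N := by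
  constructor
  · intro h
    obtain ⟨-, -, τ, hτ, γ, δ, h1, h2⟩ := nuRel_iff.1 h
    have hι := graph_castLE_product_restrictFin hq
    set ι := graph (Fin.castLE hq)
    have key : ∀ τ : Equiv.Perm (Fin q), ι ⊚ (bar τ : PartitionMonoid n).rel ⊚ flip ι = graph τ := by
      intro τ
      rw [bar_rel, ← product_assoc, ← product_assoc, hι, identity_product, product_assoc,
        ← flip_product, hι, flip_identity, product_identity]
    have e1 := key 1
    have e2 := key σ
    rw [h1, ← product_assoc, product_assoc, graph_one] at e1
    obtain ⟨ρ, hρ⟩ := eq_graph_of_product_eq_identity e1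
    rw [hρ] at e1
    have e3 := eq_graph_inv e1
    rw [h2, product_assoc, product_assoc γ, product_assoc γ, product_assoc (graph τ), e3,
      ← product_assoc, hρ, ← graph_mul, ← graph_mul] at e2
    have e4 := DFunLike.coe_injective (graph_injective e2)
    rw [← e4]
    simpa using hN.conj_mem _ hτ ρ⁻¹
  · intro h
    exact ⟨rank_bar hq _, rank_bar hq _, 1, N.one_mem, σ, h, 1, 1, by simp, by simp⟩

theorem bar_injective (hq : q ≤ n) :
    Function.Injective (bar : Equiv.Perm (Fin q) → PartitionMonoid n) := by
  intro σ τ h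
  have h' := congrArg PartitionMonoid.rel h
  have hι := graph_castLE_product_restrictFin hq
  have key : ∀ τ : Equiv.Perm (Fin q), graph (Fin.castLE hq) ⊚ (bar τ : PartitionMonoid n).rel ⊚
      flip (graph (Fin.castLE hq)) = graph τ := by
    intro τ
    rw [bar_rel, ← product_assoc, ← product_assoc, hι, identity_product, product_assoc,
      ← flip_product, hι, flip_identity, product_identity]
  have := key σ
  rw [h', key] at this
  exact (DFunLike.coe_injective (graph_injective this)).symm

variable {q' : ℕ} {N : Subgroup (Equiv.Perm (Fin q))} {N' : Subgroup (Equiv.Perm (Fin q'))}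
  {a b a' b' : Bool}

/-- Twisted pairs of the smaller degree land in the larger ideal, where both flags are true; if
instead `q' ≤ 2`, then `q ≤ 1` and there are no nontrivial twists. -/
theorem gridRel_mono_of_lt (hab : (a' = true ∧ b' = true) ∨ q' ≤ 2) (hq : q < q')
    (ha : a ≤ a') (hb : b ≤ b') {α β : PartitionMonoid n} (h : gridRel n N a b α β) :
    gridRel n N' a' b' α β := by
  rcases h with rfl | h | ⟨h1, h2, h3, h4⟩
  · exact Or.inl rfl
  · rcases hab with hab | hab
    · exact Or.inr (Or.inr ⟨h.1.trans_lt hq, h.2.1.trans_lt hq, Or.inl hab.1, Or.inl hab.2⟩)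
    · have : Subsingleton (Fin q) := Fin.subsingleton_iff_le_one.2 (by omega)
      rw [Subsingleton.elim N ⊥] at h
      exact Or.inl (nuRel_bot h)
  · exact Or.inr (Or.inr ⟨h1.trans hq, h2.trans hq, h3.imp_left (Bool.le_iff_imp.1 ha),
      h4.imp_left (Bool.le_iff_imp.1 hb)⟩)

theorem gridRel_mono_of_le {M : Subgroup (Equiv.Perm (Fin q))} (hN : N ≤ M)
    (ha : a ≤ a') (hb : b ≤ b') {α β : PartitionMonoid n} (h : gridRel n N a b α β) :
    gridRel n M a' b' α β := by
  rcases h with rfl | h | ⟨h1, h2, h3, h4⟩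
  · exact Or.inl rfl
  · obtain ⟨h1, h2, σ, hσ, τ, hτ, h⟩ := h
    exact Or.inr (Or.inl ⟨h1, h2, σ, hN hσ, τ, hN hτ, h⟩)
  · exact Or.inr (Or.inr ⟨h1, h2, h3.imp_left (Bool.le_iff_imp.1 ha),
      h4.imp_left (Bool.le_iff_imp.1 hb)⟩)

theorem kernel_le_of_gridRel_le (hn : 2 ≤ n) (hq : 1 ≤ q) (hq' : 1 ≤ q')
    (h : ∀ α β : PartitionMonoid n, gridRel n N a b α β → gridRel n N' a' b' α β) : a ≤ a' := by
  rcases a with _ | _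
  · exact Bool.false_le a'
  -- The test pair has rank 0, equal cokernels, and kernels that differ because `n ≥ 2`.
  let α : PartitionMonoid n := ⟨(⊤ : Setoid (Fin n ⊕ Fin 0)) ⊚ (⊥ : Setoid (Fin 0 ⊕ Fin n))⟩
  let β : PartitionMonoid n := ⟨(⊥ : Setoid (Fin n ⊕ Fin 0)) ⊚ (⊥ : Setoid (Fin 0 ⊕ Fin n))⟩
  have hα : α.rank = 0 := Nat.le_zero.1 (rank_le_of_eq_product rfl)
  have hβ : β.rank = 0 := Nat.le_zero.1 (rank_le_of_eq_product rfl)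
  have hne : upper α.rel ≠ upper β.rel := by
    change upper (_ ⊚ _) ≠ upper (_ ⊚ _)
    rw [upper_product_zero, upper_product_zero]
    intro h
    have h1 : (⊥ : Setoid (Fin n ⊕ Fin 0)) (.inl ⟨0, by omega⟩) (.inl ⟨1, by omega⟩) := by
      rw [← h]; trivial
    have h2 : (Sum.inl ⟨0, by omega⟩ : Fin n ⊕ Fin 0) = .inl ⟨1, by omega⟩ := h1
    simp at h2
  have hlow : lower α.rel = lower β.rel := by
    change lower (_ ⊚ _) = lower (_ ⊚ _)
    rw [lower_product_zero, lower_product_zero]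
  rcases h α β (Or.inr (Or.inr ⟨by omega, by omega, Or.inl rfl, Or.inr hlow⟩)) with h | h | h
  · exact absurd (by rw [h]) hne
  · exact absurd h.1 (by omega)
  · rw [h.2.2.1.resolve_right hne]

theorem cokernel_le_of_gridRel_le (hn : 2 ≤ n) (hq : 1 ≤ q) (hq' : 1 ≤ q')
    (h : ∀ α β : PartitionMonoid n, gridRel n N a b α β → gridRel n N' a' b' α β) : b ≤ b' := by
  refine kernel_le_of_gridRel_le (N := N) (N' := N') (b := a) (b' := a') hn hq hq' fun α β hαβ => ?_
  have := gridRel_star (h _ _ (gridRel_star hαβ))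
  rwa [star_star, star_star] at this

/-- The test pair is a partition of rank `q'` and its hat. They share kernel and cokernel, so every
relation of larger degree contains them, but their ranks `q'` and 0 keep them apart in degree `q'`.
-/
theorem degree_le_of_gridRel_le (hq : q ≤ n + 1) (hq' : 1 ≤ q')
    (h : ∀ α β : PartitionMonoid n, gridRel n N a b α β → gridRel n N' a' b' α β) : q ≤ q' := by
  by_contra! hlt
  have hr : (bar 1 : PartitionMonoid n).rank = q' := rank_bar (σ := (1 : Equiv.Perm (Fin q')))
    (by omega)
  set α : PartitionMonoid n := bar (1 : Equiv.Perm (Fin q'))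
  have hh := rank_hat α
  have hup : upper α.rel = upper α.hat.rel := by rw [hat_rel, upper_product_zero]
  have hlow : lower α.rel = lower α.hat.rel := by rw [hat_rel, lower_product_zero]
  rcases h α α.hat (Or.inr (Or.inr ⟨by omega, by omega, Or.inr hup, Or.inr hlow⟩)) with h | h | h
  · rw [← h] at hh; omega
  · have := h.2.1; omega
  · have := h.1; omega

theorem le_of_gridRel_le {M : Subgroup (Equiv.Perm (Fin q))} [N.Normal] [M.Normal] (hq : q ≤ n + 1)
    (hN : q = n + 1 → N = ⊥)
    (h : ∀ α β : PartitionMonoid n, gridRel n N a b α β → gridRel n M a' b' α β) : N ≤ M := by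
  by_cases hqn : q = n + 1
  · rw [hN hqn]; exact bot_le
  · have hqn : q ≤ n := by omega
    intro σ hσ
    rcases h _ _ (Or.inr (Or.inl ((nuRel_bar_iff hqn).2 hσ))) with h | h | h
    · rw [← bar_injective hqn h]; exact M.one_mem
    · exact (nuRel_bar_iff hqn).1 h
    · exact absurd (rank_bar hqn 1) h.1.ne

end Order

/-! ### Green's relations on partitions of rank zero -/

section Green

variable (α β : PartitionMonoid n)

/-- With equal cokernels, `α.hat = α.hat * β.hat`: the middle of this product is a partition of
empty rows, hence the identity. -/
theorem greenL_hat_iff : GreenL α.hat β.hat ↔ lower α.rel = lower β.rel := by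
  have key : ∀ α β : PartitionMonoid n, lower α.rel = lower β.rel →
      α.hat = α.hat * β.hat := by
    intro α β h
    refine PartitionMonoid.ext ?_
    rw [mul_rel, hat_rel, hat_rel, product_assoc, ← product_assoc (lower α.rel), h,
      Subsingleton.elim (lower β.rel ⊚ upper β.rel) (identity (Fin 0)), identity_product]
  constructor
  · intro h
    have h1 : α.hat ∈ Set.range (fun s => s * β.hat) := by
      rw [← h]; exact ⟨1, one_mul _⟩
    obtain ⟨s, hs⟩ := h1
    have hs := congrArg (fun x => lower x.rel) hs
    simp only [mul_rel, hat_rel] at hs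
    rw [← product_assoc, lower_product_zero, lower_product_zero] at hs
    exact hs.symm
  · intro h
    apply Set.Subset.antisymm
    · rintro _ ⟨s, rfl⟩
      exact ⟨s * α.hat, by simp only [mul_assoc]; rw [← key α β h]⟩
    · rintro _ ⟨s, rfl⟩
      exact ⟨s * β.hat, by simp only [mul_assoc]; rw [← key β α h.symm]⟩

theorem star_hat : star α.hat = (star α).hat := by
  refine PartitionMonoid.ext ?_
  rw [star_rel, hat_rel, hat_rel, star_rel, flip_product, upper_flip, lower_flip]

theorem _root_.greenR_iff_greenL_star {S : Type*} [Monoid S] [StarMul S] (x y : S) :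
    GreenR x y ↔ GreenL (star x) (star y) := by
  have key : ∀ x : S, Set.range (fun s : S => s * star x) = star '' Set.range fun s : S => x * s := by
    intro x
    ext z
    constructor
    · rintro ⟨s, rfl⟩
      exact ⟨_, ⟨star s, rfl⟩, by simp⟩
    · rintro ⟨_, ⟨s, rfl⟩, rfl⟩
      exact ⟨star s, by simp⟩
  rw [GreenR, GreenL, key, key]
  exact ⟨fun h => by rw [h], fun h => Set.image_injective.2 star_injective h⟩

theorem greenR_hat_iff : GreenR α.hat β.hat ↔ upper α.rel = upper β.rel := by
  rw [greenR_iff_greenL_star, star_hat, star_hat, greenL_hat_iff, star_rel, star_rel, lower_flip,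
    lower_flip, flip_injective.eq_iff]

theorem greenH_hat_iff : GreenH α.hat β.hat ↔
    upper α.rel = upper β.rel ∧ lower α.rel = lower β.rel := by
  rw [GreenH, greenL_hat_iff, greenR_hat_iff, and_comm]

end Green

end PartitionMonoid

/-! ### Normal subgroups of the finite symmetric groups -/

namespace PartitionMonoid

open Equiv

theorem mem_klein {x : Perm (Fin 4)} : x ∈ klein ↔ x = 1 ∨ x = swap 0 1 * swap 2 3 ∨
    x = swap 0 2 * swap 1 3 ∨ x = swap 0 3 * swap 1 2 := by
  constructor
  · intro hx
    induction hx using Subgroup.closure_induction with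
    | mem x h =>
      rcases h with rfl | rfl
      · exact Or.inr (Or.inl rfl)
      · exact Or.inr (Or.inr (Or.inl rfl))
    | one => exact Or.inl rfl
    | mul x y _ _ hx hy =>
      rcases hx with rfl | rfl | rfl | rfl <;> rcases hy with rfl | rfl | rfl | rfl <;> decide
    | inv x _ hx => rcases hx with rfl | rfl | rfl | rfl <;> decide
  · have h1 : swap 0 1 * swap 2 3 ∈ klein := Subgroup.subset_closure (Or.inl rfl)
    have h2 : swap 0 2 * swap 1 3 ∈ klein := Subgroup.subset_closure (Or.inr rfl)
    rintro (rfl | rfl | rfl | rfl)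
    · exact klein.one_mem
    · exact h1
    · exact h2
    · have : (swap 0 3 * swap 1 2 : Perm (Fin 4)) =
        swap 0 1 * swap 2 3 * (swap 0 2 * swap 1 3) := by decide
      rw [this]
      exact klein.mul_mem h1 h2

instance klein_normal : klein.Normal where
  conj_mem x hx g := by
    rw [mem_klein] at hx ⊢
    revert g
    rcases hx with rfl | rfl | rfl | rfl <;> decide

theorem klein_ne_bot : klein ≠ ⊥ := by
  intro h
  have : (swap 0 1 * swap 2 3 : Perm (Fin 4)) ∈ klein := mem_klein.2 (by decide)
  rw [h, Subgroup.mem_bot] at this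
  revert this
  decide

theorem klein_le_alternatingGroup : klein ≤ alternatingGroup (Fin 4) := by
  intro x hx
  rw [mem_klein] at hx
  rw [Perm.mem_alternatingGroup]
  rcases hx with rfl | rfl | rfl | rfl <;> decide

theorem klein_ne_alternatingGroup : klein ≠ alternatingGroup (Fin 4) := by
  intro h
  have : (swap 0 1 * swap 1 2 : Perm (Fin 4)) ∈ klein := by
    rw [h, Perm.mem_alternatingGroup]
    decide
  rw [mem_klein] at this
  revert this
  decide

theorem alternatingGroup_ne_top {q : ℕ} (hq : 2 ≤ q) : alternatingGroup (Fin q) ≠ ⊤ := by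
  intro h
  have h1 : swap (⟨0, by omega⟩ : Fin q) ⟨1, by omega⟩ ∈ alternatingGroup (Fin q) := by
    rw [h]; trivial
  rw [Perm.mem_alternatingGroup, Perm.sign_swap (by simp)] at h1
  exact absurd h1 (by decide)

theorem klein_ne_top : klein ≠ ⊤ := fun h =>
  alternatingGroup_ne_top (q := 4) (by norm_num) (top_le_iff.1 (h ▸ klein_le_alternatingGroup))

theorem alternatingGroup_ne_bot {q : ℕ} (hq : 3 ≤ q) : alternatingGroup (Fin q) ≠ ⊥ := by
  intro h
  have h1 : swap (⟨0, by omega⟩ : Fin q) ⟨1, by omega⟩ * swap ⟨1, by omega⟩ ⟨2, by omega⟩ ∈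
      alternatingGroup (Fin q) := by
    rw [Perm.mem_alternatingGroup, Perm.sign_mul, Perm.sign_swap (by simp),
      Perm.sign_swap (by simp)]
    decide
  rw [h, Subgroup.mem_bot] at h1
  have h2 := congrArg (fun σ : Perm (Fin q) => σ ⟨2, by omega⟩) h1
  simp at h2

theorem top_perm_ne_bot {q : ℕ} (hq : 2 ≤ q) : (⊤ : Subgroup (Perm (Fin q))) ≠ ⊥ := by
  have : Nontrivial (Fin q) := Fin.nontrivial_iff_two_le.2 hq
  exact top_ne_bot

theorem eq_of_alternatingGroup_le {q : ℕ} {N : Subgroup (Perm (Fin q))}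
    (h : alternatingGroup (Fin q) ≤ N) : N = alternatingGroup (Fin q) ∨ N = ⊤ := by
  by_cases h' : N ≤ alternatingGroup (Fin q)
  · exact Or.inl (le_antisymm h' h)
  · right
    obtain ⟨σ, hσ, hσ'⟩ := SetLike.not_le_iff_exists.1 h'
    rw [Perm.mem_alternatingGroup] at hσ'
    have hσ' := (Int.units_eq_one_or _).resolve_left hσ'
    refine top_le_iff.1 fun τ _ => ?_
    rcases Int.units_eq_one_or (Perm.sign τ) with hτ | hτ
    · exact h (Perm.mem_alternatingGroup.2 hτ)
    · have : τ * σ ∈ N := h (Perm.mem_alternatingGroup.2 (by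
        rw [Perm.sign_mul, hτ, hσ']; decide))
      exact (Subgroup.mul_mem_cancel_right N hσ).1 this

/-! ### Finite checks in degrees three and four -/

section Small

theorem exists_commutator_mem_klein : ∀ σ : Perm (Fin 4), σ ≠ 1 →
    ∃ g : Perm (Fin 4), g * σ * g⁻¹ * σ⁻¹ = swap 0 1 * swap 2 3 ∨
      g * σ * g⁻¹ * σ⁻¹ = swap 0 2 * swap 1 3 ∨ g * σ * g⁻¹ * σ⁻¹ = swap 0 3 * swap 1 2 := by
  decide +kernel

theorem exists_commutator_order_three : ∀ σ : Perm (Fin 4), σ ≠ 1 → σ ≠ swap 0 1 * swap 2 3 →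
    σ ≠ swap 0 2 * swap 1 3 → σ ≠ swap 0 3 * swap 1 2 →
    ∃ g : Perm (Fin 4), g * σ * g⁻¹ * σ⁻¹ ≠ 1 ∧
      (g * σ * g⁻¹ * σ⁻¹) * (g * σ * g⁻¹ * σ⁻¹) * (g * σ * g⁻¹ * σ⁻¹) = 1 := by
  decide +kernel

theorem exists_conj_of_order_three : ∀ σ : Perm (Fin 4), σ ≠ 1 → σ * σ * σ = 1 →
    ∃ g : Perm (Fin 4), g * σ * g⁻¹ = swap 0 1 * swap 1 2 := by
  decide +kernel

theorem exists_conj_mul_conj_of_sign : ∀ σ : Perm (Fin 3), σ ≠ 1 → ∀ τ : Perm (Fin 3),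
    Perm.sign τ = 1 → ∃ g h : Perm (Fin 3), g * σ * g⁻¹ * (h * σ⁻¹ * h⁻¹) = τ := by
  decide +kernel

end Small

theorem commutator_mem {G : Type*} [Group G] {N : Subgroup G} [hN : N.Normal] {σ : G} (hσ : σ ∈ N)
    (g : G) : g * σ * g⁻¹ * σ⁻¹ ∈ N :=
  N.mul_mem (hN.conj_mem _ hσ _) (N.inv_mem hσ)

theorem exists_mem_ne_one {G : Type*} [Group G] {N : Subgroup G} (h : N ≠ ⊥) :
    ∃ x ∈ N, x ≠ 1 := by
  by_contra! h'
  exact h ((Subgroup.eq_bot_iff_forall N).2 h')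

theorem klein_le_of_normal {N : Subgroup (Perm (Fin 4))} [hN : N.Normal] (h : N ≠ ⊥) :
    klein ≤ N := by
  obtain ⟨σ, hσ, hσ1⟩ := exists_mem_ne_one h
  obtain ⟨g, hg⟩ := exists_commutator_mem_klein σ hσ1
  have hk := commutator_mem hσ g
  generalize g * σ * g⁻¹ * σ⁻¹ = k at hg hk
  have key : ∀ j, (j = swap 0 1 * swap 2 3 ∨ j = swap 0 2 * swap 1 3 ∨ j = swap 0 3 * swap 1 2) →
      ∃ g : Perm (Fin 4), g * k * g⁻¹ = j := by
    rcases hg with rfl | rfl | rfl <;> decide +kernel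
  intro x hx
  rcases mem_klein.1 hx with rfl | hx
  · exact N.one_mem
  · obtain ⟨g, rfl⟩ := key x hx
    exact hN.conj_mem _ hk _

/-- An element outside the Klein group has a commutator of order three, which stays in `N`. All
elements of order three are conjugate, and three-cycles generate the alternating group. -/
theorem alternatingGroup_le_of_normal_of_not_le_klein {N : Subgroup (Perm (Fin 4))}
    [hN : N.Normal] (h : ¬ N ≤ klein) : alternatingGroup (Fin 4) ≤ N := by
  obtain ⟨σ, hσ, hσk⟩ := SetLike.not_le_iff_exists.1 h
  rw [mem_klein] at hσk
  push Not at hσk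
  obtain ⟨g, hg1, hg3⟩ := exists_commutator_order_three σ hσk.1 hσk.2.1 hσk.2.2.1 hσk.2.2.2
  have hk := commutator_mem hσ g
  generalize g * σ * g⁻¹ * σ⁻¹ = k at hg1 hg3 hk
  rw [← Perm.closure_three_cycles_eq_alternating, Subgroup.closure_le]
  intro x hx
  have hx3 : x ^ 3 = 1 := by
    rw [← hx.orderOf]
    exact pow_orderOf_eq_one x
  have hx1 : x ≠ 1 := by
    rintro rfl
    have := hx.orderOf
    simp at this
  obtain ⟨a, ha⟩ := exists_conj_of_order_three k hg1 hg3
  obtain ⟨b, hb⟩ := exists_conj_of_order_three x hx1 (by rw [← hx3]; rfl)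
  have : x = (b⁻¹ * a) * k * (b⁻¹ * a)⁻¹ := by
    rw [← ha] at hb
    calc x = b⁻¹ * (b * x * b⁻¹) * b := by group
      _ = (b⁻¹ * a) * k * (b⁻¹ * a)⁻¹ := by rw [hb]; group
  rw [this]
  exact hN.conj_mem _ hk _

/-- A normal subgroup of the symmetric group of degree `q` that is neither trivial nor alternating
nor symmetric is a Klein four-group. -/
theorem exists_normal_cases (q : ℕ) : ∃ S : Subgroup (Perm (Fin q)),
    S ≤ alternatingGroup (Fin q) ∧ (q ≠ 4 → S = ⊥) ∧ (∀ h : q = 4, S = h ▸ klein) ∧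
    ∀ N : Subgroup (Perm (Fin q)), N.Normal →
      N = ⊥ ∨ N = S ∨ N = alternatingGroup (Fin q) ∨ N = ⊤ := by
  by_cases h4 : q = 4
  · subst h4
    refine ⟨klein, klein_le_alternatingGroup, fun h => absurd rfl h, fun _ => rfl, fun N hN => ?_⟩
    by_cases h1 : N = ⊥
    · exact Or.inl h1
    · by_cases h2 : N ≤ klein
      · exact Or.inr (Or.inl (le_antisymm h2 (klein_le_of_normal h1)))
      · exact Or.inr (Or.inr (eq_of_alternatingGroup_le
          (alternatingGroup_le_of_normal_of_not_le_klein h2)))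
  · refine ⟨⊥, bot_le, fun _ => rfl, fun h => absurd h h4, fun N hN => ?_⟩
    by_cases h1 : N = ⊥
    · exact Or.inl h1
    · refine Or.inr (Or.inr (eq_of_alternatingGroup_le ?_))
      by_cases h5 : 5 ≤ q
      · exact Perm.alternatingGroup_le_of_normal (by simpa using h5)
          ((Subgroup.nontrivial_iff_ne_bot N).2 h1)
      · obtain ⟨σ, hσ, hσ1⟩ := exists_mem_ne_one h1
        intro τ hτ
        rw [Perm.mem_alternatingGroup] at hτ
        by_cases h3 : q = 3
        · subst h3
          obtain ⟨g, h, rfl⟩ := exists_conj_mul_conj_of_sign σ hσ1 τ hτ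
          exact N.mul_mem (hN.conj_mem _ hσ _) (hN.conj_mem _ (N.inv_mem hσ) _)
        · by_cases h2 : q = 2
          · subst h2
            have : τ = 1 := by revert τ; decide
            rw [this]
            exact N.one_mem
          · have : Subsingleton (Fin q) := Fin.subsingleton_iff_le_one.2 (by omega)
            rw [Subsingleton.elim τ 1]
            exact N.one_mem

open Classical in
/-- The position of a normal subgroup in the chain of all normal subgroups of a symmetric group. -/
noncomputable def normalIndex {q : ℕ} (N : Subgroup (Perm (Fin q))) : ℕ :=
  -- The order of the tests matters in degree at most 2, where these subgroups coincide. For normal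
  -- `N` the final value 1 is left to the Klein group.
  if N = ⊥ then 0 else if N = ⊤ then 3 else if N = alternatingGroup (Fin q) then 2 else 1

theorem normalIndex_le_three {q : ℕ} (N : Subgroup (Perm (Fin q))) : normalIndex N ≤ 3 := by
  unfold normalIndex
  split_ifs <;> omega

theorem normalIndex_le_iff {q : ℕ} {N M : Subgroup (Perm (Fin q))} (hN : N.Normal)
    (hM : M.Normal) : normalIndex N ≤ normalIndex M ↔ N ≤ M := by
  obtain ⟨S, hS, -, -, h⟩ := exists_normal_cases q
  have hN := h N hN
  have hM := h M hM
  constructor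
  · intro hi
    unfold normalIndex at hi
    split_ifs at hi <;> simp_all
  · intro hle
    unfold normalIndex
    split_ifs <;> simp_all
    -- What remains is an alternating `N` contained in the exceptional `M = S`.
    exact absurd (le_antisymm hS hle) ‹_›

theorem normalIndex_bot {q : ℕ} : normalIndex (⊥ : Subgroup (Perm (Fin q))) = 0 := if_pos rfl

theorem normalIndex_eq_zero_iff {q : ℕ} {N : Subgroup (Perm (Fin q))} :
    normalIndex N = 0 ↔ N = ⊥ := by
  unfold normalIndex
  split_ifs <;> simp_all

theorem normalIndex_top {q : ℕ} (hq : 2 ≤ q) :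
    normalIndex (⊤ : Subgroup (Perm (Fin q))) = 3 := by
  rw [normalIndex, if_neg (top_perm_ne_bot hq), if_pos rfl]

theorem normalIndex_alternatingGroup {q : ℕ} (hq : 3 ≤ q) :
    normalIndex (alternatingGroup (Fin q)) = 2 := by
  rw [normalIndex, if_neg (alternatingGroup_ne_bot hq),
    if_neg (alternatingGroup_ne_top (by omega)), if_pos rfl]

theorem normalIndex_klein : normalIndex klein = 1 := by
  rw [normalIndex, if_neg klein_ne_bot, if_neg klein_ne_top, if_neg klein_ne_alternatingGroup]

theorem normalIndex_cases {q : ℕ} {N : Subgroup (Perm (Fin q))} (hN : N.Normal) (h : N ≠ ⊥) :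
    (2 ≤ q ∧ N = ⊤) ∨ (3 ≤ q ∧ N = alternatingGroup (Fin q)) ∨
      (∃ h : q = 4, N = h ▸ klein) := by
  have hq : 2 ≤ q := by
    by_contra! hq
    have : Subsingleton (Fin q) := Fin.subsingleton_iff_le_one.2 (by omega)
    exact h (Subsingleton.elim _ _)
  obtain ⟨S, -, h1, h2, h3⟩ := exists_normal_cases q
  rcases h3 N hN with h' | rfl | rfl | rfl
  · exact absurd h' h
  · by_cases h4 : q = 4
    · exact Or.inr (Or.inr ⟨h4, h2 h4⟩)
    · exact absurd (h1 h4) h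
  · refine Or.inr (Or.inl ⟨?_, rfl⟩)
    by_contra! hq'
    obtain rfl : q = 2 := by omega
    refine h (le_bot_iff.1 fun σ hσ => ?_)
    rw [Perm.mem_alternatingGroup] at hσ
    rw [Subgroup.mem_bot]
    revert σ
    decide
  · exact Or.inl ⟨hq, rfl⟩

end PartitionMonoid

/-! ### The lattice of congruences -/

namespace PartitionMonoid

variable {n : ℕ}

namespace Level

/-- The place of a level in the chain of all normal subgroups of all symmetric groups. -/
def pos : Level → ℕ
  | .zero => 4
  | .one => 8
  | .symTwo => 11

theorem degree_le_two (i : Level) : i.degree ≤ 2 := by cases i <;> decide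

theorem one_le_degree (i : Level) : 1 ≤ i.degree := by cases i <;> decide

instance (i : Level) : i.group.Normal := by
  cases i
  · exact (inferInstance : (⊥ : Subgroup (Equiv.Perm (Fin 1))).Normal)
  · exact (inferInstance : (⊥ : Subgroup (Equiv.Perm (Fin 2))).Normal)
  · exact (inferInstance : (⊤ : Subgroup (Equiv.Perm (Fin 2))).Normal)

theorem pos_eq (i : Level) : i.pos = 4 * i.degree + normalIndex i.group := by
  cases i
  · exact (congrArg (4 + ·) (normalIndex_bot (q := 1))).symm
  · exact (congrArg (8 + ·) (normalIndex_bot (q := 2))).symm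
  · exact (congrArg (8 + ·) (normalIndex_top (q := 2) le_rfl)).symm

theorem pos_injective : Function.Injective pos := by
  intro i j h
  cases i <;> cases j <;> simp [pos] at h ⊢

end Level

namespace CongName

/-- All partitions of rank less than the degree are in the ideal part of the congruence. -/
def degree : CongName n → ℕ
  | .rees q _ => q + 1
  | .normal q _ _ _ _ _ => q
  | .lam i => i.degree
  | .rho i => i.degree
  | .mu i => i.degree

/-- The normal subgroup that belongs to a congruence. -/
def group : (x : CongName n) → Subgroup (Equiv.Perm (Fin x.degree))
  | .rees _ _ => ⊥
  | .normal _ _ _ N _ _ => N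
  | .lam i => i.group
  | .rho i => i.group
  | .mu i => i.group

/-- Whether the congruence ignores kernels on the ideal. -/
def ker : CongName n → Bool
  | .rho _ => false
  | .mu _ => false
  | _ => true

/-- Whether the congruence ignores cokernels on the ideal. -/
def coker : CongName n → Bool
  | .lam _ => false
  | .mu _ => false
  | _ => true

/-- The place of a name in the chain of all normal subgroups of all symmetric groups. -/
noncomputable def pos (x : CongName n) : ℕ := 4 * x.degree + normalIndex x.group

instance (x : CongName n) : x.group.Normal := by
  cases x with
  | rees => exact (inferInstance : (⊥ : Subgroup (Equiv.Perm (Fin _))).Normal)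
  | normal _ _ _ _ hN => exact hN
  | lam i => exact (inferInstance : i.group.Normal)
  | rho i => exact (inferInstance : i.group.Normal)
  | mu i => exact (inferInstance : i.group.Normal)

theorem one_le_degree (x : CongName n) : 1 ≤ x.degree := by
  cases x with
  | rees q => exact Nat.le_add_left 1 q
  | normal q h => exact le_trans (by norm_num) h
  | lam i => exact i.one_le_degree
  | rho i => exact i.one_le_degree
  | mu i => exact i.one_le_degree

theorem degree_le (hn : 2 ≤ n) (x : CongName n) : x.degree ≤ n + 1 := by
  cases x with
  | rees q h => exact Nat.succ_le_succ h
  | normal q _ h => exact Nat.le_succ_of_le h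
  | lam i => exact i.degree_le_two.trans (by omega)
  | rho i => exact i.degree_le_two.trans (by omega)
  | mu i => exact i.degree_le_two.trans (by omega)

theorem group_eq_bot (hn : 2 ≤ n) (x : CongName n) (h : x.degree = n + 1) : x.group = ⊥ := by
  cases x with
  | rees q => rfl
  | normal q _ h' => exact absurd h (by simp only [degree]; omega)
  | lam i => exact absurd h (by have := i.degree_le_two; simp only [degree]; omega)
  | rho i => exact absurd h (by have := i.degree_le_two; simp only [degree]; omega)
  | mu i => exact absurd h (by have := i.degree_le_two; simp only [degree]; omega)

theorem ker_coker_or (x : CongName n) : (x.ker = true ∧ x.coker = true) ∨ x.degree ≤ 2 := by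
  cases x with
  | rees => exact Or.inl ⟨rfl, rfl⟩
  | normal => exact Or.inl ⟨rfl, rfl⟩
  | lam i => exact Or.inr i.degree_le_two
  | rho i => exact Or.inr i.degree_le_two
  | mu i => exact Or.inr i.degree_le_two

theorem toRel_iff (x : CongName n) (α β : PartitionMonoid n) :
    x.toRel α β ↔ gridRel n x.group x.ker x.coker α β := by
  cases x with
  | rees q =>
    simp only [toRel, reesRel, gridRel, group, ker, coker, degree, Nat.lt_succ_iff, true_or,
      and_true]
    have := nuRel_bot (n := n) (q := q + 1) (α := α) (β := β)
    tauto
  | normal q _ _ N => simp [toRel, normalRel, gridRel, group, ker, coker, degree]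
  | lam i =>
    simp only [toRel, liftRel, gridRel, group, ker, coker, degree, greenL_hat_iff]
    simp
  | rho i =>
    simp only [toRel, liftRel, gridRel, group, ker, coker, degree, greenR_hat_iff]
    simp
  | mu i =>
    simp only [toRel, liftRel, gridRel, group, ker, coker, degree, greenH_hat_iff]
    simp

/-- The congruence with a given name. -/
def toCon (x : CongName n) : Con (PartitionMonoid n) :=
  gridCon n x.group x.ker x.coker x.ker_coker_or

theorem coe_toCon (x : CongName n) : ⇑x.toCon = x.toRel := by
  ext α β
  exact (x.toRel_iff α β).symm

/-- The index is at most 3, so comparing `pos` is the lexicographic comparison of degree and normal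
subgroup. -/
theorem toCon_le_iff (hn : 2 ≤ n) (x y : CongName n) :
    x.toCon ≤ y.toCon ↔ x.ker ≤ y.ker ∧ x.coker ≤ y.coker ∧ x.pos ≤ y.pos := by
  have hx := normalIndex_le_three x.group
  have hy := normalIndex_le_three y.group
  simp only [pos]
  constructor
  · intro h
    have h : ∀ α β, gridRel n x.group x.ker x.coker α β → gridRel n y.group y.ker y.coker α β :=
      fun α β hαβ => h hαβ
    refine ⟨kernel_le_of_gridRel_le hn x.one_le_degree y.one_le_degree h,
      cokernel_le_of_gridRel_le hn x.one_le_degree y.one_le_degree h, ?_⟩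
    have hd := degree_le_of_gridRel_le (x.degree_le hn) y.one_le_degree h
    rcases hd.lt_or_eq with hd | hd
    · omega
    · have h1 := x.group_eq_bot hn
      have h2 := x.degree_le hn
      have nx : x.group.Normal := inferInstance
      have ny : y.group.Normal := inferInstance
      generalize x.group = N at *
      generalize y.group = M at *
      generalize x.degree = q at *
      generalize y.degree = q' at *
      subst hd
      rw [add_le_add_iff_left, normalIndex_le_iff nx ny]
      exact le_of_gridRel_le h2 h1 h
  · rintro ⟨h1, h2, h3⟩ α β h
    have h : gridRel n x.group x.ker x.coker α β := h
    change gridRel n y.group y.ker y.coker α β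
    rcases Nat.lt_trichotomy x.degree y.degree with hd | hd | hd
    · exact gridRel_mono_of_lt y.ker_coker_or hd h1 h2 h
    · have nx : x.group.Normal := inferInstance
      have ny : y.group.Normal := inferInstance
      generalize x.group = N at *
      generalize y.group = M at *
      generalize x.degree = q at *
      generalize y.degree = q' at *
      subst hd
      rw [add_le_add_iff_left, normalIndex_le_iff nx ny] at h3
      exact gridRel_mono_of_le h3 h1 h2 h
    · omega

theorem pos_rees {q : ℕ} (h : q ≤ n) : (rees q h : CongName n).pos = 4 * q + 4 := by
  change 4 * (q + 1) + normalIndex (⊥ : Subgroup (Equiv.Perm (Fin (q + 1)))) = _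
  rw [normalIndex_bot]
  ring

theorem pos_normal {q : ℕ} (h2 : 2 ≤ q) (hq : q ≤ n) (N : Subgroup (Equiv.Perm (Fin q)))
    (hN : N.Normal) (hN' : N ≠ ⊥) :
    (normal q h2 hq N hN hN' : CongName n).pos = 4 * q + normalIndex N := rfl

theorem pos_lam (i : Level) : (lam i : CongName n).pos = i.pos := i.pos_eq.symm

theorem pos_rho (i : Level) : (rho i : CongName n).pos = i.pos := i.pos_eq.symm

theorem pos_mu (i : Level) : (mu i : CongName n).pos = i.pos := i.pos_eq.symm

theorem pos_top (hn : 2 ≤ n) (i : Level) : (top hn i).pos = i.pos := by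
  cases i
  · exact pos_rees _
  · exact pos_rees _
  · exact (pos_normal _ _ _ _ _).trans (by rw [normalIndex_top le_rfl]; rfl)

theorem ker_top (hn : 2 ≤ n) (i : Level) : (top hn i).ker = true := by cases i <;> rfl

theorem coker_top (hn : 2 ≤ n) (i : Level) : (top hn i).coker = true := by cases i <;> rfl

theorem pos_normal_cases {q : ℕ} (h2 : 2 ≤ q) (hq : q ≤ n) (N : Subgroup (Equiv.Perm (Fin q)))
    (hN : N.Normal) (hN' : N ≠ ⊥) :
    (N = ⊤ ∧ (normal q h2 hq N hN hN' : CongName n).pos = 4 * q + 3) ∨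
    (3 ≤ q ∧ N = alternatingGroup (Fin q) ∧
      (normal q h2 hq N hN hN' : CongName n).pos = 4 * q + 2) ∨
    ((∃ h : q = 4, N = h ▸ klein) ∧ (normal q h2 hq N hN hN' : CongName n).pos = 17) := by
  rw [pos_normal]
  rcases normalIndex_cases hN hN' with ⟨-, rfl⟩ | ⟨h3, rfl⟩ | ⟨rfl, rfl⟩
  · exact Or.inl ⟨rfl, by rw [normalIndex_top h2]⟩
  · exact Or.inr (Or.inl ⟨h3, rfl, by rw [normalIndex_alternatingGroup h3]⟩)
  · exact Or.inr (Or.inr ⟨⟨rfl, rfl⟩, by rw [normalIndex_klein]⟩)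

/-- These are the only places that can be occupied; the gaps between them prove that nothing lies
between the ends of an edge. -/
theorem pos_cases (x : CongName n) : (∃ q, x.pos = 4 * q) ∨ (∃ q, 2 ≤ q ∧ x.pos = 4 * q + 3) ∨
    (∃ q, 3 ≤ q ∧ x.pos = 4 * q + 2) ∨ x.pos = 17 := by
  have key : ∀ i : Level, (∃ q, i.pos = 4 * q) ∨ (∃ q, 2 ≤ q ∧ i.pos = 4 * q + 3) ∨
      (∃ q, 3 ≤ q ∧ i.pos = 4 * q + 2) ∨ i.pos = 17 := by
    intro i
    cases i
    · exact Or.inl ⟨1, rfl⟩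
    · exact Or.inl ⟨2, rfl⟩
    · exact Or.inr (Or.inl ⟨2, le_rfl, rfl⟩)
  cases x with
  | rees q h => exact Or.inl ⟨q + 1, by rw [pos_rees]; ring⟩
  | normal q h2 hq N hN hN' =>
    rcases pos_normal_cases h2 hq N hN hN' with h | h | h
    · exact Or.inr (Or.inl ⟨q, h2, h.2⟩)
    · exact Or.inr (Or.inr (Or.inl ⟨q, h.1, h.2.2⟩))
    · exact Or.inr (Or.inr (Or.inr h.2))
  | lam i => rw [pos_lam]; exact key i
  | rho i => rw [pos_rho]; exact key i
  | mu i => rw [pos_mu]; exact key i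

theorem pos_le (hn : 2 ≤ n) (x : CongName n) : x.pos ≤ 4 * n + 4 := by
  have key : ∀ i : Level, i.pos ≤ 4 * n + 4 := fun i => by
    cases i <;> simp only [Level.pos] <;> omega
  cases x with
  | rees q h => rw [pos_rees]; omega
  | normal q h2 hq N hN hN' =>
    rw [pos_normal]
    have := normalIndex_le_three N
    omega
  | lam i => rw [pos_lam]; exact key i
  | rho i => rw [pos_rho]; exact key i
  | mu i => rw [pos_mu]; exact key i

theorem eq_of_pos_eq {x y : CongName n} (h1 : x.ker = y.ker) (h2 : x.coker = y.coker)
    (h3 : x.pos = y.pos) : x = y := by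
  cases x with
  | rees q h =>
    cases y with
    | rees q' h' =>
      rw [pos_rees, pos_rees] at h3
      obtain rfl : q = q' := by omega
      rfl
    | normal q' h2' hq' N hN hN' =>
      rw [pos_rees, pos_normal] at h3
      have h4 := normalIndex_le_three N
      exact absurd (normalIndex_eq_zero_iff.1 (by omega)) hN'
    | lam i => cases h2
    | rho i => cases h1
    | mu i => cases h1
  | normal q h2 hq N hN hN' =>
    cases y with
    | rees q' h' =>
      rw [pos_rees, pos_normal] at h3
      have h4 := normalIndex_le_three N
      exact absurd (normalIndex_eq_zero_iff.1 (by omega)) hN'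
    | normal q' h2' hq' M hM hM' =>
      rw [pos_normal, pos_normal] at h3
      have h4 := normalIndex_le_three N
      have h5 := normalIndex_le_three M
      obtain rfl : q = q' := by omega
      have h6 : normalIndex N = normalIndex M := by omega
      obtain rfl : N = M := le_antisymm ((normalIndex_le_iff hN hM).1 h6.le)
        ((normalIndex_le_iff hM hN).1 h6.ge)
      rfl
    | lam i => cases h2
    | rho i => cases h1
    | mu i => cases h1
  | lam i =>
    cases y with
    | lam j => rw [pos_lam, pos_lam] at h3; rw [Level.pos_injective h3]
    | rees => cases h2
    | normal => cases h2
    | rho => cases h1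
    | mu => cases h1
  | rho i =>
    cases y with
    | rho j => rw [pos_rho, pos_rho] at h3; rw [Level.pos_injective h3]
    | rees => cases h1
    | normal => cases h1
    | lam => cases h1
    | mu => cases h2
  | mu i =>
    cases y with
    | mu j => rw [pos_mu, pos_mu] at h3; rw [Level.pos_injective h3]
    | rees => cases h1
    | normal => cases h1
    | rho => cases h2
    | lam => cases h1

theorem toCon_injective (hn : 2 ≤ n) : Function.Injective (toCon : CongName n → _) := by
  intro x y h
  have h1 := (toCon_le_iff hn x y).1 h.le
  have h2 := (toCon_le_iff hn y x).1 h.ge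
  exact eq_of_pos_eq (le_antisymm h1.1 h2.1) (le_antisymm h1.2.1 h2.2.1)
    (le_antisymm h1.2.2 h2.2.2)

theorem toCon_lt_iff (hn : 2 ≤ n) (x y : CongName n) : x.toCon < y.toCon ↔
    (x.ker ≤ y.ker ∧ x.coker ≤ y.coker ∧ x.pos ≤ y.pos) ∧
      ¬ (x.ker = y.ker ∧ x.coker = y.coker ∧ x.pos = y.pos) := by
  rw [lt_iff_le_and_ne, toCon_le_iff hn, (toCon_injective hn).ne_iff]
  refine and_congr_right fun _ => not_congr ⟨?_, fun h => eq_of_pos_eq h.1 h.2.1 h.2.2⟩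
  rintro rfl
  exact ⟨rfl, rfl, rfl⟩

theorem exists_eq_of_level (i : Level) (a b : Bool) (hn : 2 ≤ n) :
    ∃ x : CongName n, x.toCon = gridCon n i.group a b (Or.inr i.degree_le_two) := by
  cases a <;> cases b
  · exact ⟨mu i, rfl⟩
  · exact ⟨rho i, rfl⟩
  · exact ⟨lam i, rfl⟩
  · cases i
    · exact ⟨rees 0 (Nat.zero_le n), rfl⟩
    · exact ⟨rees 1 (by omega), rfl⟩
    · exact ⟨top hn .symTwo, rfl⟩

/-- In degree at most 2 the data form one of the three levels with arbitrary flags. In higher degree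
both flags are true; a trivial subgroup in degree `p + 1` is `R_p`, which covers degree `n + 1`. -/
theorem toCon_surjective (hn : 2 ≤ n) : Function.Surjective (toCon : CongName n → _) := by
  intro c
  obtain ⟨q, N, a, b, hq1, hqn, hN, hN', hab, h⟩ := exists_gridRel c
  have hc : c = gridCon n N a b hab := Con.ext h
  rw [hc]
  by_cases hq2 : q ≤ 2
  · by_cases hq : q = 1
    · subst hq
      obtain rfl : N = ⊥ := Subsingleton.elim _ _
      exact exists_eq_of_level .zero a b hn
    · obtain rfl : q = 2 := by omega
      by_cases hb : N = ⊥
      · subst hb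
        exact exists_eq_of_level .one a b hn
      · rcases normalIndex_cases hN hb with ⟨-, rfl⟩ | ⟨h3, -⟩ | ⟨h4, -⟩
        · exact exists_eq_of_level .symTwo a b hn
        · omega
        · omega
  · obtain ⟨rfl, rfl⟩ := hab.resolve_right hq2
    by_cases hb : N = ⊥
    · subst hb
      obtain ⟨p, rfl⟩ := Nat.exists_eq_add_of_le' hq1
      exact ⟨rees p (by omega), rfl⟩
    · have hqn' : q ≤ n := by
        by_contra hlt
        exact hb (hN' (by omega))
      exact ⟨normal q (by omega) hqn' N hN hb, rfl⟩

theorem toCon_mem_starCongruences_iff (hn : 2 ≤ n) (x : CongName n) :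
    x.toCon ∈ starCongruences (PartitionMonoid n) ↔ x.ker = x.coker := by
  constructor
  · intro h
    have h' : ∀ α β, gridRel n x.group x.ker x.coker α β →
        gridRel n x.group x.coker x.ker α β := by
      intro α β hαβ
      have := gridRel_star (h α β hαβ)
      rwa [star_star, star_star] at this
    exact le_antisymm (kernel_le_of_gridRel_le hn x.one_le_degree x.one_le_degree h')
      (cokernel_le_of_gridRel_le hn x.one_le_degree x.one_le_degree h')
  · intro h α β hαβ
    have : gridRel n x.group x.coker x.ker (star α) (star β) := gridRel_star hαβ
    change gridRel n x.group x.ker x.coker (star α) (star β)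
    rwa [← h, h] at this ⊢

end CongName

end PartitionMonoid

/-! ### The Hasse diagrams -/

namespace PartitionMonoid

variable {n : ℕ}

namespace CongName

/-- Every edge changes exactly one of the three coordinates. This and the next two lemmas treat a
change of place, of the kernel flag and of the cokernel flag. -/
theorem toCon_covBy_of_pos (hn : 2 ≤ n) {x y : CongName n} (h1 : x.ker = y.ker)
    (h2 : x.coker = y.coker) (h3 : x.pos < y.pos)
    (h4 : ∀ w : CongName n, x.pos < w.pos → y.pos ≤ w.pos) : x.toCon ⋖ y.toCon := by
  refine ⟨(toCon_lt_iff hn x y).2 ⟨⟨h1.le, h2.le, h3.le⟩, fun h => h3.ne h.2.2⟩, fun c hc hc' => ?_⟩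
  obtain ⟨w, rfl⟩ := toCon_surjective hn c
  obtain ⟨⟨a1, a2, a3⟩, a4⟩ := (toCon_lt_iff hn _ _).1 hc
  obtain ⟨⟨b1, b2, b3⟩, b4⟩ := (toCon_lt_iff hn _ _).1 hc'
  have e1 : x.ker = w.ker := le_antisymm a1 (h1 ▸ b1)
  have e2 : x.coker = w.coker := le_antisymm a2 (h2 ▸ b2)
  have e3 : x.pos < w.pos := lt_of_le_of_ne a3 fun h => a4 ⟨e1, e2, h⟩
  exact b4 ⟨e1.symm.trans h1, e2.symm.trans h2, le_antisymm b3 (h4 w e3)⟩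

theorem toCon_covBy_of_ker (hn : 2 ≤ n) {x y : CongName n} (h1 : x.ker = false)
    (h2 : y.ker = true) (h3 : x.coker = y.coker) (h4 : x.pos = y.pos) : x.toCon ⋖ y.toCon := by
  refine ⟨(toCon_lt_iff hn x y).2 ⟨⟨by simp [h1], h3.le, h4.le⟩, fun h => by simp [h1, h2] at h⟩,
    fun c hc hc' => ?_⟩
  obtain ⟨w, rfl⟩ := toCon_surjective hn c
  obtain ⟨⟨a1, a2, a3⟩, a4⟩ := (toCon_lt_iff hn _ _).1 hc
  obtain ⟨⟨b1, b2, b3⟩, b4⟩ := (toCon_lt_iff hn _ _).1 hc'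
  have e2 : x.coker = w.coker := le_antisymm a2 (h3 ▸ b2)
  have e3 : x.pos = w.pos := le_antisymm a3 (h4 ▸ b3)
  rcases hw : w.ker with _ | _
  · exact a4 ⟨h1.trans hw.symm, e2, e3⟩
  · exact b4 ⟨hw.trans h2.symm, e2.symm.trans h3, e3.symm.trans h4⟩

theorem toCon_covBy_of_coker (hn : 2 ≤ n) {x y : CongName n} (h1 : x.coker = false)
    (h2 : y.coker = true) (h3 : x.ker = y.ker) (h4 : x.pos = y.pos) : x.toCon ⋖ y.toCon := by
  refine ⟨(toCon_lt_iff hn x y).2 ⟨⟨h3.le, by simp [h1], h4.le⟩, fun h => by simp [h1, h2] at h⟩,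
    fun c hc hc' => ?_⟩
  obtain ⟨w, rfl⟩ := toCon_surjective hn c
  obtain ⟨⟨a1, a2, a3⟩, a4⟩ := (toCon_lt_iff hn _ _).1 hc
  obtain ⟨⟨b1, b2, b3⟩, b4⟩ := (toCon_lt_iff hn _ _).1 hc'
  have e2 : x.ker = w.ker := le_antisymm a1 (h3 ▸ b1)
  have e3 : x.pos = w.pos := le_antisymm a3 (h4 ▸ b3)
  rcases hw : w.coker with _ | _
  · exact a4 ⟨e2, h1.trans hw.symm, e3⟩
  · exact b4 ⟨e2.symm.trans h3, hw.trans h2.symm, e3.symm.trans h4⟩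

theorem le_pos_of_step {i j : Level} (h : i.Step j) (w : CongName n) (hw : i.pos < w.pos) :
    j.pos ≤ w.pos := by
  have := w.pos_cases
  cases h <;> simp only [Level.pos] at hw ⊢ <;> omega

theorem pos_lt_of_step {i j : Level} (h : i.Step j) : i.pos < j.pos := by
  cases h <;> decide

theorem toCon_covBy_of_wickEdge (hn : 2 ≤ n) {x y : CongName n} (h : WickEdge x y) :
    x.toCon ⋖ y.toCon := by
  cases h with
  | sym_rees q h2q hqn hN hN' =>
    refine toCon_covBy_of_pos hn rfl rfl ?_ fun w hw => ?_
    · rw [pos_rees, pos_normal, normalIndex_top h2q]; omega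
    · rw [pos_normal, normalIndex_top h2q] at hw
      rw [pos_rees]
      omega
  | rees_alt q h2q hq3 hqn h2q' hqn' hN hN' =>
    refine toCon_covBy_of_pos hn rfl rfl ?_ fun w hw => ?_
    · rw [pos_rees, pos_normal, normalIndex_alternatingGroup (by omega)]; omega
    · have := w.pos_cases
      rw [pos_rees] at hw
      rw [pos_normal, normalIndex_alternatingGroup (by omega)]
      omega
  | alt_sym q h3q h2q hqn hA hA' hN hN' =>
    refine toCon_covBy_of_pos hn rfl rfl ?_ fun w hw => ?_
    · rw [pos_normal, pos_normal, normalIndex_alternatingGroup h3q, normalIndex_top h2q]; omega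
    · rw [pos_normal, normalIndex_alternatingGroup h3q] at hw
      rw [pos_normal, normalIndex_top h2q]
      omega
  | rees_klein h3n h24 h4n hK hK' =>
    refine toCon_covBy_of_pos hn rfl rfl ?_ fun w hw => ?_
    · rw [pos_rees, pos_normal, normalIndex_klein]; omega
    · rw [pos_rees] at hw
      rw [pos_normal, normalIndex_klein]
      omega
  | klein_alt h24 h4n hK hK' hA hA' =>
    refine toCon_covBy_of_pos hn rfl rfl ?_ fun w hw => ?_
    · rw [pos_normal, pos_normal, normalIndex_klein, normalIndex_alternatingGroup (by omega)]
      omega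
    · rw [pos_normal, normalIndex_klein] at hw
      rw [pos_normal, normalIndex_alternatingGroup (by omega)]
      omega

theorem toCon_covBy_top (hn : 2 ≤ n) {i j : Level} (h : i.Step j) :
    (top hn i).toCon ⋖ (top hn j).toCon := by
  refine toCon_covBy_of_pos hn (by rw [ker_top, ker_top]) (by rw [coker_top, coker_top]) ?_ ?_
  · rw [pos_top, pos_top]; exact pos_lt_of_step h
  · rw [pos_top, pos_top]; exact le_pos_of_step h

theorem toCon_covBy_mu (hn : 2 ≤ n) {i j : Level} (h : i.Step j) :
    (mu i : CongName n).toCon ⋖ (mu j).toCon := by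
  refine toCon_covBy_of_pos hn rfl rfl ?_ ?_
  · rw [pos_mu, pos_mu]; exact pos_lt_of_step h
  · rw [pos_mu, pos_mu]; exact le_pos_of_step h

theorem toCon_covBy_of_hasseEdge (hn : 2 ≤ n) {x y : CongName n} (h : HasseEdge hn x y) :
    x.toCon ⋖ y.toCon := by
  cases h with
  | mu_mu h => exact toCon_covBy_mu hn h
  | lam_lam h =>
    refine toCon_covBy_of_pos hn rfl rfl ?_ ?_
    · rw [pos_lam, pos_lam]; exact pos_lt_of_step h
    · rw [pos_lam, pos_lam]; exact le_pos_of_step h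
  | rho_rho h =>
    refine toCon_covBy_of_pos hn rfl rfl ?_ ?_
    · rw [pos_rho, pos_rho]; exact pos_lt_of_step h
    · rw [pos_rho, pos_rho]; exact le_pos_of_step h
  | top_top h => exact toCon_covBy_top hn h
  | mu_lam i => exact toCon_covBy_of_ker hn rfl rfl rfl (by rw [pos_mu, pos_lam])
  | mu_rho i => exact toCon_covBy_of_coker hn rfl rfl rfl (by rw [pos_mu, pos_rho])
  | lam_top i =>
    exact toCon_covBy_of_coker hn rfl (coker_top hn i) (ker_top hn i).symm (by rw [pos_top, pos_lam])
  | rho_top i =>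
    exact toCon_covBy_of_ker hn rfl (ker_top hn i) (coker_top hn i).symm (by rw [pos_top, pos_rho])
  | wick h => exact toCon_covBy_of_wickEdge hn h

theorem exists_step {i : Level} {y : CongName n} (h : i.pos < y.pos) (hy : y.pos ≤ 11) :
    ∃ j, i.Step j ∧ j.pos ≤ y.pos := by
  cases i
  · exact ⟨.one, .zero_one, le_pos_of_step .zero_one y h⟩
  · exact ⟨.symTwo, .one_symTwo, le_pos_of_step .one_symTwo y h⟩
  · exact absurd h (not_lt_of_ge hy)

theorem pos_le_eleven {y : CongName n} (h : ¬ (y.ker = true ∧ y.coker = true)) : y.pos ≤ 11 := by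
  have key : ∀ i : Level, i.pos ≤ 11 := fun i => by cases i <;> decide
  cases y with
  | rees => exact absurd ⟨rfl, rfl⟩ h
  | normal => exact absurd ⟨rfl, rfl⟩ h
  | lam i => rw [pos_lam]; exact key i
  | rho i => rw [pos_rho]; exact key i
  | mu i => rw [pos_mu]; exact key i

/-- Each member of the chain of `R`'s has an edge to the next occupied place. That `y` lies above
`x` guarantees that the chain has not ended, that is, `q < n` when `x` is `R_q`. -/
theorem exists_edge_of_top (hn : 2 ≤ n) {x y : CongName n} (hk : x.ker = true)
    (hc : x.coker = true) (h : x.pos < y.pos) :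
    ∃ z : CongName n, (WickEdge x z ∨ ∃ i j, i.Step j ∧ x = top hn i ∧ z = top hn j) ∧
      z.ker = true ∧ z.coker = true ∧ z.pos ≤ y.pos := by
  have hyn := y.pos_le hn
  have hyc := y.pos_cases
  cases x with
  | rees q hq =>
    by_cases h0 : q = 0
    · subst h0
      refine ⟨top hn .one, Or.inr ⟨.zero, .one, .zero_one, rfl, rfl⟩, rfl, rfl, ?_⟩
      rw [pos_top]
      exact le_pos_of_step .zero_one y (by rwa [← pos_top hn .zero])
    · by_cases h1 : q = 1
      · subst h1
        refine ⟨top hn .symTwo, Or.inr ⟨.one, .symTwo, .one_symTwo, rfl, rfl⟩, rfl, rfl, ?_⟩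
        rw [pos_top]
        exact le_pos_of_step .one_symTwo y (by rwa [← pos_top hn .one])
      · rw [pos_rees] at h
        by_cases h3 : q = 3
        · subst h3
          refine ⟨_, Or.inl (.rees_klein hq (by norm_num) (by omega) klein_normal klein_ne_bot),
            rfl, rfl, ?_⟩
          rw [pos_normal, normalIndex_klein]
          omega
        · refine ⟨_, Or.inl (.rees_alt q (by omega) h3 hq (by omega) (by omega) inferInstance
            (alternatingGroup_ne_bot (by omega))), rfl, rfl, ?_⟩
          rw [pos_normal, normalIndex_alternatingGroup (by omega)]
          rcases hyc with ⟨p, hp⟩ | ⟨p, -, hp⟩ | ⟨p, -, hp⟩ | hp <;> omega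
  | normal q h2 hq N hN hN' =>
    rcases pos_normal_cases h2 hq N hN hN' with ⟨rfl, hp⟩ | ⟨h3, rfl, hp⟩ | ⟨⟨rfl, rfl⟩, hp⟩
    · refine ⟨_, Or.inl (.sym_rees q h2 hq hN hN'), rfl, rfl, ?_⟩
      rw [pos_rees]
      omega
    · refine ⟨_, Or.inl (.alt_sym q h3 h2 hq hN hN' inferInstance (top_perm_ne_bot h2)),
        rfl, rfl, ?_⟩
      rw [pos_normal, normalIndex_top h2]
      omega
    · refine ⟨_, Or.inl (.klein_alt h2 hq hN hN' inferInstance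
        (alternatingGroup_ne_bot (by norm_num))), rfl, rfl, ?_⟩
      rw [pos_normal, normalIndex_alternatingGroup (by norm_num)]
      omega
  | lam i => cases hc
  | rho i => cases hk
  | mu i => cases hk

/-- If some flag of `x` is false where that of `y` is true, raise it. Otherwise the flags agree and
the place can be raised; when a flag is false, `y` is itself one of `λ`, `ρ`, `μ`, so the next level
is available. -/
theorem exists_hasseEdge (hn : 2 ≤ n) {x y : CongName n} (h : x.toCon < y.toCon) :
    ∃ z, HasseEdge hn x z ∧ z.toCon ≤ y.toCon := by
  obtain ⟨⟨h1, h2, h3⟩, h4⟩ := (toCon_lt_iff hn _ _).1 h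
  simp only [toCon_le_iff hn]
  have htop : x.ker = true → x.coker = true →
      ∃ z, HasseEdge hn x z ∧ z.ker ≤ y.ker ∧ z.coker ≤ y.coker ∧ z.pos ≤ y.pos := by
    intro hk hc
    have hyk : y.ker = true := by rw [hk] at h1; exact top_le_iff.1 h1
    have hyc : y.coker = true := by rw [hc] at h2; exact top_le_iff.1 h2
    obtain ⟨z, hz, hzk, hzc, hzp⟩ := exists_edge_of_top hn hk hc
      (lt_of_le_of_ne h3 fun h => h4 ⟨hk.trans hyk.symm, hc.trans hyc.symm, h⟩)
    refine ⟨z, ?_, by rw [hzk, hyk], by rw [hzc, hyc], hzp⟩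
    rcases hz with hz | ⟨i, j, hij, rfl, rfl⟩
    · exact .wick hz
    · exact .top_top hij
  cases x with
  | rees => exact htop rfl rfl
  | normal => exact htop rfl rfl
  | lam i =>
    have hyk : y.ker = true := top_le_iff.1 h1
    rw [pos_lam] at h3 h4
    rcases hyc : y.coker with _ | _
    · obtain ⟨j, hij, hj⟩ := exists_step (lt_of_le_of_ne h3 fun h => h4 ⟨hyk.symm, hyc.symm, h⟩)
        (pos_le_eleven fun h => by simp [hyc] at h)
      exact ⟨lam j, .lam_lam hij, h1, le_rfl, by rwa [pos_lam]⟩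
    · exact ⟨top hn i, .lam_top i, by rw [ker_top, hyk], by rw [coker_top], by rwa [pos_top]⟩
  | rho i =>
    have hyc : y.coker = true := top_le_iff.1 h2
    rw [pos_rho] at h3 h4
    rcases hyk : y.ker with _ | _
    · obtain ⟨j, hij, hj⟩ := exists_step (lt_of_le_of_ne h3 fun h => h4 ⟨hyk.symm, hyc.symm, h⟩)
        (pos_le_eleven fun h => by simp [hyk] at h)
      exact ⟨rho j, .rho_rho hij, le_rfl, h2, by rwa [pos_rho]⟩
    · exact ⟨top hn i, .rho_top i, by rw [ker_top], by rw [coker_top, hyc], by rwa [pos_top]⟩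
  | mu i =>
    rw [pos_mu] at h3 h4
    rcases hyk : y.ker with _ | _
    · rcases hyc : y.coker with _ | _
      · obtain ⟨j, hij, hj⟩ := exists_step (lt_of_le_of_ne h3 fun h => h4 ⟨hyk.symm, hyc.symm, h⟩)
          (pos_le_eleven fun h => by simp [hyk] at h)
        exact ⟨mu j, .mu_mu hij, le_rfl, le_rfl, by rwa [pos_mu]⟩
      · exact ⟨rho i, .mu_rho i, le_rfl, le_rfl, by rwa [pos_rho]⟩
    · exact ⟨lam i, .mu_lam i, le_rfl, Bool.false_le _, by rwa [pos_lam]⟩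

/-- Some edge leads from `x` to a `z` below or equal to `y`. Edges go strictly upwards, so a cover
leaves only `z = y`. -/
theorem toCon_covBy_iff (hn : 2 ≤ n) (x y : CongName n) :
    x.toCon ⋖ y.toCon ↔ HasseEdge hn x y := by
  refine ⟨fun h => ?_, toCon_covBy_of_hasseEdge hn⟩
  obtain ⟨z, hz, hzy⟩ := exists_hasseEdge hn h.lt
  obtain rfl : z = y := toCon_injective hn
    (hzy.eq_of_not_lt fun h' => h.2 (toCon_covBy_of_hasseEdge hn hz).lt h')
  exact hz

/-! ### The lattice of `*`-congruences -/

theorem coe_starCongruences (hn : 2 ≤ n) :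
    (starCongruences (PartitionMonoid n) : Set (Con (PartitionMonoid n))) =
      Set.univ \ {(lam .zero).toCon, (lam .one).toCon, (lam .symTwo).toCon,
        (rho .zero).toCon, (rho .one).toCon, (rho .symTwo).toCon} := by
  ext c
  obtain ⟨x, rfl⟩ := toCon_surjective hn c
  simp only [SetLike.mem_coe, toCon_mem_starCongruences_iff hn, Set.mem_sdiff, Set.mem_univ,
    true_and, Set.mem_insert_iff, Set.mem_singleton_iff, (toCon_injective hn).eq_iff]
  cases x with
  | rees => simp [ker, coker]
  | normal => simp [ker, coker]
  | lam i => cases i <;> simp [ker, coker]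
  | rho i => cases i <;> simp [ker, coker]
  | mu i => simp [ker, coker]

theorem covBy_star_of_covBy {x y : CongName n} (hx : x.toCon ∈ starCongruences (PartitionMonoid n))
    (hy : y.toCon ∈ starCongruences (PartitionMonoid n)) (h : x.toCon ⋖ y.toCon) :
    (⟨x.toCon, hx⟩ : starCongruences (PartitionMonoid n)) ⋖ ⟨y.toCon, hy⟩ :=
  ⟨h.1, fun _ h1 h2 => h.2 h1 h2⟩

theorem covBy_of_starHasseEdge (hn : 2 ≤ n) {x y : CongName n}
    (hx : x.toCon ∈ starCongruences (PartitionMonoid n))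
    (hy : y.toCon ∈ starCongruences (PartitionMonoid n)) (h : StarHasseEdge hn x y) :
    (⟨x.toCon, hx⟩ : starCongruences (PartitionMonoid n)) ⋖ ⟨y.toCon, hy⟩ := by
  cases h with
  | mu_mu h => exact covBy_star_of_covBy hx hy (toCon_covBy_mu hn h)
  | top_top h => exact covBy_star_of_covBy hx hy (toCon_covBy_top hn h)
  | wick h => exact covBy_star_of_covBy hx hy (toCon_covBy_of_wickEdge hn h)
  -- This edge is no cover among all congruences. A `*`-congruence in between has equal flags and
  -- the same place, hence equals one of the ends.
  | mu_top i =>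
    have hp : (mu i : CongName n).pos = (top hn i).pos := by rw [pos_mu, pos_top]
    refine ⟨(toCon_lt_iff hn _ _).2 ⟨⟨Bool.false_le _, Bool.false_le _, hp.le⟩, fun h => ?_⟩, ?_⟩
    · rw [ker_top] at h
      cases h.1
    · rintro ⟨c, hc⟩ h1 h2
      obtain ⟨w, rfl⟩ := toCon_surjective hn c
      obtain ⟨⟨a1, a2, a3⟩, a4⟩ := (toCon_lt_iff hn _ _).1 h1
      obtain ⟨⟨b1, b2, b3⟩, b4⟩ := (toCon_lt_iff hn _ _).1 h2
      have hw := (toCon_mem_starCongruences_iff hn w).1 hc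
      have e3 : (mu i).pos = w.pos := le_antisymm a3 (hp ▸ b3)
      rw [ker_top, coker_top] at b4
      rcases hk : w.ker with _ | _
      · exact a4 ⟨hk.symm, (hw ▸ hk).symm, e3⟩
      · exact b4 ⟨hk, hw ▸ hk, e3.symm.trans hp⟩

theorem exists_starHasseEdge (hn : 2 ≤ n) {x y : CongName n} (hx : x.ker = x.coker)
    (hy : y.ker = y.coker) (h : x.toCon < y.toCon) :
    ∃ z, z.ker = z.coker ∧ StarHasseEdge hn x z ∧ z.toCon ≤ y.toCon := by
  obtain ⟨⟨h1, h2, h3⟩, h4⟩ := (toCon_lt_iff hn _ _).1 h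
  simp only [toCon_le_iff hn]
  have htop : x.ker = true → x.coker = true → ∃ z, z.ker = z.coker ∧
      StarHasseEdge hn x z ∧ z.ker ≤ y.ker ∧ z.coker ≤ y.coker ∧ z.pos ≤ y.pos := by
    intro hk hc
    have hyk : y.ker = true := by rw [hk] at h1; exact top_le_iff.1 h1
    have hyc : y.coker = true := by rw [hc] at h2; exact top_le_iff.1 h2
    obtain ⟨z, hz, hzk, hzc, hzp⟩ := exists_edge_of_top hn hk hc
      (lt_of_le_of_ne h3 fun h => h4 ⟨hk.trans hyk.symm, hc.trans hyc.symm, h⟩)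
    refine ⟨z, hzk.trans hzc.symm, ?_, by rw [hzk, hyk], by rw [hzc, hyc], hzp⟩
    rcases hz with hz | ⟨i, j, hij, rfl, rfl⟩
    · exact .wick hz
    · exact .top_top hij
  cases x with
  | rees => exact htop rfl rfl
  | normal => exact htop rfl rfl
  | lam i => cases hx
  | rho i => cases hx
  | mu i =>
    rw [pos_mu] at h3 h4
    rcases hyk : y.ker with _ | _
    · have hyc := hy ▸ hyk
      obtain ⟨j, hij, hj⟩ := exists_step (lt_of_le_of_ne h3 fun h => h4 ⟨hyk.symm, hyc.symm, h⟩)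
        (pos_le_eleven fun h => by simp [hyk] at h)
      exact ⟨mu j, rfl, .mu_mu hij, le_rfl, Bool.false_le _, by rwa [pos_mu]⟩
    · have hyc := hy ▸ hyk
      exact ⟨top hn i, by rw [ker_top, coker_top], .mu_top i, by rw [ker_top],
        by rw [coker_top, hyc], by rwa [pos_top]⟩

theorem star_covBy_iff (hn : 2 ≤ n) (x y : CongName n)
    (hx : x.toCon ∈ starCongruences (PartitionMonoid n))
    (hy : y.toCon ∈ starCongruences (PartitionMonoid n)) :
    (⟨x.toCon, hx⟩ : starCongruences (PartitionMonoid n)) ⋖ ⟨y.toCon, hy⟩ ↔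
      StarHasseEdge hn x y := by
  refine ⟨fun h => ?_, covBy_of_starHasseEdge hn hx hy⟩
  obtain ⟨z, hz, hxz, hzy⟩ := exists_starHasseEdge hn ((toCon_mem_starCongruences_iff hn x).1 hx)
    ((toCon_mem_starCongruences_iff hn y).1 hy) h.lt
  have hz := (toCon_mem_starCongruences_iff hn z).2 hz
  obtain rfl : z = y := toCon_injective hn
    (hzy.eq_of_not_lt fun h' => h.2 (covBy_of_starHasseEdge hn hx hz hxz).lt
      (show (⟨z.toCon, hz⟩ : starCongruences (PartitionMonoid n)) < ⟨y.toCon, hy⟩ from h'))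
  exact hxz

end CongName

end PartitionMonoid

theorem corollary5 (n : ℕ) (hn : 2 ≤ n) :
    ∃ e : PartitionMonoid.CongName n ≃ Con (PartitionMonoid n),
      (∀ x : PartitionMonoid.CongName n, ⇑(e x) = x.toRel) ∧
      (∀ x y : PartitionMonoid.CongName n, e x ⋖ e y ↔ PartitionMonoid.HasseEdge hn x y) ∧
      (starCongruences (PartitionMonoid n) : Set (Con (PartitionMonoid n))) =
        Set.univ \ {e (.lam .zero), e (.lam .one), e (.lam .symTwo),
          e (.rho .zero), e (.rho .one), e (.rho .symTwo)} ∧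
      (∀ (x y : PartitionMonoid.CongName n) (hx : e x ∈ starCongruences (PartitionMonoid n))
        (hy : e y ∈ starCongruences (PartitionMonoid n)),
        (⟨e x, hx⟩ : starCongruences (PartitionMonoid n)) ⋖ ⟨e y, hy⟩ ↔
          PartitionMonoid.StarHasseEdge hn x y) := by
  open PartitionMonoid in
  refine ⟨Equiv.ofBijective CongName.toCon
    ⟨CongName.toCon_injective hn, CongName.toCon_surjective hn⟩, CongName.coe_toCon,
    CongName.toCon_covBy_iff hn, CongName.coe_starCongruences hn, CongName.star_covBy_iff hn⟩
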